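/- **Problem.** In *Weighted Directed Minimum $(k,n-k)$-Cut*, one is given a simple directed graph $G=(V,A)$ with $n$ vertices, arc weights $w\colon A\to\mathbb{N}$, and an integer $k$. For $L\subseteq V$ let $c(L)=\sum_{(u,v)\in A,\ u\notin L,\ v\in L} w((u,v))$ be the total weight of the arcs from $V\setminus L$ to $L$; the task is to find a set $L$ with $|L|=k$ that minimizes $c(L)$. A $(1+\varepsilon)$-approximation is a set $L$ with $|L|=k$ and $c(L)\le(1+\varepsilon)\,c(S)$ for every $S\subseteq V$ with $|S|=k$. Let $w_{\max}=\max_{a\in A}w(a)$. **Conventions.** Let $\omega$ be the matrix multiplication exponent, that is, the infimum of all real $\tau$ such that two $N\times N$ matrices over $\mathbb{Q}$ can be multiplied with $O(N^{\tau})$ additions, subtractions and multiplications. As usual, "time $O(2^{\omega n/3}\cdots)$" means time $O(2^{\tau n/3}\cdots)$ for every fixed real $\tau>\omega$. Running times are bit costs on a random access machine: each memory access, addition, subtraction or test costs an amount linear in the bit lengths of the indices and numbers involved, and each multiplication or division the product of the bit lengths of its operands. **Proposition.** For every real $\tau>\omega$ there are a single program $P$ and a constant $C$, both depending only on $\tau$,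 such that the following holds for every real $\varepsilon>0$, all integers $1\le k\le n$ and every arc-weighted simple directed graph $G$ with $n$ vertices and $w_{\max}\ge 2$. Given $(G,w,k)$ (adjacency and weight matrices) and the integer $\lceil 1/\varepsilon\rceil$, the program $P$ halts, outputs a $(1+\varepsilon)$-approximation for Weighted Directed Minimum $(k,n-k)$-Cut on $(G,w,k)$, and takes time at most $$C\cdot 2^{\tau n/3}\cdot\log(w_{\max})\cdot\max\{1,1/\varepsilon\}^2\cdot k^2 .$$ In short, Weighted Directed Minimum $(k,n-k)$-Cut can be $(1+\varepsilon)$-approximated in $O\bigl(2^{\omega n/3}\cdot\log(w_{\max})\cdot(1/\varepsilon)^2\cdot k^2\bigr)$ time. -/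

import Mathlib

/-! ### The matrix multiplication exponent -/

namespace Arith

/-- The three arithmetic operations of a division-free straight-line program. -/
inductive Op
  | add
  | sub
  | mul

/-- An operand: an input variable, a constant of the field, or the result of an earlier step. -/
inductive Operand (K ι : Type)
  | input (x : ι)
  | const (c : K)
  | result (i : ℕ)

/-- One step of a straight-line program: a single arithmetic operation on two operands. -/
structure Step (K ι : Type) where
  op : Op
  lhs : Operand K ι
  rhs : Operand K ι

/-- The value of an operand, where `acc` lists the results of the steps performed so far, in order
(an index that is out of range denotes the constant `0`). -/
def Operand.val {K ι : Type} [Field K] (inp : ι → K) (acc : List K) : Operand K ι → K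
  | .input x => inp x
  | .const c => c
  | .result i => acc.getD i 0

def Step.val {K ι : Type} [Field K] (inp : ι → K) (acc : List K) (s : Step K ι) : K :=
  match s.op with
  | .add => s.lhs.val inp acc + s.rhs.val inp acc
  | .sub => s.lhs.val inp acc - s.rhs.val inp acc
  | .mul => s.lhs.val inp acc * s.rhs.val inp acc

/-- The results of all steps of the straight-line program `p`, in order. -/
def results {K ι : Type} [Field K] (inp : ι → K) (p : List (Step K ι)) : List K :=
  p.foldl (fun acc s => acc ++ [s.val inp acc]) []

/-- The input variables for the product of two `N × N` matrices `A`, `B`: the entries of `A` are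
indexed by `Sum.inl (i, j)`, the entries of `B` by `Sum.inr (i, j)`. -/
abbrev MatVars (N : ℕ) : Type := (Fin N × Fin N) ⊕ (Fin N × Fin N)

def matInput {K : Type} {N : ℕ} (A B : Matrix (Fin N) (Fin N) K) : MatVars N → K
  | .inl ij => A ij.1 ij.2
  | .inr ij => B ij.1 ij.2

/-- The straight-line program `p` with output operands `out` computes the product of any two
`N × N` matrices over `K`. -/
def ComputesMatMul {K : Type} [Field K] {N : ℕ} (p : List (Step K (MatVars N)))
    (out : Fin N → Fin N → Operand K (MatVars N)) : Prop :=
  ∀ (A B : Matrix (Fin N) (Fin N) K) (i j : Fin N),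
    (out i j).val (matInput A B) (results (matInput A B) p) = (A * B) i j

/-- The matrix multiplication exponent `ω` (over the rationals): the infimum of all real `τ` such
that the product of two `N × N` matrices can be computed with `O(N ^ τ)` arithmetic operations. -/
noncomputable def matMulExponent : ℝ :=
  sInf {τ : ℝ | ∃ C : ℝ, ∀ N : ℕ, ∃ (p : List (Step ℚ (MatVars N)))
    (out : Fin N → Fin N → Operand ℚ (MatVars N)),
      ComputesMatMul p out ∧ (p.length : ℝ) ≤ C * (N : ℝ) ^ τ}

end Arith

/-! ### A random access machine with logarithmic (bit) cost

The memory consists of arrays of cells, each cell holding a natural number; a program refers to its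
(finitely many) arrays by fixed names and to the cells of an array by computed indices. Every
access and every operation is charged by the bit lengths of the indices and numbers involved. -/

namespace RAM

/-- `m a i` is the content of cell `i` of array `a`. -/
abbrev Mem : Type := ℕ → ℕ → ℕ

/-- One plus the number of binary digits. -/
def len (x : ℕ) : ℕ := Nat.size x + 1

inductive Expr
  | const (c : ℕ)
  | load (a : ℕ) (idx : Expr)
  | add (e₁ e₂ : Expr)
  | sub (e₁ e₂ : Expr)
  | mul (e₁ e₂ : Expr)
  | div (e₁ e₂ : Expr)

/-- Values of expressions; subtraction is truncated, division is integer division (`x / 0 = 0`). -/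
def Expr.eval (m : Mem) : Expr → ℕ
  | .const c => c
  | .load a idx => m a (idx.eval m)
  | .add e₁ e₂ => e₁.eval m + e₂.eval m
  | .sub e₁ e₂ => e₁.eval m - e₂.eval m
  | .mul e₁ e₂ => e₁.eval m * e₂.eval m
  | .div e₁ e₂ => e₁.eval m / e₂.eval m

/-- The cost of evaluating an expression: linear in the bit lengths for memory access, addition and
subtraction, and the product of the bit lengths for multiplication and division. -/
def Expr.cost (m : Mem) : Expr → ℕ
  | .const c => len c
  | .load a idx => idx.cost m + len (idx.eval m) + len (m a (idx.eval m))
  | .add e₁ e₂ => e₁.cost m + e₂.cost m + (len (e₁.eval m) + len (e₂.eval m))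
  | .sub e₁ e₂ => e₁.cost m + e₂.cost m + (len (e₁.eval m) + len (e₂.eval m))
  | .mul e₁ e₂ => e₁.cost m + e₂.cost m + len (e₁.eval m) * len (e₂.eval m)
  | .div e₁ e₂ => e₁.cost m + e₂.cost m + len (e₁.eval m) * len (e₂.eval m)

inductive Prog
  | skip
  | store (a : ℕ) (idx val : Expr)
  | seq (p₁ p₂ : Prog)
  | ite (e : Expr) (p₁ p₂ : Prog)
  | while (e : Expr) (p : Prog)

/-- `m` with cell `i` of array `a` overwritten by `x`. -/
def Mem.set (m : Mem) (a i x : ℕ) : Mem :=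
  Function.update m a (Function.update (m a) i x)

/-- `Exec p m t m'`: started in memory `m`, the program `p` halts in memory `m'`, and the total cost
of this (unique) computation is `t`. A test succeeds if its value is nonzero. -/
inductive Exec : Prog → Mem → ℕ → Mem → Prop
  | skip (m : Mem) : Exec .skip m 1 m
  | store (a : ℕ) (idx val : Expr) (m : Mem) :
      Exec (.store a idx val) m
        (idx.cost m + val.cost m + len (idx.eval m) + len (val.eval m))
        (m.set a (idx.eval m) (val.eval m))
  | seq {p₁ p₂ : Prog} {m₀ m₁ m₂ : Mem} {t₁ t₂ : ℕ} :
      Exec p₁ m₀ t₁ m₁ → Exec p₂ m₁ t₂ m₂ → Exec (.seq p₁ p₂) m₀ (t₁ + t₂) m₂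
  | ite_true {e : Expr} {p₁ p₂ : Prog} {m m' : Mem} {t : ℕ} :
      e.eval m ≠ 0 → Exec p₁ m t m' →
      Exec (.ite e p₁ p₂) m (e.cost m + len (e.eval m) + t) m'
  | ite_false {e : Expr} {p₁ p₂ : Prog} {m m' : Mem} {t : ℕ} :
      e.eval m = 0 → Exec p₂ m t m' →
      Exec (.ite e p₁ p₂) m (e.cost m + len (e.eval m) + t) m'
  | while_true {e : Expr} {p : Prog} {m₀ m₁ m₂ : Mem} {t₁ t₂ : ℕ} :
      e.eval m₀ ≠ 0 → Exec p m₀ t₁ m₁ → Exec (.while e p) m₁ t₂ m₂ →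
      Exec (.while e p) m₀ (e.cost m₀ + len (e.eval m₀) + t₁ + t₂) m₂
  | while_false {e : Expr} {p : Prog} {m : Mem} :
      e.eval m = 0 → Exec (.while e p) m (e.cost m + len (e.eval m)) m

end RAM

/-! ### Weighted Directed Minimum `(k, n - k)`-Cut -/

/-- A simple directed graph on the vertex set `Fin n` (no loops, no parallel arcs, opposite arcs
allowed) with natural numbers as arc weights. -/
structure ArcWeightedDigraph (n : ℕ) where
  arcs : Finset (Fin n × Fin n)
  loopless : ∀ v : Fin n, (v, v) ∉ arcs
  weight : arcs → ℕ

namespace ArcWeightedDigraph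

/-- The largest arc weight (`0` if there is no arc). -/
def wMax {n : ℕ} (G : ArcWeightedDigraph n) : ℕ := Finset.univ.sup G.weight

/-- The total weight of the arcs from `V \ L` to `L`. -/
def cutWeight {n : ℕ} (G : ArcWeightedDigraph n) (L : Finset (Fin n)) : ℕ :=
  ∑ a : G.arcs, if a.1.1 ∉ L ∧ a.1.2 ∈ L then G.weight a else 0

/-- `L` is a solution of size `k` whose weight is at most `1 + ε` times the minimum. -/
def IsApproxMinCut {n : ℕ} (G : ArcWeightedDigraph n) (k : ℕ) (ε : ℝ) (L : Finset (Fin n)) : Prop :=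
  L.card = k ∧ ∀ S : Finset (Fin n), S.card = k →
    (G.cutWeight L : ℝ) ≤ (1 + ε) * (G.cutWeight S : ℝ)

/-- The initial memory for the instance `(G, k)` with integer precision parameter `q`: array `0`
holds `n, k, q` in its first three cells, array `1` holds the adjacency matrix and array `2` the
matrix of arc weights, both row by row; everything else is `0`. -/
def encode {n : ℕ} (G : ArcWeightedDigraph n) (k q : ℕ) : RAM.Mem := fun a i =>
  match a with
  | 0 => match i with
    | 0 => n
    | 1 => k
    | 2 => q
    | _ => 0
  | 1 => ∑ e : G.arcs, if i = e.1.1.val * n + e.1.2.val then 1 else 0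
  | 2 => ∑ e : G.arcs, if i = e.1.1.val * n + e.1.2.val then G.weight e else 0
  | _ => 0

/-- The vertex set that a final memory describes: `v` belongs to it if and only if cell `v` of
array `3` is nonzero. -/
def output (n : ℕ) (m : RAM.Mem) : Finset (Fin n) :=
  Finset.univ.filter fun v => m 3 v.val ≠ 0

end ArcWeightedDigraph

/-! Let q = ⌈1/ε⌉, so that 1/q ≤ ε. The largest weight θ of an arc in an optimal cut S is guessed by
running through all entries of the weight matrix. Every weight w is replaced by ⌈wQ/θ⌉, capped at K,
where Q = n²q. Rounding adds at most θ to each wQ, hence at most n²θ ≤ n²c(S) to Q·c(S). A set L of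
size k that minimizes the rounded weight therefore satisfies Q·c(L) ≤ (Q + n²)·c(S), that is, q·c(L)
≤ (q + 1)·c(S). The cap exceeds the rounded weight of S, so no arc cut by L is truncated
(`IsCand.approx`). Among the sets found for the different guesses the best true weight is kept, so
the right guess need not be known.

The rounded weight is minimized by matrix multiplication. The vertices are split into three blocks
of about n/3, so a set is a triple (x, y, z) of parts, with N choices for each. Arcs inside the
first two blocks, remaining arcs inside the last two, and arcs between the outer blocks split the
weight into f(x,y) + g(y,z) + h(x,z) (`cost_whole`). For fixed values of |y|, f and g, the product
of two 0-1 matrices tells for which (x, z) a suitable y exists; the least f + g + h is then read off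
(`runs_solveProg`, `exists_isCand`), and y is recovered by trying all N middle parts
(`runs_finalProg`). Rounded cuts have weight O(n⁶q), so there are poly(n)·q² matrix products of
dimension N.

For ω < σ < τ a straight-line program from the definition of ω yields, through its part of degree
two, a bilinear algorithm for matrices of one fixed dimension 2^e with at most 2^(σe) products
(`exists_scheme`). It is applied recursively, all blocks of one recursion level being treated as one
layer (`IsScheme.layers`), modulo a number exceeding all entries of the result (`runs_mulProg`). The
gap between σ and τ absorbs all polynomials in n.

For the bit cost, all numbers other than weights and cut weights stay below some Ω = 2^O(n), and
those below Ξ = Ω·w_max. No product or quotient has two large operands, so each operation costs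
O(len Ω · len Ξ), which is linear in log w_max (`Expr.cost_le`). This needs q < 2^n. For q ≥ 2^n an
exhaustive search costs q·polylog(q)·log w_max and fits into the allowance q²
(`exists_brute_bound`). The factor k² enters only through k² ≥ 1. -/

namespace RAM

/-! ### Bit lengths of sums and products. -/

theorem one_le_len (x : ℕ) : 1 ≤ len x := by simp [len]

theorem len_mono {x y : ℕ} (h : x ≤ y) : len x ≤ len y := by
  simpa [len] using Nat.size_le_size h

theorem len_add_le (x y : ℕ) : len (x + y) ≤ len x + len y := by
  have hx := Nat.lt_size_self x
  have hy := Nat.lt_size_self y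
  have h : (x + y).size ≤ x.size + y.size + 1 := by
    rw [Nat.size_le, pow_succ, pow_add]
    have h1 : 1 ≤ 2 ^ x.size := Nat.one_le_two_pow
    have h2 : 1 ≤ 2 ^ y.size := Nat.one_le_two_pow
    nlinarith
  simp only [len]; omega

theorem len_mul_le (x y : ℕ) : len (x * y) ≤ len x + len y := by
  have hx := Nat.lt_size_self x
  have hy := Nat.lt_size_self y
  have h : (x * y).size ≤ x.size + y.size := by
    rw [Nat.size_le, pow_add]
    exact Nat.mul_lt_mul'' hx hy
  simp only [len]; omega

/-! ### Memory updates -/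

@[simp] theorem Mem.set_of_ne (m : Mem) {a a' : ℕ} (h : a' ≠ a) (i x : ℕ) :
    m.set a i x a' = m a' := by simp [Mem.set, h]

@[simp] theorem Mem.set_self (m : Mem) (a i x : ℕ) : m.set a i x a i = x := by simp [Mem.set]

theorem Mem.set_apply (m : Mem) (a i x i' : ℕ) :
    m.set a i x a i' = if i' = i then x else m a i' := by
  simp [Mem.set, Function.update_apply]

@[simp] theorem Mem.set_self_of_ne (m : Mem) {i i' : ℕ} (h : i' ≠ i) (a x : ℕ) :
    m.set a i x a i' = m a i' := by simp [Mem.set, h]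

/-! ### Derived expressions -/

/-- The scalar stored in cell `0` of array `a`. -/
@[reducible] def Expr.var (a : ℕ) : Expr := .load a (.const 0)

@[simp] theorem Expr.eval_const (m : Mem) (c : ℕ) : (Expr.const c).eval m = c := rfl
@[simp] theorem Expr.eval_load (m : Mem) (a : ℕ) (e : Expr) :
    (Expr.load a e).eval m = m a (e.eval m) := rfl
@[simp] theorem Expr.eval_add (m : Mem) (e₁ e₂ : Expr) :
    (Expr.add e₁ e₂).eval m = e₁.eval m + e₂.eval m := rfl
@[simp] theorem Expr.eval_sub (m : Mem) (e₁ e₂ : Expr) :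
    (Expr.sub e₁ e₂).eval m = e₁.eval m - e₂.eval m := rfl
@[simp] theorem Expr.eval_mul (m : Mem) (e₁ e₂ : Expr) :
    (Expr.mul e₁ e₂).eval m = e₁.eval m * e₂.eval m := rfl
@[simp] theorem Expr.eval_div (m : Mem) (e₁ e₂ : Expr) :
    (Expr.div e₁ e₂).eval m = e₁.eval m / e₂.eval m := rfl

/-- Remainder. -/
def Expr.mod (e₁ e₂ : Expr) : Expr := .sub e₁ (.mul e₂ (.div e₁ e₂))

@[simp] theorem Expr.eval_mod (m : Mem) (e₁ e₂ : Expr) :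
    (Expr.mod e₁ e₂).eval m = e₁.eval m % e₂.eval m := by
  simp only [Expr.mod, Expr.eval_sub, Expr.eval_mul, Expr.eval_div]
  have := Nat.div_add_mod (e₁.eval m) (e₂.eval m)
  omega

/-- `1` if the value is `0`, and `0` otherwise. -/
def Expr.isZero (e : Expr) : Expr := .sub (.const 1) e

@[simp] theorem Expr.eval_isZero (m : Mem) (e : Expr) :
    e.isZero.eval m = if e.eval m = 0 then 1 else 0 := by
  simp only [Expr.isZero, Expr.eval_sub, Expr.eval_const]
  split_ifs <;> omega

/-- Equality test. -/
def Expr.eq (e₁ e₂ : Expr) : Expr := .isZero (.add (.sub e₁ e₂) (.sub e₂ e₁))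

@[simp] theorem Expr.eval_eq (m : Mem) (e₁ e₂ : Expr) :
    (Expr.eq e₁ e₂).eval m = if e₁.eval m = e₂.eval m then 1 else 0 := by
  simp only [Expr.eq, Expr.eval_isZero, Expr.eval_add, Expr.eval_sub]
  congr 1
  simp only [eq_iff_iff]; omega

/-- Strict comparison. -/
def Expr.lt (e₁ e₂ : Expr) : Expr := .isZero (.isZero (.sub e₂ e₁))

@[simp] theorem Expr.eval_lt (m : Mem) (e₁ e₂ : Expr) :
    (Expr.lt e₁ e₂).eval m = if e₁.eval m < e₂.eval m then 1 else 0 := by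
  simp only [Expr.lt, Expr.eval_isZero, Expr.eval_sub]
  by_cases h : e₁.eval m < e₂.eval m
  · have h' : e₂.eval m - e₁.eval m ≠ 0 := by omega
    simp [h, h']
  · have h' : e₂.eval m - e₁.eval m = 0 := by omega
    simp [h, h']

/-- The sum of `c` expressions. -/
def Expr.sum : ℕ → (ℕ → Expr) → Expr
  | 0, _ => .const 0
  | c + 1, g => .add (Expr.sum c g) (g c)

@[simp] theorem Expr.eval_sum (m : Mem) (c : ℕ) (g : ℕ → Expr) :
    (Expr.sum c g).eval m = ∑ j ∈ Finset.range c, (g j).eval m := by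
  induction c with
  | zero => rfl
  | succ c ih => rw [Finset.sum_range_succ, ← ih]; rfl

/-! ### Cost bounds -/

/-- The arrays that may hold numbers of unrestricted size. -/
@[simp] def isBig (a : ℕ) : Prop := a = 2 ∨ a = 32 ∨ a = 36 ∨ a = 39

instance : DecidablePred isBig := fun a => by unfold isBig; infer_instance

/-- The expression reads no array of large numbers. -/
def Expr.Small : Expr → Prop
  | .const _ => True
  | .load a e => ¬ isBig a ∧ e.Small
  | .add e₁ e₂ | .sub e₁ e₂ | .mul e₁ e₂ | .div e₁ e₂ => e₁.Small ∧ e₂.Small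

/-- Every product and every quotient has an operand that reads no array of large numbers. -/
def Expr.Ok : Expr → Prop
  | .const _ => True
  | .load _ e => e.Ok
  | .add e₁ e₂ | .sub e₁ e₂ => e₁.Ok ∧ e₂.Ok
  | .mul e₁ e₂ | .div e₁ e₂ => e₁.Ok ∧ e₂.Ok ∧ (e₁.Small ∨ e₂.Small)

/-- A size measure of expressions that bounds their costs. -/
def Expr.wt : Expr → ℕ
  | .const c => len c
  | .load _ e => 2 * e.wt + 1
  | .add e₁ e₂ | .sub e₁ e₂ | .mul e₁ e₂ | .div e₁ e₂ =>
      2 * (e₁.wt + e₂.wt) + e₁.wt * e₂.wt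

/-- The bound on the content of the cells of array `a`. -/
def lim (Ω Ξ a : ℕ) : ℕ := if isBig a then Ξ else Ω

/-- All cells of the memory respect their bounds. -/
def Bdd (Ω Ξ : ℕ) (m : Mem) : Prop := ∀ a i, m a i ≤ lim Ω Ξ a

theorem lim_le {Ω Ξ : ℕ} (h : Ω ≤ Ξ) (a : ℕ) : lim Ω Ξ a ≤ Ξ := by
  unfold lim; split_ifs <;> omega

theorem le_lim {Ω Ξ : ℕ} (h : Ω ≤ Ξ) (a : ℕ) : Ω ≤ lim Ω Ξ a := by
  unfold lim; split_ifs <;> omega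

theorem Bdd.set {Ω Ξ : ℕ} {m : Mem} (h : Bdd Ω Ξ m) {a x : ℕ} (i : ℕ) (hx : x ≤ lim Ω Ξ a) :
    Bdd Ω Ξ (m.set a i x) := by
  intro a' i'
  by_cases ha : a' = a
  · subst ha
    rw [Mem.set_apply]
    split_ifs
    · exact hx
    · exact h _ _
  · rw [Mem.set_of_ne _ ha]; exact h _ _

/-- Every operation at most adds bit lengths, up to the constants collected in `Expr.wt`. The
predicate `S` lets one induction serve two bounds: all arrays have length at most `b`, or only the
arrays of small numbers do and the expression reads no others. -/
theorem Expr.len_eval_le {m : Mem} {b : ℕ} (hb : 1 ≤ b) (S : ℕ → Prop)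
    (hm : ∀ a, S a → ∀ i, len (m a i) ≤ b) (e : Expr)
    (he : (∀ a, S a) ∨ (e.Small ∧ ∀ a, ¬ isBig a → S a)) : len (e.eval m) ≤ e.wt * b := by
  induction e with
  | const c => exact Nat.le_mul_of_pos_right _ hb
  | load a e ih =>
    have hS : S a := by
      rcases he with h | ⟨h, h'⟩
      · exact h a
      · exact h' a h.1
    have := hm a hS (e.eval m)
    simp only [Expr.wt, Expr.eval_load]
    nlinarith
  | add e₁ e₂ ih₁ ih₂ | mul e₁ e₂ ih₁ ih₂ =>
    have h1 := ih₁ (he.imp_right fun h => ⟨h.1.1, h.2⟩)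
    have h2 := ih₂ (he.imp_right fun h => ⟨h.1.2, h.2⟩)
    have h3 := len_add_le (e₁.eval m) (e₂.eval m)
    have h4 := len_mul_le (e₁.eval m) (e₂.eval m)
    simp only [Expr.wt, Expr.eval_add, Expr.eval_mul]
    calc _ ≤ e₁.wt * b + e₂.wt * b := by omega
      _ ≤ _ := by rw [← add_mul]; exact Nat.mul_le_mul_right _ (by nlinarith)
  | sub e₁ e₂ ih₁ ih₂ | div e₁ e₂ ih₁ ih₂ =>
    have h1 := ih₁ (he.imp_right fun h => ⟨h.1.1, h.2⟩)
    have h3 : len (e₁.eval m - e₂.eval m) ≤ _ := len_mono (Nat.sub_le _ _)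
    have h4 : len (e₁.eval m / e₂.eval m) ≤ _ := len_mono (Nat.div_le_self _ _)
    simp only [Expr.wt, Expr.eval_sub, Expr.eval_div]
    calc _ ≤ e₁.wt * b := by omega
      _ ≤ _ := Nat.mul_le_mul_right _ (by nlinarith)

section bounds

variable {Ω Ξ : ℕ} {m : Mem}

theorem Expr.len_eval_le_big (hΩ : Ω ≤ Ξ) (hm : Bdd Ω Ξ m) (e : Expr) :
    len (e.eval m) ≤ e.wt * len Ξ :=
  e.len_eval_le (one_le_len _) (fun _ => True)
    (fun a _ i => len_mono ((hm a i).trans (lim_le hΩ a))) (Or.inl fun _ => trivial)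

theorem Expr.len_eval_le_small (hm : Bdd Ω Ξ m) (e : Expr) (he : e.Small) :
    len (e.eval m) ≤ e.wt * len Ω :=
  e.len_eval_le (one_le_len _) (fun a => ¬ isBig a)
    (fun a ha i => len_mono ((hm a i).trans (by unfold lim; rw [if_neg ha])))
    (Or.inr ⟨he, fun _ h => h⟩)

theorem Expr.len_eval_le_unit (hΩ : Ω ≤ Ξ) (hm : Bdd Ω Ξ m) (e : Expr) :
    len (e.eval m) ≤ e.wt * (len Ω * len Ξ) :=
  (e.len_eval_le_big hΩ hm).trans
    (Nat.mul_le_mul_left _ (Nat.le_mul_of_pos_left _ (one_le_len _)))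

/-- Since one operand of each product or quotient is small, the product of the bit lengths contains
`len Ξ` only once. A quadratic dependence on `len Ξ` would give the square of log w_max. -/
theorem Expr.cost_le (hΩ : Ω ≤ Ξ) (hm : Bdd Ω Ξ m) (e : Expr) (he : e.Ok) :
    e.cost m ≤ e.wt * (len Ω * len Ξ) := by
  have hU : 1 ≤ len Ω * len Ξ := Nat.mul_pos (one_le_len _) (one_le_len _)
  induction e with
  | const c => exact Nat.le_mul_of_pos_right _ hU
  | load a e ih =>
    have h1 := ih he
    have h2 := e.len_eval_le_unit hΩ hm
    have h3 := (Expr.load a e).len_eval_le_big hΩ hm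
    have h4 : len (m a (e.eval m)) ≤ len Ξ := len_mono ((hm a _).trans (lim_le hΩ a))
    have h5 : len Ξ ≤ len Ω * len Ξ := Nat.le_mul_of_pos_left _ (one_le_len _)
    simp only [Expr.wt, Expr.cost]
    nlinarith
  | add e₁ e₂ ih₁ ih₂ | sub e₁ e₂ ih₁ ih₂ =>
    have h1 := ih₁ he.1
    have h2 := ih₂ he.2
    have h3 := e₁.len_eval_le_unit hΩ hm
    have h4 := e₂.len_eval_le_unit hΩ hm
    simp only [Expr.wt, Expr.cost]
    calc _ ≤ 2 * (e₁.wt + e₂.wt) * (len Ω * len Ξ) := by nlinarith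
      _ ≤ _ := Nat.mul_le_mul_right _ (by omega)
  | mul e₁ e₂ ih₁ ih₂ | div e₁ e₂ ih₁ ih₂ =>
    have h1 := ih₁ he.1
    have h2 := ih₂ he.2.1
    have h3 : len (e₁.eval m) * len (e₂.eval m) ≤ e₁.wt * e₂.wt * (len Ω * len Ξ) := by
      rcases he.2.2 with h | h
      · calc _ ≤ (e₁.wt * len Ω) * (e₂.wt * len Ξ) :=
              Nat.mul_le_mul (e₁.len_eval_le_small hm h) (e₂.len_eval_le_big hΩ hm)
          _ = _ := by ring
      · calc _ ≤ (e₁.wt * len Ξ) * (e₂.wt * len Ω) :=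
              Nat.mul_le_mul (e₁.len_eval_le_big hΩ hm) (e₂.len_eval_le_small hm h)
          _ = _ := by ring
    simp only [Expr.wt, Expr.cost]
    nlinarith

end bounds

/-! ### Timed total correctness -/

/-- All expressions of the program are `Ok`. -/
def Prog.Ok : Prog → Prop
  | .skip => True
  | .store _ idx val => idx.Ok ∧ val.Ok
  | .seq p₁ p₂ => p₁.Ok ∧ p₂.Ok
  | .ite e p₁ p₂ => e.Ok ∧ p₁.Ok ∧ p₂.Ok
  | .while e p => e.Ok ∧ p.Ok

/-- A size measure of programs. -/
def Prog.wt : Prog → ℕ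
  | .skip => 1
  | .store _ idx val => 2 * (idx.wt + val.wt)
  | .seq p₁ p₂ => p₁.wt + p₂.wt
  | .ite e p₁ p₂ => 2 * e.wt + p₁.wt + p₂.wt
  | .while e p => 2 * e.wt + p.wt

/-- The arrays that the program may write to. -/
def Prog.writes : Prog → List ℕ
  | .skip => []
  | .store a _ _ => [a]
  | .seq p₁ p₂ => p₁.writes ++ p₂.writes
  | .ite _ p₁ p₂ => p₁.writes ++ p₂.writes
  | .while _ p => p.writes

/-- Started in `m`, the program halts in a memory satisfying `Q`, keeps the bounds on the cells,
writes only to its arrays, and takes time at most its size times `c` cost units. -/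
def Runs (Ω Ξ c : ℕ) (P : Prog) (m : Mem) (Q : Mem → Prop) : Prop :=
  P.Ok → Bdd Ω Ξ m → ∃ t m', Exec P m t m' ∧ t ≤ P.wt * (len Ω * len Ξ * c) ∧ Bdd Ω Ξ m' ∧
    (∀ a, a ∉ P.writes → m' a = m a) ∧ Q m'

section rules

variable {Ω Ξ c : ℕ} {m : Mem} {Q : Mem → Prop}

/-- The new postcondition may use the cell bounds and the frame condition of the final memory. In
this way facts about untouched arrays pass from one subprogram to the next. -/
theorem Runs.mono {c' : ℕ} {P : Prog} {Q' : Mem → Prop} (h : Runs Ω Ξ c P m Q) (hc : c ≤ c')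
    (hQ : ∀ m', Bdd Ω Ξ m' → (∀ a, a ∉ P.writes → m' a = m a) → Q m' → Q' m') :
    Runs Ω Ξ c' P m Q' := by
  intro hP hm
  obtain ⟨t, m', h1, h2, h3, h4, h5⟩ := h hP hm
  exact ⟨t, m', h1, h2.trans (Nat.mul_le_mul_left _ (Nat.mul_le_mul_left _ hc)), h3, h4,
    hQ m' h3 h4 h5⟩

theorem Runs.of_bdd {P : Prog} (h : Bdd Ω Ξ m → Runs Ω Ξ c P m Q) : Runs Ω Ξ c P m Q :=
  fun hP hm => h hm hP hm

theorem Runs.skip (hc : 1 ≤ c) (h : Q m) : Runs Ω Ξ c .skip m Q := fun _ hm =>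
  ⟨1, m, .skip m, by
    have : 1 ≤ len Ω * len Ξ * c :=
      Nat.mul_pos (Nat.mul_pos (one_le_len _) (one_le_len _)) hc
    simpa [Prog.wt] using this, hm, fun _ _ => rfl, h⟩

theorem Runs.store (hΩ : Ω ≤ Ξ) (hc : 1 ≤ c) {a : ℕ} {idx val : Expr}
    (hv : val.eval m ≤ lim Ω Ξ a) (h : Q (m.set a (idx.eval m) (val.eval m))) :
    Runs Ω Ξ c (.store a idx val) m Q := fun hP hm =>
  ⟨_, _, .store a idx val m, by
    have h1 := idx.cost_le hΩ hm hP.1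
    have h2 := val.cost_le hΩ hm hP.2
    have h3 := idx.len_eval_le_unit hΩ hm
    have h4 := val.len_eval_le_unit hΩ hm
    have h5 : len Ω * len Ξ ≤ len Ω * len Ξ * c := Nat.le_mul_of_pos_right _ hc
    simp only [Prog.wt]
    calc _ ≤ 2 * (idx.wt + val.wt) * (len Ω * len Ξ) := by nlinarith
      _ ≤ _ := Nat.mul_le_mul_left _ h5, hm.set _ hv, fun a' ha => by
    simp only [Prog.writes, List.mem_singleton] at ha
    exact Mem.set_of_ne _ ha _ _, h⟩

/-- The postcondition of the first program is that the second one runs, so that proofs can follow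
the program text. Both parts share the factor `c` because `Prog.wt` is additive. -/
theorem Runs.seq {p₁ p₂ : Prog}
    (h : Runs Ω Ξ c p₁ m fun m₁ => (∀ a, a ∉ p₁.writes → m₁ a = m a) → Runs Ω Ξ c p₂ m₁ Q) :
    Runs Ω Ξ c (.seq p₁ p₂) m Q := by
  intro hP hm
  obtain ⟨t₁, m₁, e₁, ht₁, hb₁, hf₁, h₁⟩ := h hP.1 hm
  obtain ⟨t₂, m₂, e₂, ht₂, hb₂, hf₂, h₂⟩ := h₁ hf₁ hP.2 hb₁
  refine ⟨_, _, .seq e₁ e₂, ?_, hb₂, fun a ha => ?_, h₂⟩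
  · simp only [Prog.wt, add_mul]; omega
  · simp only [Prog.writes, List.mem_append, not_or] at ha
    rw [hf₂ a ha.2, hf₁ a ha.1]

theorem Runs.store_seq (hΩ : Ω ≤ Ξ) (hc : 1 ≤ c) {a : ℕ} {idx val : Expr} {p : Prog}
    (hv : val.eval m ≤ lim Ω Ξ a)
    (h : Runs Ω Ξ c p (m.set a (idx.eval m) (val.eval m)) Q) :
    Runs Ω Ξ c (.seq (.store a idx val) p) m Q :=
  Runs.seq (Runs.store hΩ hc hv fun _ => h)

theorem Runs.ite (hΩ : Ω ≤ Ξ) (hc : 1 ≤ c) {e : Expr} {p₁ p₂ : Prog}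
    (h₁ : e.eval m ≠ 0 → Runs Ω Ξ c p₁ m Q) (h₂ : e.eval m = 0 → Runs Ω Ξ c p₂ m Q) :
    Runs Ω Ξ c (.ite e p₁ p₂) m Q := by
  intro hP hm
  have hc1 := e.cost_le hΩ hm hP.1
  have hc2 := e.len_eval_le_unit hΩ hm
  have h5 : len Ω * len Ξ ≤ len Ω * len Ξ * c := Nat.le_mul_of_pos_right _ hc
  have h6 : e.cost m + len (e.eval m) ≤ 2 * e.wt * (len Ω * len Ξ * c) := by
    calc _ ≤ 2 * e.wt * (len Ω * len Ξ) := by nlinarith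
      _ ≤ _ := Nat.mul_le_mul_left _ h5
  by_cases h : e.eval m = 0
  · obtain ⟨t, m', e', ht, hb, hf, h'⟩ := h₂ h hP.2.2 hm
    refine ⟨_, _, .ite_false h e', ?_, hb, fun a ha => hf a ?_, h'⟩
    · simp only [Prog.wt, add_mul] at *; omega
    · simp only [Prog.writes, List.mem_append, not_or] at ha; exact ha.2
  · obtain ⟨t, m', e', ht, hb, hf, h'⟩ := h₁ h hP.2.1 hm
    refine ⟨_, _, .ite_true h e', ?_, hb, fun a ha => hf a ?_, h'⟩
    · simp only [Prog.wt, add_mul] at *; omega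
    · simp only [Prog.writes, List.mem_append, not_or] at ha; exact ha.1

/-- `for i = 0, ..., bnd - 1 do body`, where the counter `i` and the bound are scalars. -/
def Prog.forLoop (i bnd : ℕ) (body : Prog) : Prog :=
  .seq (.store i (.const 0) (.const 0))
    (.while (.sub (.var bnd) (.var i))
      (.seq body (.store i (.const 0) (.add (.var i) (.const 1)))))

theorem Prog.writes_forLoop (i bnd : ℕ) (body : Prog) :
    (Prog.forLoop i bnd body).writes = i :: (body.writes ++ [i]) := rfl

theorem Prog.ok_forLoop (i bnd : ℕ) (body : Prog) :
    (Prog.forLoop i bnd body).Ok ↔ body.Ok := by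
  simp [Prog.forLoop, Prog.Ok, Expr.Ok]

/-- One share of the budget pays for each iteration and one more for the initialization and the last
test, whence the factor `cnt + 1`. The counter is increased after the body, so the body has to
establish the next invariant for the memory with the new counter value already in place. -/
theorem Runs.forLoop (hΩ : Ω ≤ Ξ) (hc : 1 ≤ c) {i bnd : ℕ} {body : Prog} {cnt : ℕ}
    (hcnt : m bnd 0 = cnt) (hi : i ∉ body.writes) (hb : bnd ∉ body.writes) (hib : bnd ≠ i)
    (hlim : cnt ≤ lim Ω Ξ i) (Inv : ℕ → Mem → Prop) (h0 : Inv 0 (m.set i 0 0))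
    (hstep : ∀ j m', j < cnt → (∀ a, a ∉ (Prog.forLoop i bnd body).writes → m' a = m a) →
      m' i 0 = j → Inv j m' →
      Runs Ω Ξ c body m' fun m'' => Inv (j + 1) (m''.set i 0 (j + 1))) :
    Runs Ω Ξ (c * (cnt + 1)) (Prog.forLoop i bnd body) m (Inv cnt) := by
  set U := len Ω * len Ξ with hUdef
  set g : Expr := .sub (.var bnd) (.var i) with hg
  set inc : Prog := .store i (.const 0) (.add (.var i) (.const 1)) with hinc
  intro hP hm
  have hbody : body.Ok := hP.2.2.1
  have hUc : U ≤ U * c := Nat.le_mul_of_pos_right _ hc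
  have gcost : ∀ m', Bdd Ω Ξ m' → g.cost m' + len (g.eval m') ≤ 2 * g.wt * (U * c) := by
    intro m' hm'
    have h1 := g.cost_le hΩ hm' hP.2.1
    have h2 := g.len_eval_le_unit hΩ hm'
    calc _ ≤ 2 * g.wt * U := by rw [hUdef]; nlinarith
      _ ≤ _ := Nat.mul_le_mul_left _ hUc
  -- Induction on the number `r` of iterations that remain.
  have key : ∀ r j m', j + r = cnt → Bdd Ω Ξ m' →
      (∀ a, a ∉ (Prog.forLoop i bnd body).writes → m' a = m a) → m' i 0 = j → Inv j m' →
      ∃ t m'', Exec (.while g (.seq body inc)) m' t m'' ∧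
        t ≤ (2 * g.wt + body.wt + inc.wt) * (U * c) * r + 2 * g.wt * (U * c) ∧
        Bdd Ω Ξ m'' ∧ (∀ a, a ∉ (Prog.forLoop i bnd body).writes → m'' a = m a) ∧
        Inv cnt m'' := by
    intro r
    induction r with
    | zero =>
      intro j m' hj hb' hf hmi hI
      have hbn : m' bnd 0 = cnt := by
        rw [hf bnd (by simp [Prog.writes_forLoop, hib, hb]), hcnt]
      refine ⟨_, m', .while_false (by simp [hg, hbn, hmi]; omega), ?_, hb', hf, ?_⟩
      · have := gcost m' hb'; omega
      · have : j = cnt := by omega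
        exact this ▸ hI
    | succ r ih =>
      intro j m' hj hb' hf hmi hI
      have hbn : m' bnd 0 = cnt := by
        rw [hf bnd (by simp [Prog.writes_forLoop, hib, hb]), hcnt]
      have hjc : j < cnt := by omega
      obtain ⟨t₁, m₁, e₁, ht₁, hb₁, hf₁, h₁⟩ := hstep j m' hjc hf hmi hI hbody hb'
      have hmi₁ : m₁ i 0 = j := by rw [hf₁ i hi, hmi]
      obtain ⟨t₂, m₂, e₂, ht₂, hb₂, hf₂, h₂⟩ :=
        (Runs.store (Q := fun m₂ => m₂ = m₁.set i 0 (j + 1)) (c := c) (Ω := Ω) (Ξ := Ξ) hΩ hc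
          (a := i) (idx := .const 0) (val := .add (.var i) (.const 1)) (m := m₁)
          (by simp [hmi₁]; omega) (by simp [hmi₁])) (by simp [Prog.Ok, Expr.Ok]) hb₁
      have hfl : ∀ a, a ∉ (Prog.forLoop i bnd body).writes → m₂ a = m a := by
        intro a ha
        have ha' := ha
        simp only [Prog.writes_forLoop, List.mem_cons, List.mem_append, not_or] at ha
        rw [hf₂ a (by simp [Prog.writes, ha.1]), hf₁ a ha.2.1, hf a ha']
      obtain ⟨t₃, m₃, e₃, ht₃, hb₃, hf₃, h₃⟩ := ih (j + 1) m₂ (by omega) hb₂ hfl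
        (by rw [h₂]; simp) (h₂ ▸ h₁)
      refine ⟨_, m₃, .while_true (by simp [hg, hbn, hmi]; omega) (.seq e₁ e₂) e₃, ?_, hb₃, hf₃,
        h₃⟩
      have hgc := gcost m' hb'
      have e1 : (2 * g.wt + body.wt + inc.wt) * (U * c) * (r + 1) =
        (2 * g.wt + body.wt + inc.wt) * (U * c) * r + 2 * g.wt * (U * c) + body.wt * (U * c)
          + inc.wt * (U * c) := by ring
      rw [e1]
      change t₂ ≤ inc.wt * (U * c) at ht₂
      rw [← hUdef] at ht₁
      omega
  obtain ⟨t₀, m₀, e₀, ht₀, hb₀, hf₀, h₀⟩ :=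
    (Runs.store (Q := fun m₂ => m₂ = m.set i 0 0) (c := c) (Ω := Ω) (Ξ := Ξ) hΩ hc
      (a := i) (idx := .const 0) (val := .const 0) (m := m) (by simp) (by simp))
      (by simp [Prog.Ok, Expr.Ok]) hm
  obtain ⟨t, m', e', ht, hb', hf, h'⟩ := key cnt 0 m₀ (by omega) hb₀
    (fun a ha => hf₀ a (by
      simp only [Prog.writes_forLoop, List.mem_cons, not_or] at ha
      simp [Prog.writes, ha.1])) (by rw [h₀]; simp) (h₀ ▸ h0)
  refine ⟨_, m', .seq e₀ e', ?_, hb', hf, h'⟩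
  -- The budget, split into the cost of the initialization, the bound from `key`, and an unused
  -- rest.
  have e1 : (Prog.forLoop i bnd body).wt * (U * (c * (cnt + 1))) =
      2 * ((Expr.const 0).wt + (Expr.const 0).wt) * (U * c) * (cnt + 1) +
      ((2 * g.wt + body.wt + inc.wt) * (U * c) * cnt + 2 * g.wt * (U * c)
        + body.wt * (U * c) + inc.wt * (U * c)) := by
    simp only [Prog.forLoop, Prog.wt, ← hg, hinc]; ring
  have e2 : t₀ ≤ 2 * ((Expr.const 0).wt + (Expr.const 0).wt) * (U * c) * (cnt + 1) :=
    ht₀.trans (Nat.le_mul_of_pos_right _ (by omega))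
  rw [e1]
  omega

end rules

end RAM

namespace Arith

open Polynomial

/-! ### From straight-line programs to bilinear algorithms -/

section slp

variable {ι : Type}

/-- The value of an operand, computed with polynomials. -/
noncomputable def Operand.polyVal (inp : ι → ℚ[X]) (acc : List ℚ[X]) : Operand ℚ ι → ℚ[X]
  | .input x => inp x
  | .const c => C c
  | .result i => acc.getD i 0

noncomputable def Step.polyVal (inp : ι → ℚ[X]) (acc : List ℚ[X]) (s : Step ℚ ι) : ℚ[X] :=
  match s.op with
  | .add => s.lhs.polyVal inp acc + s.rhs.polyVal inp acc
  | .sub => s.lhs.polyVal inp acc - s.rhs.polyVal inp acc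
  | .mul => s.lhs.polyVal inp acc * s.rhs.polyVal inp acc

/-- The results of all steps, computed with polynomials. -/
noncomputable def polyResults (inp : ι → ℚ[X]) (p : List (Step ℚ ι)) : List ℚ[X] :=
  p.foldl (fun acc s => acc ++ [s.polyVal inp acc]) []

theorem polyResults_append (inp : ι → ℚ[X]) (p : List (Step ℚ ι)) (s : Step ℚ ι) :
    polyResults inp (p ++ [s]) = polyResults inp p ++ [s.polyVal inp (polyResults inp p)] := by
  simp [polyResults]

theorem results_append {K : Type} [Field K] (inp : ι → K) (p : List (Step K ι)) (s : Step K ι) :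
    results inp (p ++ [s]) = results inp p ++ [s.val inp (results inp p)] := by
  simp [results]

theorem length_results {K : Type} [Field K] (inp : ι → K) (p : List (Step K ι)) :
    (results inp p).length = p.length := by
  induction p using List.reverseRecOn with
  | nil => rfl
  | append_singleton p s ih => rw [results_append]; simp [ih]

theorem length_polyResults (inp : ι → ℚ[X]) (p : List (Step ℚ ι)) :
    (polyResults inp p).length = p.length := by
  induction p using List.reverseRecOn with
  | nil => rfl
  | append_singleton p s ih => rw [polyResults_append]; simp [ih]

theorem Operand.eval_polyVal (inp : ι → ℚ[X]) (acc : List ℚ[X]) (t : ℚ) (o : Operand ℚ ι) :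
    (o.polyVal inp acc).eval t = o.val (fun i => (inp i).eval t) (acc.map (eval t)) := by
  cases o with
  | input x => rfl
  | const c => simp [Operand.polyVal, Operand.val]
  | result i =>
    simp only [Operand.polyVal, Operand.val, List.getD_eq_getElem?_getD, List.getElem?_map]
    cases acc[i]? <;> simp

theorem map_polyResults (inp : ι → ℚ[X]) (t : ℚ) (p : List (Step ℚ ι)) :
    (polyResults inp p).map (eval t) = results (fun i => (inp i).eval t) p := by
  induction p using List.reverseRecOn with
  | nil => rfl
  | append_singleton p s ih =>
    rw [polyResults_append, results_append, List.map_append, ih]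
    congr 1
    simp only [List.map_cons, List.map_nil, List.cons.injEq, and_true]
    unfold Step.polyVal Step.val
    cases s.op <;> simp [Operand.eval_polyVal, ih]

/-- The coefficients of degree `0`, `1`, `2` of the family of polynomials `F` are constant, linear
and in the space `S`, respectively. -/
def HasJet (S : Submodule ℚ ((ι → ℚ) → ℚ)) (F : (ι → ℚ) → ℚ[X]) : Prop :=
  ∃ (c : ℚ) (l : (ι → ℚ) →ₗ[ℚ] ℚ), ∃ g ∈ S, ∀ x,
    (F x).coeff 0 = c ∧ (F x).coeff 1 = l x ∧ (F x).coeff 2 = g x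

theorem HasJet.mono {S S' : Submodule ℚ ((ι → ℚ) → ℚ)} (h : S ≤ S') {F : (ι → ℚ) → ℚ[X]}
    (hF : HasJet S F) : HasJet S' F := by
  obtain ⟨c, l, g, hg, hx⟩ := hF
  exact ⟨c, l, g, h hg, hx⟩

theorem HasJet.const (S : Submodule ℚ ((ι → ℚ) → ℚ)) (c : ℚ) : HasJet S fun _ => C c :=
  ⟨c, 0, 0, S.zero_mem, fun x => by simp [coeff_C]⟩

theorem HasJet.input (S : Submodule ℚ ((ι → ℚ) → ℚ)) (i : ι) : HasJet S fun x => C (x i) * X :=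
  ⟨0, LinearMap.proj i, 0, S.zero_mem, fun x => by simp [coeff_X]⟩

theorem HasJet.add {S : Submodule ℚ ((ι → ℚ) → ℚ)} {F G : (ι → ℚ) → ℚ[X]}
    (hF : HasJet S F) (hG : HasJet S G) : HasJet S fun x => F x + G x := by
  obtain ⟨c, l, g, hg, hx⟩ := hF
  obtain ⟨c', l', g', hg', hx'⟩ := hG
  exact ⟨c + c', l + l', g + g', S.add_mem hg hg', fun x => by
    simp [(hx x).1, (hx x).2.1, (hx x).2.2, (hx' x).1, (hx' x).2.1, (hx' x).2.2]⟩

theorem HasJet.sub {S : Submodule ℚ ((ι → ℚ) → ℚ)} {F G : (ι → ℚ) → ℚ[X]}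
    (hF : HasJet S F) (hG : HasJet S G) : HasJet S fun x => F x - G x := by
  obtain ⟨c, l, g, hg, hx⟩ := hF
  obtain ⟨c', l', g', hg', hx'⟩ := hG
  exact ⟨c - c', l - l', g - g', S.sub_mem hg hg', fun x => by
    simp [(hx x).1, (hx x).2.1, (hx x).2.2, (hx' x).1, (hx' x).2.1, (hx' x).2.2]⟩

/-- The coefficient of degree two of a product is c g' + l l' + c' g, so only the product of the two
linear parts is new. The forms are chosen before `S'` because the space is enlarged by exactly this
product. -/
theorem HasJet.mul {S : Submodule ℚ ((ι → ℚ) → ℚ)} {F G : (ι → ℚ) → ℚ[X]}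
    (hF : HasJet S F) (hG : HasJet S G) : ∃ l l' : (ι → ℚ) →ₗ[ℚ] ℚ,
      ∀ S', S ≤ S' → (fun x => l x * l' x) ∈ S' → HasJet S' fun x => F x * G x := by
  obtain ⟨c, l, g, hg, hx⟩ := hF
  obtain ⟨c', l', g', hg', hx'⟩ := hG
  refine ⟨l, l', fun S' hS hl => ⟨c * c', c • l' + c' • l,
    c • g' + (fun x => l x * l' x) + c' • g,
    S'.add_mem (S'.add_mem (S'.smul_mem _ (hS hg')) hl) (S'.smul_mem _ (hS hg)), fun x => ?_⟩⟩
  simp only [mul_coeff_zero, mul_coeff_one, (hx x).1, (hx x).2.1, (hx' x).1, (hx' x).2.1,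
    LinearMap.add_apply, LinearMap.smul_apply, smul_eq_mul, Pi.add_apply, Pi.smul_apply, true_and]
  refine ⟨by ring, ?_⟩
  rw [coeff_mul, Finset.Nat.antidiagonal_succ, Finset.sum_cons, Finset.sum_map,
    Finset.Nat.antidiagonal_succ, Finset.sum_cons, Finset.sum_map, Finset.Nat.antidiagonal_zero,
    Finset.sum_singleton]
  simp [(hx x).1, (hx x).2.1, (hx x).2.2, (hx' x).1, (hx' x).2.1, (hx' x).2.2]
  ring

/-- The span of the products of the given pairs of linear forms. -/
def prodSpan (fs : List (((ι → ℚ) →ₗ[ℚ] ℚ) × ((ι → ℚ) →ₗ[ℚ] ℚ))) :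
    Submodule ℚ ((ι → ℚ) → ℚ) :=
  Submodule.span ℚ (Set.range fun s : Fin fs.length => fun x =>
    (fs.getD s 0).1 x * (fs.getD s 0).2 x)

theorem prodSpan_mono (fs : List (((ι → ℚ) →ₗ[ℚ] ℚ) × ((ι → ℚ) →ₗ[ℚ] ℚ))) (f) :
    prodSpan fs ≤ prodSpan (fs ++ [f]) := by
  refine Submodule.span_mono ?_
  rintro _ ⟨s, rfl⟩
  refine ⟨⟨s, by have := s.2; simp only [List.length_append]; omega⟩, ?_⟩
  simp

theorem mem_prodSpan_last (fs : List (((ι → ℚ) →ₗ[ℚ] ℚ) × ((ι → ℚ) →ₗ[ℚ] ℚ))) (f) :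
    (fun x => f.1 x * f.2 x) ∈ prodSpan (fs ++ [f]) := by
  refine Submodule.subset_span ⟨⟨fs.length, by simp⟩, ?_⟩
  simp

theorem Operand.hasJet {S : Submodule ℚ ((ι → ℚ) → ℚ)} {p : List (Step ℚ ι)}
    (h : ∀ i, HasJet S fun x => (polyResults (fun i => C (x i) * X) p).getD i 0)
    (o : Operand ℚ ι) :
    HasJet S fun x => o.polyVal (fun i => C (x i) * X) (polyResults (fun i => C (x i) * X) p) := by
  cases o with
  | input i => exact HasJet.input S i
  | const c => exact HasJet.const S c
  | result i => exact h i

/-- With each input multiplied by `X`, every step of the program contributes at most one new product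
of linear forms to the coefficients of degree two. -/
theorem exists_hasJet (p : List (Step ℚ ι)) :
    ∃ fs : List (((ι → ℚ) →ₗ[ℚ] ℚ) × ((ι → ℚ) →ₗ[ℚ] ℚ)), fs.length = p.length ∧
      ∀ i, HasJet (prodSpan fs) fun x => (polyResults (fun i => C (x i) * X) p).getD i 0 := by
  induction p using List.reverseRecOn with
  | nil => exact ⟨[], rfl, fun i => by simpa [polyResults] using HasJet.const _ 0⟩
  | append_singleton p s ih =>
    obtain ⟨fs, hlen, hfs⟩ := ih
    have hl := Operand.hasJet hfs s.lhs
    have hr := Operand.hasJet hfs s.rhs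
    obtain ⟨l, l', hmul⟩ := hl.mul hr
    have hs : HasJet (prodSpan (fs ++ [(l, l')])) fun x =>
        s.polyVal (fun i => C (x i) * X) (polyResults (fun i => C (x i) * X) p) := by
      unfold Step.polyVal
      cases s.op
      · exact (hl.add hr).mono (prodSpan_mono _ _)
      · exact (hl.sub hr).mono (prodSpan_mono _ _)
      · exact hmul _ (prodSpan_mono _ _) (mem_prodSpan_last fs (l, l'))
    -- A pair is appended even for additions and subtractions, so that pairs and steps are equal in
    -- number.
    refine ⟨fs ++ [(l, l')], by simp [hlen], fun i => ?_⟩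
    simp only [polyResults_append]
    rcases lt_trichotomy i p.length with h | h | h
    · convert (hfs i).mono (prodSpan_mono fs (l, l')) using 2 with x
      simp [List.getElem?_append_left, length_polyResults, h]
    · convert hs using 2 with x
      simp [h, length_polyResults]
    -- An index out of range denotes the constant 0.
    · convert HasJet.const _ 0 using 2 with x
      rw [List.getD_eq_default]
      · simp
      · simp [length_polyResults]; omega

end slp

/-- The input in which `A` is the matrix unit `(a, b)` and `B = 0`. -/
def unitL {N : ℕ} (a b : ℕ) : MatVars N → ℚ
  | .inl ij => if ij.1.val = a ∧ ij.2.val = b then 1 else 0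
  | .inr _ => 0

/-- The input in which `A = 0` and `B` is the matrix unit `(a, b)`. -/
def unitR {N : ℕ} (a b : ℕ) : MatVars N → ℚ
  | .inl _ => 0
  | .inr ij => if ij.1.val = a ∧ ij.2.val = b then 1 else 0

section matmul

variable {N : ℕ} {p : List (Step ℚ (MatVars N))} {out : Fin N → Fin N → Operand ℚ (MatVars N)}

/-- An entry of the matrix product is homogeneous of degree two, so it is the coefficient of degree
two of the output polynomial, and this lies in the span of the products. -/
theorem ComputesMatMul.exists_quadratic (h : ComputesMatMul p out) :
    ∃ (l l' : ℕ → (MatVars N → ℚ) →ₗ[ℚ] ℚ) (γ : Fin N → Fin N → ℕ → ℚ),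
      ∀ (x : MatVars N → ℚ) (i j : Fin N), ∑ k, x (.inl (i, k)) * x (.inr (k, j)) =
        ∑ s ∈ Finset.range p.length, γ i j s * (l s x * l' s x) := by
  obtain ⟨fs, hlen, hfs⟩ := exists_hasJet p
  have key : ∀ i j : Fin N, ∃ γ : ℕ → ℚ, ∀ x : MatVars N → ℚ,
      ∑ k, x (.inl (i, k)) * x (.inr (k, j)) =
        ∑ s ∈ Finset.range p.length, γ s * ((fs.getD s 0).1 x * (fs.getD s 0).2 x) := by
    intro i j
    obtain ⟨c, l, g, hg, hx⟩ := Operand.hasJet hfs (out i j)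
    obtain ⟨γ, hγ⟩ := (Submodule.mem_span_range_iff_exists_fun ℚ).1 hg
    refine ⟨fun s => if hs : s < fs.length then γ ⟨s, hs⟩ else 0, fun x => ?_⟩
    have h2 := (hx x).2.2
    beta_reduce at h2
    -- Both sides agree at every rational `t`, since scaling both matrices by `t` scales their
    -- product by `t ^ 2`.
    have h3 : (out i j).polyVal (fun i => C (x i) * X) (polyResults (fun i => C (x i) * X) p) =
        C (∑ k, x (.inl (i, k)) * x (.inr (k, j))) * X ^ 2 := by
      refine Polynomial.funext fun t => ?_
      rw [Operand.eval_polyVal, map_polyResults]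
      have := h (Matrix.of fun a b => x (.inl (a, b)) * t)
        (Matrix.of fun a b => x (.inr (a, b)) * t)
        i j
      have e : matInput (Matrix.of fun a b => x (.inl (a, b)) * t)
          (Matrix.of fun a b => x (.inr (a, b)) * t) =
          fun i => eval t (C (x i) * X) := by
        funext i; rcases i with i | i <;> simp [matInput]
      rw [e] at this
      rw [this, Matrix.mul_apply]
      simp only [eval_mul, eval_C, eval_pow, eval_X, Finset.sum_mul, Matrix.of_apply]
      exact Finset.sum_congr rfl fun k _ => by ring
    rw [h3, coeff_C_mul_X_pow, if_pos rfl, ← hγ, Finset.sum_apply] at h2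
    rw [h2, ← hlen, Finset.sum_range]
    exact Finset.sum_congr rfl fun s _ => by simp
  choose γ hγ using key
  exact ⟨fun s => (fs.getD s 0).1, fun s => (fs.getD s 0).2, γ, fun x i j => hγ i j x⟩

theorem exists_int_multiple (f : ℕ → ℕ → ℚ) (a b : ℕ) : ∃ (D : ℕ) (g : ℕ → ℕ → ℤ), 0 < D ∧
    ∀ i < a, ∀ j < b, (g i j : ℚ) = D * f i j := by
  -- The product of all denominators clears every fraction; the floor merely names the resulting
  -- integer.
  refine ⟨∏ i ∈ Finset.range a, ∏ j ∈ Finset.range b, (f i j).den,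
    fun i j => ⌊((∏ i ∈ Finset.range a, ∏ j ∈ Finset.range b, (f i j).den : ℕ) : ℚ) * f i j⌋,
    Finset.prod_pos fun i _ => Finset.prod_pos fun j _ => (f i j).den_pos, fun i hi j hj => ?_⟩
  obtain ⟨c, hc⟩ : (f i j).den ∣ ∏ i ∈ Finset.range a, ∏ j ∈ Finset.range b, (f i j).den :=
    (Finset.dvd_prod_of_mem (fun j => (f i j).den) (Finset.mem_range.2 hj)).trans
      (Finset.dvd_prod_of_mem (fun i => ∏ j ∈ Finset.range b, (f i j).den) (Finset.mem_range.2 hi))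
  rw [hc]
  have : ((f i j).den * c : ℕ) * f i j = (((f i j).num * c : ℤ) : ℚ) := by
    push_cast
    rw [mul_right_comm, Rat.den_mul_eq_num]
  beta_reduce
  rw [this, Int.floor_intCast]

/-- A bilinear algorithm with `R` products, over the integers up to the factor `D`, for the product
of `N × N` matrices. -/
def IsScheme (N R D : ℕ) (U V W : ℕ → ℕ → ℤ) : Prop :=
  ∀ i < N, ∀ j < N, ∀ a < N, ∀ b < N, ∀ c < N, ∀ g < N,
    ∑ r ∈ Finset.range R, W (i * N + j) r * (U r (a * N + b) * V r (c * N + g)) =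
      if i = a ∧ b = c ∧ g = j then (D : ℤ) else 0

/-- Polarization: on the input (A, B) = (A, 0) + (0, B), each product l l' splits into two mixed
terms, bilinear in A and B, and two pure terms. The pure terms cancel, and the mixed ones account
for the factor 2. Clearing denominators produces `D`. -/
theorem ComputesMatMul.exists_isScheme (h : ComputesMatMul p out) :
    ∃ (D : ℕ) (U V W : ℕ → ℕ → ℤ), 0 < D ∧ IsScheme N (2 * p.length) D U V W := by
  obtain ⟨l, l', γ, hq⟩ := h.exists_quadratic
  set L := p.length with hL
  -- The first `L` products are l(A) l'(B), the other `L` are l'(A) l(B).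
  let u : ℕ → ℕ → ℚ := fun r m =>
    if r < L then l r (unitL (m / N) (m % N)) else l' (r - L) (unitL (m / N) (m % N))
  let v : ℕ → ℕ → ℚ := fun r m =>
    if r < L then l' r (unitR (m / N) (m % N)) else l (r - L) (unitR (m / N) (m % N))
  let w : ℕ → ℕ → ℚ := fun m r =>
    if hm : m / N < N ∧ m % N < N then γ ⟨m / N, hm.1⟩ ⟨m % N, hm.2⟩ (if r < L then r else r - L)
    else 0
  have hidx : ∀ a < N, ∀ b < N, (a * N + b) / N = a ∧ (a * N + b) % N = b ∧
      a * N + b < N * N := by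
    intro a ha b hb
    refine ⟨?_, ?_, by nlinarith⟩
    · rw [mul_comm, Nat.mul_add_div (by omega), Nat.div_eq_of_lt hb, add_zero]
    · rw [mul_comm, Nat.mul_add_mod, Nat.mod_eq_of_lt hb]
  obtain ⟨D₁, U, hD₁, hU⟩ := exists_int_multiple u (2 * L) (N * N)
  obtain ⟨D₂, V, hD₂, hV⟩ := exists_int_multiple v (2 * L) (N * N)
  obtain ⟨D₃, W, hD₃, hW⟩ := exists_int_multiple w (N * N) (2 * L)
  refine ⟨D₃ * (D₁ * D₂), U, V, W, by positivity, ?_⟩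
  intro i hi j hj a ha b hb c hc g hg
  have hQ : ∑ r ∈ Finset.range (2 * L), w (i * N + j) r *
      (u r (a * N + b) * v r (c * N + g)) = if i = a ∧ b = c ∧ g = j then (1 : ℚ) else 0 := by
    have hp := hq (unitL a b + unitR c g) ⟨i, hi⟩ ⟨j, hj⟩
    -- With one factor zero the matrix product vanishes, hence so do the sums of the pure terms.
    have hpl := hq (unitL a b) ⟨i, hi⟩ ⟨j, hj⟩
    have hpr := hq (unitR c g) ⟨i, hi⟩ ⟨j, hj⟩
    simp only [unitL, unitR, mul_zero, zero_mul, Finset.sum_const_zero] at hpl hpr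
    have e1 : ∑ k : Fin N, (unitL a b + unitR c g : MatVars N → ℚ) (.inl (⟨i, hi⟩, k)) *
        (unitL a b + unitR c g : MatVars N → ℚ) (.inr (k, ⟨j, hj⟩)) =
        if i = a ∧ b = c ∧ g = j then (1 : ℚ) else 0 := by
      simp only [Pi.add_apply, unitL, unitR, add_zero, zero_add]
      rw [Finset.sum_eq_single ⟨b, hb⟩]
      · simp only [and_true]
        split_ifs <;> first | (exfalso; omega) | simp
      · intro k _ hk
        have : k.val ≠ b := fun h' => hk (Fin.ext h')
        simp [this]
      · simp
    rw [e1] at hp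
    have hsum : ∑ s ∈ Finset.range L,
        (w (i * N + j) s * (u s (a * N + b) * v s (c * N + g)) +
          w (i * N + j) (L + s) * (u (L + s) (a * N + b) * v (L + s) (c * N + g)) +
          γ ⟨i, hi⟩ ⟨j, hj⟩ s * (l s (unitL a b) * l' s (unitL a b)) +
          γ ⟨i, hi⟩ ⟨j, hj⟩ s * (l s (unitR c g) * l' s (unitR c g))) =
        ∑ s ∈ Finset.range L, γ ⟨i, hi⟩ ⟨j, hj⟩ s *
          (l s (unitL a b + unitR c g) * l' s (unitL a b + unitR c g)) := by
      refine Finset.sum_congr rfl fun s hs => ?_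
      have hs' : s < L := Finset.mem_range.1 hs
      obtain ⟨p1, p2, -⟩ := hidx i hi j hj
      obtain ⟨p3, p4, -⟩ := hidx a ha b hb
      obtain ⟨p5, p6, -⟩ := hidx c hc g hg
      simp only [u, v, w, p1, p2, p3, p4, p5, p6, hi, hj, and_self, dite_true, if_pos hs',
        show ¬ (L + s < L) by omega, if_false, Nat.add_sub_cancel_left, map_add]
      ring
    simp only [Finset.sum_add_distrib] at hsum
    rw [hp, two_mul, Finset.sum_range_add]
    linarith
  have hZ : ((∑ r ∈ Finset.range (2 * L), W (i * N + j) r *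
      (U r (a * N + b) * V r (c * N + g)) : ℤ) : ℚ) =
      ((if i = a ∧ b = c ∧ g = j then ((D₃ * (D₁ * D₂) : ℕ) : ℤ) else 0 : ℤ) : ℚ) := by
    push_cast
    calc _ = (D₃ * (D₁ * D₂) : ℚ) * ∑ r ∈ Finset.range (2 * L), w (i * N + j) r *
          (u r (a * N + b) * v r (c * N + g)) := by
          rw [Finset.mul_sum]
          refine Finset.sum_congr rfl fun r hr => ?_
          have hr' := Finset.mem_range.1 hr
          rw [hW _ (hidx i hi j hj).2.2 _ hr', hU _ hr' _ (hidx a ha b hb).2.2,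
            hV _ hr' _ (hidx c hc g hg).2.2]
          ring
      _ = _ := by rw [hQ]; split_ifs <;> simp
  exact_mod_cast hZ

/-- A straight-line program for the product of `N × N` matrices has at least `N²` steps. -/
theorem ComputesMatMul.sq_le_length (h : ComputesMatMul p out) : N ^ 2 ≤ p.length := by
  have h0 : ∀ i j : Fin N, (out i j).val (matInput 0 0) (results (matInput 0 0) p) = 0 := by
    intro i j; rw [h]; simp
  have h1 : ∀ i j i' j' : Fin N,
      (out i' j').val (matInput (Matrix.single i j (1 : ℚ)) (Matrix.single j j 1))
        (results (matInput (Matrix.single i j (1 : ℚ)) (Matrix.single j j 1)) p) =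
        if i = i' ∧ j = j' then 1 else 0 := by
    intro i j i' j'
    rw [h, Matrix.single_mul_single_same, mul_one, Matrix.single_apply]
  have h2 : ∀ i j : Fin N,
      (out i j).val (matInput (Matrix.single i j (2 : ℚ)) (Matrix.single j j 2))
        (results (matInput (Matrix.single i j (2 : ℚ)) (Matrix.single j j 2)) p) = 4 := by
    intro i j
    rw [h, Matrix.single_mul_single_same, Matrix.single_apply]
    norm_num
  -- No output is a constant, since both 0 and 1 occur as its values. None is an input, since
  -- doubled matrix units give 4 where an input holds 0 or 2. None is an index out of range, since
  -- that has value 0.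
  have key : ∀ ij : Fin N × Fin N, ∃ k : Fin p.length, out ij.1 ij.2 = .result k := by
    rintro ⟨i, j⟩
    have a0 := h0 i j
    have a1 := h1 i j i j
    have a2 := h2 i j
    rw [if_pos ⟨rfl, rfl⟩] at a1
    cases ho : out i j with
    | input x =>
      rw [ho] at a2
      exfalso
      simp only [Operand.val] at a2
      rcases x with x | x <;> simp only [matInput, Matrix.single_apply] at a2 <;>
        split_ifs at a2 <;> norm_num at a2
    | const c =>
      rw [ho] at a0 a1
      simp only [Operand.val] at a0 a1
      exact absurd (a0.symm.trans a1) (by norm_num)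
    | result k =>
      by_cases hk : k < p.length
      · exact ⟨⟨k, hk⟩, rfl⟩
      · rw [ho] at a1
        simp only [Operand.val] at a1
        rw [List.getD_eq_default _ _ (by rw [length_results]; omega)] at a1
        norm_num at a1
  choose f hf using key
  -- Products of matrix units distinguish the entries, so different entries need different steps.
  have hinj : Function.Injective f := by
    rintro ⟨i, j⟩ ⟨i', j'⟩ hij
    have a1 := h1 i j i j
    have a2 := h1 i j i' j'
    have e : out i j = out i' j' := by
      rw [hf (i, j), hf (i', j'), hij]
    rw [← e, a1, if_pos ⟨rfl, rfl⟩] at a2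
    by_contra hne
    rw [if_neg (by simpa using hne)] at a2
    norm_num at a2
  simpa [sq] using Fintype.card_le_of_injective f hinj

end matmul

/-! ### The schoolbook algorithm -/

section schoolbook

variable {ι : Type}

/-- After the program `p`, and after all its extensions, the operand `o` holds the value `f`. -/
def Holds (p : List (Step ℚ ι)) (o : Operand ℚ ι) (f : (ι → ℚ) → ℚ) : Prop :=
  ∀ p', p <+: p' → ∀ inp, o.val inp (results inp p') = f inp

theorem results_prefix (inp : ι → ℚ) {p p' : List (Step ℚ ι)} (h : p <+: p') :
    results inp p <+: results inp p' := by
  obtain ⟨r, rfl⟩ := h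
  induction r using List.reverseRecOn with
  | nil => simp
  | append_singleton r s ih =>
    rw [← List.append_assoc, results_append]
    exact ih.trans (List.prefix_append _ _)

theorem Holds.mono {p p' : List (Step ℚ ι)} (h : p <+: p') {o : Operand ℚ ι} {f}
    (ho : Holds p o f) : Holds p' o f :=
  fun p'' hp => ho p'' (h.trans hp)

theorem Holds.step {p : List (Step ℚ ι)} (s : Step ℚ ι) {f : (ι → ℚ) → ℚ}
    (h : ∀ inp, s.val inp (results inp p) = f inp) :
    Holds (p ++ [s]) (.result p.length) f := by
  intro p' hp inp
  obtain ⟨r, hr⟩ := results_prefix inp hp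
  rw [results_append] at hr
  simp only [Operand.val]
  rw [← hr, ← h inp, List.append_assoc]
  simp [length_results]

/-- Each summand costs one multiplication and one addition. -/
theorem exists_holds_sum (i j : ℕ → Operand ℚ ι) (f g : ℕ → (ι → ℚ) → ℚ)
    (hi : ∀ k, Holds [] (i k) (f k)) (hj : ∀ k, Holds [] (j k) (g k))
    (p : List (Step ℚ ι)) (c : ℕ) :
    ∃ p' o, p <+: p' ∧ p'.length ≤ p.length + 2 * c ∧
      Holds p' o fun inp => ∑ k ∈ Finset.range c, f k inp * g k inp := by
  induction c with
  | zero => exact ⟨p, .const 0, List.prefix_refl p, by simp, fun p' _ inp => by simp [Operand.val]⟩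
  | succ c ih =>
    obtain ⟨p', o, hp, hlen, ho⟩ := ih
    have h1 : Holds (p' ++ [⟨.mul, i c, j c⟩]) (.result p'.length)
        fun inp => f c inp * g c inp := by
      refine Holds.step _ fun inp => ?_
      simp [Step.val, hi c p' (List.nil_prefix) inp, hj c p' (List.nil_prefix) inp]
    have h2 : Holds ((p' ++ [⟨.mul, i c, j c⟩]) ++ [⟨.add, o, .result p'.length⟩])
        (.result (p' ++ [(⟨.mul, i c, j c⟩ : Step ℚ ι)]).length)
        fun inp => ∑ k ∈ Finset.range (c + 1), f k inp * g k inp := by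
      refine Holds.step _ fun inp => ?_
      rw [Finset.sum_range_succ]
      simp only [Step.val]
      rw [ho _ (List.prefix_append _ _) inp, h1 _ (List.prefix_refl _) inp]
    refine ⟨_, _, hp.trans ((List.prefix_append _ _).trans (List.prefix_append _ _)), ?_, h2⟩
    simp; omega

/-- This shows that the set of exponents defining ω is nonempty; the infimum of the empty set is 0
by convention and would carry no information. -/
theorem exists_schoolbook (N : ℕ) : ∃ (p : List (Step ℚ (MatVars N)))
    (out : Fin N → Fin N → Operand ℚ (MatVars N)),
      ComputesMatMul p out ∧ p.length ≤ 2 * N ^ 3 := by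
  have key : ∀ l : List (Fin N × Fin N), ∃ p : List (Step ℚ (MatVars N)),
      p.length ≤ 2 * N * l.length ∧ ∀ ij ∈ l, ∃ o, Holds p o fun inp =>
        ∑ k : Fin N, inp (.inl (ij.1, k)) * inp (.inr (k, ij.2)) := by
    intro l
    induction l with
    | nil => exact ⟨[], by simp, by simp⟩
    | cons ij l ih =>
      obtain ⟨p, hp, hl⟩ := ih
      obtain ⟨p', o, h1, h2, h3⟩ := exists_holds_sum
        (fun k => if h : k < N then .input (.inl (ij.1, ⟨k, h⟩)) else .const 0)
        (fun k => if h : k < N then .input (.inr (⟨k, h⟩, ij.2)) else .const 0)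
        (fun k inp => if h : k < N then inp (.inl (ij.1, ⟨k, h⟩)) else 0)
        (fun k inp => if h : k < N then inp (.inr (⟨k, h⟩, ij.2)) else 0)
        (fun k p' _ inp => by split_ifs <;> rfl) (fun k p' _ inp => by split_ifs <;> rfl) p N
      refine ⟨p', by simp only [List.length_cons]; nlinarith, ?_⟩
      intro x hx
      rcases List.mem_cons.1 hx with rfl | hx
      · refine ⟨o, fun p'' hp'' inp => ?_⟩
        rw [h3 p'' hp'' inp]
        beta_reduce
        rw [Finset.sum_range]
        exact Finset.sum_congr rfl fun k _ => by simp
      · obtain ⟨o', ho'⟩ := hl x hx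
        exact ⟨o', ho'.mono h1⟩
  obtain ⟨p, hp, h⟩ := key Finset.univ.toList
  choose o ho using fun ij => h ij (by simp)
  refine ⟨p, fun i j => o (i, j), fun A B i j => ?_, ?_⟩
  · rw [ho (i, j) p (List.prefix_refl p), Matrix.mul_apply]
    rfl
  · refine hp.trans (le_of_eq ?_)
    simp; ring

end schoolbook

/-- An exponent τ₀ < τ admits a bound C·N^τ₀, and for large `e` the gap 2^((τ - τ₀)e) exceeds 2C,
where the 2 stems from polarization. The lower bound on `R` ensures that no layer of the recursion
takes more than `R ^ h` cells. -/
theorem exists_scheme {τ : ℝ} (hτ : matMulExponent < τ) :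
    ∃ (e R D : ℕ) (U V W : ℕ → ℕ → ℤ), 1 ≤ e ∧ 0 < D ∧ IsScheme (2 ^ e) R D U V W ∧
      (2 ^ e) ^ 2 ≤ R ∧ (R : ℝ) ≤ (2 : ℝ) ^ (τ * e) := by
  have hne : {τ : ℝ | ∃ C : ℝ, ∀ N : ℕ, ∃ (p : List (Step ℚ (MatVars N)))
      (out : Fin N → Fin N → Operand ℚ (MatVars N)),
      ComputesMatMul p out ∧ (p.length : ℝ) ≤ C * (N : ℝ) ^ τ}.Nonempty := by
    refine ⟨(3 : ℕ), 2, fun N => ?_⟩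
    obtain ⟨p, out, h, hl⟩ := exists_schoolbook N
    refine ⟨p, out, h, ?_⟩
    rw [Real.rpow_natCast]
    exact_mod_cast hl
  obtain ⟨τ₀, ⟨C, hC⟩, hlt⟩ := exists_lt_of_csInf_lt hne hτ
  have h1 : (1 : ℝ) < 2 ^ (τ - τ₀) := Real.one_lt_rpow one_lt_two (by linarith)
  obtain ⟨e₀, he₀⟩ := pow_unbounded_of_one_lt (2 * C) h1
  obtain ⟨p, out, hp, hl⟩ := hC (2 ^ (e₀ + 1))
  obtain ⟨D, U, V, W, hD, hS⟩ := hp.exists_isScheme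
  refine ⟨e₀ + 1, 2 * p.length, D, U, V, W, by omega, hD, hS, ?_, ?_⟩
  · have := hp.sq_le_length; omega
  · have h2 : 2 * C ≤ (2 ^ (τ - τ₀)) ^ (e₀ + 1) :=
      he₀.le.trans (pow_le_pow_right₀ h1.le (Nat.le_succ _))
    have h3 : ((2 ^ (e₀ + 1) : ℕ) : ℝ) ^ τ₀ = 2 ^ (τ₀ * (e₀ + 1 : ℕ)) := by
      rw [Nat.cast_pow, Nat.cast_ofNat, ← Real.rpow_natCast, ← Real.rpow_mul two_pos.le, mul_comm]
    rw [h3] at hl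
    push_cast at hl ⊢
    calc _ ≤ 2 * (C * 2 ^ (τ₀ * (e₀ + 1 : ℝ))) := by linarith
      _ = 2 * C * 2 ^ (τ₀ * (e₀ + 1 : ℝ)) := by ring
      _ ≤ (2 ^ (τ - τ₀)) ^ (e₀ + 1) * 2 ^ (τ₀ * (e₀ + 1 : ℝ)) := by gcongr
      _ = _ := by
        rw [← Real.rpow_natCast, ← Real.rpow_mul two_pos.le, ← Real.rpow_add two_pos]
        congr 1; push_cast; ring

end Arith

namespace Arith

/-! ### Recursive use of a bilinear algorithm, layer by layer -/

theorem sum_range_mul_eq {A : Type*} [AddCommMonoid A] (f : ℕ → A) (k l : ℕ) :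
    ∑ y ∈ Finset.range (k * l), f y =
      ∑ b ∈ Finset.range k, ∑ y ∈ Finset.range l, f (b * l + y) := by
  induction k with
  | zero => simp
  | succ k ih => rw [Nat.succ_mul, Finset.sum_range_add, ih, Finset.sum_range_succ]

/-- Expanding the products turns the left side into a combination of the `X a b * Y c g`, whose
coefficients are prescribed by the scheme. -/
theorem IsScheme.block {A : Type*} [CommRing A] {d R D : ℕ} {U V W : ℕ → ℕ → ℤ}
    (h : IsScheme d R D U V W) (X Y : ℕ → ℕ → A) {α β : ℕ} (hα : α < d) (hβ : β < d) :
    ∑ r ∈ Finset.range R, (W (α * d + β) r : A) *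
      ((∑ a ∈ Finset.range d, ∑ b ∈ Finset.range d, (U r (a * d + b) : A) * X a b) *
        ∑ c ∈ Finset.range d, ∑ g ∈ Finset.range d, (V r (c * d + g) : A) * Y c g) =
      D * ∑ b ∈ Finset.range d, X α b * Y b β := by
  have e1 : ∀ a ∈ Finset.range d, ∀ b ∈ Finset.range d, ∀ c ∈ Finset.range d,
      ∀ g ∈ Finset.range d, (∑ r ∈ Finset.range R, (W (α * d + β) r : A) *
        ((U r (a * d + b) : A) * (V r (c * d + g) : A))) * (X a b * Y c g) =
      if α = a then if b = c then if g = β then (D : A) * (X a b * Y c g) else 0 else 0 else 0 := by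
    intro a ha b hb c hc g hg
    rw [Finset.mem_range] at ha hb hc hg
    have := congrArg (Int.cast : ℤ → A) (h α hα β hβ a ha b hb c hc g hg)
    push_cast at this
    rw [this]
    split_ifs <;> first | (exfalso; omega) | simp
  calc _ = ∑ a ∈ Finset.range d, ∑ b ∈ Finset.range d, ∑ c ∈ Finset.range d,
        ∑ g ∈ Finset.range d, (∑ r ∈ Finset.range R, (W (α * d + β) r : A) *
        ((U r (a * d + b) : A) * (V r (c * d + g) : A))) * (X a b * Y c g) := by
        simp only [Finset.sum_mul]
        simp only [Finset.mul_sum]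
        rw [Finset.sum_comm]
        refine Finset.sum_congr rfl fun a _ => ?_
        rw [Finset.sum_comm]
        refine Finset.sum_congr rfl fun b _ => ?_
        rw [Finset.sum_comm]
        refine Finset.sum_congr rfl fun c _ => ?_
        rw [Finset.sum_comm]
        refine Finset.sum_congr rfl fun g _ => ?_
        exact Finset.sum_congr rfl fun r _ => by ring
    _ = ∑ a ∈ Finset.range d, ∑ b ∈ Finset.range d, ∑ c ∈ Finset.range d,
        ∑ g ∈ Finset.range d,
        if α = a then if b = c then if g = β then (D : A) * (X a b * Y c g) else 0 else 0 else 0 :=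
      Finset.sum_congr rfl fun a ha => Finset.sum_congr rfl fun b hb =>
        Finset.sum_congr rfl fun c hc => Finset.sum_congr rfl fun g hg => e1 a ha b hb c hc g hg
    _ = _ := by
      rw [Finset.sum_eq_single_of_mem α (Finset.mem_range.2 hα) fun a _ ha => by
        simp [Ne.symm ha], Finset.mul_sum]
      refine Finset.sum_congr rfl fun b hb => ?_
      rw [Finset.sum_eq_single_of_mem b hb fun c _ hc => by simp [Ne.symm hc],
        Finset.sum_eq_single_of_mem β (Finset.mem_range.2 hβ) fun g _ hg => by simp [hg]]
      simp

/-- Layer `i` consists of `R ^ i` square blocks of dimension `d ^ (h - i)`, stored one after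
another, row by row. The layers of `a` and `b` are computed downwards, the last ones are multiplied
entrywise, and the layers of `c` are computed upwards. Each level of the recursion contributes one
factor `D`. -/
theorem IsScheme.layers {A : Type*} [CommRing A] {d R D : ℕ} {U V W : ℕ → ℕ → ℤ}
    (hS : IsScheme d R D U V W) (hd : 0 < d) (h : ℕ) (a b c : ℕ → ℕ → A)
    (ha : ∀ i < h, ∀ ρ < R ^ i, ∀ r < R, ∀ x < d ^ (h - 1 - i), ∀ y < d ^ (h - 1 - i),
      a (i + 1) (((ρ * R + r) * d ^ (h - 1 - i) + x) * d ^ (h - 1 - i) + y) =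
        ∑ p ∈ Finset.range d, ∑ q ∈ Finset.range d, (U r (p * d + q) : A) *
          a i ((ρ * d ^ (h - i) + (p * d ^ (h - 1 - i) + x)) * d ^ (h - i)
            + (q * d ^ (h - 1 - i) + y)))
    (hb : ∀ i < h, ∀ ρ < R ^ i, ∀ r < R, ∀ x < d ^ (h - 1 - i), ∀ y < d ^ (h - 1 - i),
      b (i + 1) (((ρ * R + r) * d ^ (h - 1 - i) + x) * d ^ (h - 1 - i) + y) =
        ∑ p ∈ Finset.range d, ∑ q ∈ Finset.range d, (V r (p * d + q) : A) *
          b i ((ρ * d ^ (h - i) + (p * d ^ (h - 1 - i) + x)) * d ^ (h - i)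
            + (q * d ^ (h - 1 - i) + y)))
    (hc : ∀ i < h, ∀ ρ < R ^ i, ∀ α < d, ∀ β < d, ∀ x < d ^ (h - 1 - i),
      ∀ y < d ^ (h - 1 - i),
      c i ((ρ * d ^ (h - i) + (α * d ^ (h - 1 - i) + x)) * d ^ (h - i)
            + (β * d ^ (h - 1 - i) + y)) =
        ∑ r ∈ Finset.range R, (W (α * d + β) r : A) *
          c (i + 1) (((ρ * R + r) * d ^ (h - 1 - i) + x) * d ^ (h - 1 - i) + y))
    (h0 : ∀ ρ < R ^ h, c h ρ = a h ρ * b h ρ) :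
    ∀ x < d ^ h, ∀ z < d ^ h, c 0 (x * d ^ h + z) =
      D ^ h * ∑ y ∈ Finset.range (d ^ h), a 0 (x * d ^ h + y) * b 0 (y * d ^ h + z) := by
  -- Induction on the number `m` of levels below: each block of layer `h - m` of `c` is `D ^ m`
  -- times the product of the corresponding blocks of `a` and `b`.
  have key : ∀ m ≤ h, ∀ ρ < R ^ (h - m), ∀ x < d ^ m, ∀ z < d ^ m,
      c (h - m) ((ρ * d ^ m + x) * d ^ m + z) = D ^ m * ∑ y ∈ Finset.range (d ^ m),
        a (h - m) ((ρ * d ^ m + x) * d ^ m + y) * b (h - m) ((ρ * d ^ m + y) * d ^ m + z) := by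
    intro m
    induction m with
    | zero =>
      intro _ ρ hρ x hx z hz
      obtain rfl : x = 0 := by simpa using hx
      obtain rfl : z = 0 := by simpa using hz
      simpa using h0 ρ hρ
    | succ m ih =>
      intro hm ρ hρ x hx z hz
      have e1 : h - 1 - (h - (m + 1)) = m := by omega
      have e2 : h - (h - (m + 1)) = m + 1 := by omega
      have e3 : h - (m + 1) + 1 = h - m := by omega
      have hi : h - (m + 1) < h := by omega
      have ha' := ha _ hi ρ hρ
      have hb' := hb _ hi ρ hρ
      have hc' := hc _ hi ρ hρ
      rw [e1, e2, e3] at ha' hb' hc'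
      have hdm : 0 < d ^ m := Nat.pow_pos hd
      have split : ∀ x < d ^ (m + 1), x / d ^ m < d ∧ x % d ^ m < d ^ m ∧
          x = x / d ^ m * d ^ m + x % d ^ m := fun x hx =>
        ⟨Nat.div_lt_of_lt_mul (by rwa [← pow_succ]), Nat.mod_lt _ hdm, by
          rw [mul_comm]; exact (Nat.div_add_mod _ _).symm⟩
      obtain ⟨hα, hx', ex⟩ := split x hx
      obtain ⟨hβ, hz', ez⟩ := split z hz
      generalize x / d ^ m = α at hα ex
      generalize z / d ^ m = β at hβ ez
      generalize x % d ^ m = x' at hx' ex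
      generalize z % d ^ m = z' at hz' ez
      subst ex ez
      rw [hc' α hα β hβ x' hx' z' hz']
      have hρR : ∀ r ∈ Finset.range R, ρ * R + r < R ^ (h - m) := by
        intro r hr
        rw [Finset.mem_range] at hr
        rw [← e3, pow_succ]
        calc ρ * R + r < ρ * R + R := by omega
          _ = (ρ + 1) * R := by ring
          _ ≤ _ := Nat.mul_le_mul_right _ hρ
      calc _ = ∑ r ∈ Finset.range R, (W (α * d + β) r : A) * (D ^ m *
            ∑ y ∈ Finset.range (d ^ m),
              a (h - m) (((ρ * R + r) * d ^ m + x') * d ^ m + y) *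
              b (h - m) (((ρ * R + r) * d ^ m + y) * d ^ m + z')) :=
            Finset.sum_congr rfl fun r hr => by rw [ih (by omega) _ (hρR r hr) x' hx' z' hz']
        -- The sum over the inner index `y` is moved outside. For fixed `y` the scheme is then
        -- applied to scalars.
        _ = D ^ m * ∑ y ∈ Finset.range (d ^ m), ∑ r ∈ Finset.range R, (W (α * d + β) r : A) *
              (a (h - m) (((ρ * R + r) * d ^ m + x') * d ^ m + y) *
              b (h - m) (((ρ * R + r) * d ^ m + y) * d ^ m + z')) := by
            rw [Finset.sum_comm]
            simp only [Finset.mul_sum]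
            exact Finset.sum_congr rfl fun r _ => Finset.sum_congr rfl fun y _ => by ring
        _ = D ^ m * ∑ y ∈ Finset.range (d ^ m), D * ∑ β' ∈ Finset.range d,
              a (h - (m + 1)) ((ρ * d ^ (m + 1) + (α * d ^ m + x')) * d ^ (m + 1)
                + (β' * d ^ m + y)) *
              b (h - (m + 1)) ((ρ * d ^ (m + 1) + (β' * d ^ m + y)) * d ^ (m + 1)
                + (β * d ^ m + z')) := by
            congr 1
            refine Finset.sum_congr rfl fun y hy => ?_
            rw [Finset.mem_range] at hy
            rw [← hS.block (fun p q => a (h - (m + 1))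
              ((ρ * d ^ (m + 1) + (p * d ^ m + x')) * d ^ (m + 1) + (q * d ^ m + y)))
              (fun p q => b (h - (m + 1))
              ((ρ * d ^ (m + 1) + (p * d ^ m + y)) * d ^ (m + 1) + (q * d ^ m + z'))) hα hβ]
            refine Finset.sum_congr rfl fun r hr => ?_
            rw [Finset.mem_range] at hr
            rw [ha' r hr x' hx' y hy, hb' r hr y hy z' hz']
        _ = _ := by
            rw [← Finset.mul_sum, ← mul_assoc, ← pow_succ, Finset.sum_comm]
            congr 1
            rw [show Finset.range (d ^ (m + 1)) = Finset.range (d * d ^ m) by rw [pow_succ'],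
              sum_range_mul_eq]
  intro x hx z hz
  have := key h le_rfl 0 (by simp) x hx z hz
  simpa using this

end Arith

namespace RAM

/-! ### Vertex sets as bit masks -/

/-- Bit `u` of the mask `l`. -/
def bit (l u : ℕ) : ℕ := l / 2 ^ u % 2

/-- The weight of the cut described by the mask `l`, for the `n × n` matrix of weights `w`. -/
def cost (n : ℕ) (w : ℕ → ℕ) (l : ℕ) : ℕ :=
  ∑ p ∈ Finset.range (n * n), w p * (bit l (p % n) * (1 - bit l (p / n)))

/-- The number of vertices in the set described by the mask `l`. -/
def pop (n l : ℕ) : ℕ := ∑ v ∈ Finset.range n, bit l v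

theorem bit_le (l u : ℕ) : bit l u ≤ 1 := by unfold bit; omega

theorem cost_le (n : ℕ) (w : ℕ → ℕ) (l : ℕ) : cost n w l ≤ ∑ p ∈ Finset.range (n * n), w p := by
  refine Finset.sum_le_sum fun p _ => ?_
  have h1 := bit_le l (p % n)
  have h2 : 1 - bit l (p / n) ≤ 1 := Nat.sub_le _ _
  calc _ ≤ w p * (1 * 1) := Nat.mul_le_mul_left _ (Nat.mul_le_mul h1 h2)
    _ = _ := by ring

theorem pop_le (n l : ℕ) : pop n l ≤ n := by
  calc _ ≤ ∑ v ∈ Finset.range n, 1 := Finset.sum_le_sum fun v _ => bit_le l v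
    _ = n := by simp

/-! ### Layout of the memory

Arrays `0`, `1`, `2`, `3` are fixed by the input and output conventions. Arrays `4`, ..., `29` hold
parameters and tables that are computed once, the others are working space. -/

/-- The parameters needed for evaluating masks: array `4` holds `n`, array `5` holds `k`, array `7`
holds `n²`, and array `8` holds the powers of `2`. -/
structure Base (n k : ℕ) (m : Mem) : Prop where
  n_eq : m 4 0 = n
  k_eq : m 5 0 = k
  nn_eq : m 7 0 = n * n
  pow_eq : ∀ u < n, m 8 u = 2 ^ u

/-- The memories agree on the input and the parameters. -/
def Agree (m m' : Mem) : Prop := ∀ a < 30, a ≠ 3 → m' a = m a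

theorem Agree.of_frame {P : Prog} {m m' : Mem} (hw : ∀ x ∈ P.writes, 30 ≤ x)
    (h : ∀ a, a ∉ P.writes → m' a = m a) : Agree m m' :=
  fun a ha _ => h a fun hx => absurd (hw a hx) (by omega)

theorem Agree.trans {m m' m'' : Mem} (h : Agree m m') (h' : Agree m' m'') : Agree m m'' :=
  fun a ha h3 => (h' a ha h3).trans (h a ha h3)

theorem Agree.set {m : Mem} {a : ℕ} (ha : 30 ≤ a) (i x : ℕ) : Agree m (m.set a i x) :=
  fun a' ha' _ => Mem.set_of_ne m (by omega) i x

theorem Base.agree {n k : ℕ} {m m' : Mem} (h : Base n k m) (ha : Agree m m') : Base n k m' where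
  n_eq := by rw [ha 4 (by norm_num) (by norm_num), h.n_eq]
  k_eq := by rw [ha 5 (by norm_num) (by norm_num), h.k_eq]
  nn_eq := by rw [ha 7 (by norm_num) (by norm_num), h.nn_eq]
  pow_eq := by rw [ha 8 (by norm_num) (by norm_num)]; exact h.pow_eq

/-! ### Evaluating a mask -/

/-- Bit `e` of the mask in array `30`. -/
def Expr.bit (e : Expr) : Expr := .mod (.div (.var 30) (.load 8 e)) (.const 2)

/-- Puts the weight of the mask in array `30`, with respect to the weights in array `w`, into
array `32`. -/
def costProg (w : ℕ) : Prog :=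
  .seq (.store 32 (.const 0) (.const 0))
    (.forLoop 31 7 (.store 32 (.const 0) (.add (.var 32) (.mul (.load w (.var 31))
      (.mul (.bit (.mod (.var 31) (.var 4))) (.isZero (.bit (.div (.var 31) (.var 4)))))))))

/-- Puts the number of elements of the mask in array `30` into array `34`. -/
def popProg : Prog :=
  .seq (.store 34 (.const 0) (.const 0))
    (.forLoop 33 4 (.store 34 (.const 0) (.add (.var 34) (.bit (.var 33)))))

@[simp] theorem writes_costProg (w : ℕ) : (costProg w).writes = [32, 31, 32, 31] := rfl
@[simp] theorem writes_popProg : popProg.writes = [34, 33, 34, 33] := rfl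

theorem ok_costProg (w : ℕ) : (costProg w).Ok := by
  simp [costProg, Prog.ok_forLoop, Prog.Ok, Expr.Ok, Expr.Small, Expr.bit, Expr.mod, Expr.isZero]

theorem ok_popProg : popProg.Ok := by
  simp [popProg, Prog.ok_forLoop, Prog.Ok, Expr.Ok, Expr.Small, Expr.bit, Expr.mod]

variable {Ω Ξ n k : ℕ} {m : Mem}

/-- The partial sums never exceed the total weight, which keeps the accumulator below `Ξ`. -/
theorem runs_costProg (hΩ : Ω ≤ Ξ) (hn : n * n ≤ Ω) (hb : Base n k m) {w : ℕ} (hw : w ≠ 31)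
    (hw' : w ≠ 32) (hsum : ∑ p ∈ Finset.range (n * n), m w p ≤ Ξ) :
    Runs Ω Ξ (n * n + 1) (costProg w) m fun m' => m' 32 0 = cost n (m w) (m 30 0) := by
  refine Runs.store_seq hΩ (by omega) (by simp) ?_
  refine (Runs.forLoop (c := 1) (cnt := n * n) hΩ le_rfl (by simp [hb.nn_eq])
    (by simp [Prog.writes]) (by simp [Prog.writes]) (by simp) (hn.trans (le_lim hΩ _))
    (fun j m' => m' 32 0 =
      ∑ p ∈ Finset.range j, m w p * (bit (m 30 0) (p % n) * (1 - bit (m 30 0) (p / n))))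
    (by simp) ?_).mono (by omega) fun m' _ _ h => h
  intro j m' hj hf hj' hI
  simp only [Prog.writes_forLoop, Prog.writes, List.mem_cons, List.mem_append, List.not_mem_nil,
    not_or, or_false, and_imp] at hf
  have h30 : m' 30 0 = m 30 0 := by rw [hf 30] <;> simp
  have h4 : m' 4 0 = n := by rw [hf 4] <;> simp [hb.n_eq]
  have hwj : m' w j = m w j := by rw [hf w] <;> simp [hw, hw']
  have hpos : 0 < n := by rcases Nat.eq_zero_or_pos n with h | h; · simp [h] at hj
                          · exact h
  have h8 : ∀ u < n, m' 8 u = 2 ^ u := by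
    intro u hu; rw [hf 8] <;> simp [hb.pow_eq u hu]
  have h8a := h8 (j % n) (Nat.mod_lt _ hpos)
  have h8b := h8 (j / n) (Nat.div_lt_of_lt_mul hj)
  have hval : (Expr.add (.var 32) (.mul (.load w (.var 31))
      (.mul (.bit (.mod (.var 31) (.var 4))) (.isZero (.bit (.div (.var 31) (.var 4))))))).eval m' =
      ∑ p ∈ Finset.range (j + 1),
        m w p * (bit (m 30 0) (p % n) * (1 - bit (m 30 0) (p / n))) := by
    rw [Finset.sum_range_succ, ← hI]
    simp [Expr.bit, Expr.isZero, hj', h4, h30, hwj, h8a, h8b, bit]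
  refine Runs.store hΩ le_rfl ?_ ?_
  · rw [hval]
    refine le_trans ?_ ((cost_le n (m w) (m 30 0)).trans hsum)
    exact Finset.sum_le_sum_of_subset (Finset.range_mono hj)
  · rw [hval]; simp

theorem runs_popProg (hΩ : Ω ≤ Ξ) (hn : n ≤ Ω) (hb : Base n k m) :
    Runs Ω Ξ (n + 1) popProg m fun m' => m' 34 0 = pop n (m 30 0) := by
  refine Runs.store_seq hΩ (by omega) (by simp) ?_
  refine (Runs.forLoop (c := 1) (cnt := n) hΩ le_rfl (by simp [hb.n_eq])
    (by simp [Prog.writes]) (by simp [Prog.writes]) (by simp) (hn.trans (le_lim hΩ _))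
    (fun j m' => m' 34 0 = ∑ v ∈ Finset.range j, bit (m 30 0) v)
    (by simp) ?_).mono (by omega) fun m' _ _ h => h
  intro j m' hj hf hj' hI
  simp only [Prog.writes_forLoop, Prog.writes, List.mem_cons, List.mem_append, List.not_mem_nil,
    not_or, or_false, and_imp] at hf
  have h30 : m' 30 0 = m 30 0 := by rw [hf 30] <;> simp
  have h8 : m' 8 j = 2 ^ j := by rw [hf 8] <;> simp [hb.pow_eq j hj]
  have hval : (Expr.add (.var 34) (.bit (.var 33))).eval m' =
      ∑ v ∈ Finset.range (j + 1), bit (m 30 0) v := by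
    rw [Finset.sum_range_succ, ← hI]
    simp [Expr.bit, hj', h30, h8, bit]
  refine Runs.store hΩ le_rfl ?_ ?_
  · rw [hval]
    refine le_trans ?_ (((pop_le n (m 30 0)).trans hn).trans (le_lim hΩ _))
    exact Finset.sum_le_sum_of_subset (Finset.range_mono hj)
  · rw [hval]; simp

end RAM

namespace RAM

/-! ### Keeping the best mask -/

/-- The scalars `35`, `36`, `37` describe the best mask of size `k` in `S`: whether there is one,
its weight, and the mask itself. -/
def IsBest (n k : ℕ) (w : ℕ → ℕ) (S : Set ℕ) (m : Mem) : Prop :=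
  (m 35 0 = 0 ∧ ∀ l ∈ S, pop n l ≠ k) ∨
  (m 35 0 = 1 ∧ pop n (m 37 0) = k ∧ m 36 0 = cost n w (m 37 0) ∧
    ∀ l ∈ S, pop n l = k → cost n w (m 37 0) ≤ cost n w l)

theorem IsBest.congr {n k : ℕ} {w : ℕ → ℕ} {S : Set ℕ} {m m' : Mem} (h : IsBest n k w S m)
    (h5 : m' 35 = m 35) (h6 : m' 36 = m 36) (h7 : m' 37 = m 37) : IsBest n k w S m' := by
  unfold IsBest; rw [h5, h6, h7]; exact h

theorem IsBest.subset {n k : ℕ} {w : ℕ → ℕ} {S S' : Set ℕ} {m : Mem} (h : IsBest n k w S m)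
    (hS : S' ⊆ S) : IsBest n k w S' m :=
  h.imp (fun h => ⟨h.1, fun l hl => h.2 l (hS hl)⟩)
    fun h => ⟨h.1, h.2.1, h.2.2.1, fun l hl => h.2.2.2 l (hS hl)⟩

/-- Compares the mask in array `30` with the best mask so far. -/
def considerProg : Prog :=
  .seq (costProg 2) (.seq popProg
    (.ite (.mul (.eq (.var 34) (.var 5)) (.add (.isZero (.var 35)) (.sub (.var 36) (.var 32))))
      (.seq (.store 35 (.const 0) (.const 1))
        (.seq (.store 36 (.const 0) (.var 32)) (.store 37 (.const 0) (.var 30))))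
      .skip))

@[simp] theorem writes_considerProg :
    considerProg.writes = [32, 31, 32, 31, 34, 33, 34, 33, 35, 36, 37] := rfl

theorem ok_considerProg : considerProg.Ok := by
  simp [considerProg, ok_costProg, ok_popProg, Prog.Ok, Expr.Ok, Expr.Small, Expr.eq, Expr.isZero]

variable {Ω Ξ n k : ℕ} {m : Mem}

theorem runs_considerProg (hΩ : Ω ≤ Ξ) (h1 : 1 ≤ Ω) (hn : n * n ≤ Ω) (hb : Base n k m)
    (hsum : ∑ p ∈ Finset.range (n * n), m 2 p ≤ Ξ) {S : Set ℕ} (hS : IsBest n k (m 2) S m) :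
    Runs Ω Ξ (n * n + 1) considerProg m (IsBest n k (m 2) (insert (m 30 0) S)) := by
  refine Runs.of_bdd fun hbd => Runs.seq ?_
  refine (runs_costProg hΩ hn hb (by norm_num) (by norm_num) hsum).mono le_rfl ?_
  intro m₁ hbd₁ hf₁ hc _
  have hb₁ : Base n k m₁ := hb.agree (Agree.of_frame (by simp) hf₁)
  refine Runs.seq ((runs_popProg hΩ (le_trans (Nat.le_mul_self n) hn) hb₁).mono
    (by nlinarith [Nat.le_mul_self n]) ?_)
  intro m₂ hbd₂ hf₂ hp _
  simp only [writes_costProg, List.mem_cons, List.not_mem_nil, not_or, or_false, and_imp] at hf₁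
  simp only [writes_popProg, List.mem_cons, List.not_mem_nil, not_or, or_false, and_imp] at hf₂
  have e30 : m₁ 30 0 = m 30 0 := by rw [hf₁] <;> simp
  have e30' : m₂ 30 0 = m 30 0 := by rw [hf₂, e30] <;> simp
  have e5 : m₂ 5 0 = k := by rw [hf₂, hf₁, hb.k_eq] <;> simp
  have e32 : m₂ 32 0 = cost n (m 2) (m 30 0) := by rw [hf₂, hc] <;> simp
  have e35 : m₂ 35 = m 35 := by rw [hf₂, hf₁] <;> simp
  have e36 : m₂ 36 = m 36 := by rw [hf₂, hf₁] <;> simp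
  have e37 : m₂ 37 = m 37 := by rw [hf₂, hf₁] <;> simp
  rw [e30] at hp
  -- The test is nonzero exactly if the mask has size `k` and either no best mask exists or the
  -- truncated difference of the old and the new weight is positive.
  refine Runs.ite hΩ (by omega) (fun ht => ?_) fun ht => ?_
  · refine Runs.store_seq hΩ (by omega) (by simpa [lim] using h1) ?_
    refine Runs.store_seq hΩ (by omega) ?_ ?_
    · simpa [e32, lim] using (cost_le _ _ _).trans hsum
    refine Runs.store hΩ (by omega) ?_ ?_
    · have := hbd 30 0
      simp [e30']; simpa [lim] using this
    · simp [hp, e5, e32, e35, e36] at ht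
      refine Or.inr ⟨by simp, by simp [e30', ht.1], by simp [e30', e32], ?_⟩
      simp only [Expr.eval_const, Expr.eval_load, Mem.set_self, ne_eq,
        Nat.reduceEqDiff, not_false_eq_true, Mem.set_of_ne, e30']
      intro l hl hk
      rcases hl with rfl | hl
      · exact le_rfl
      · rcases hS with h | ⟨h35, -, h36, h⟩
        · exact absurd hk (h.2 l hl)
        · have := h l hl hk
          have h2 := ht.2
          omega
  · refine Runs.skip (by omega) ?_
    simp [hp, e5, e32, e35, e36] at ht
    have hb : IsBest n k (m 2) S m₂ := hS.congr e35 e36 e37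
    rcases hb with ⟨h35, h⟩ | ⟨h35, h37, h36, h⟩
    · refine Or.inl ⟨h35, fun l hl => ?_⟩
      rcases hl with rfl | hl
      · intro hk
        rw [e35] at h35
        exact absurd h35 (ht hk).1
      · exact h l hl
    · refine Or.inr ⟨h35, h37, h36, fun l hl hk => ?_⟩
      rcases hl with rfl | hl
      · rw [← h36, e36]; have := (ht hk).2; omega
      · exact h l hl hk

/-- Considers all masks below the number in array `21`. -/
def bruteProg : Prog := .forLoop 38 21 (.seq (.store 30 (.const 0) (.var 38)) considerProg)

@[simp] theorem writes_bruteProg : bruteProg.writes =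
    38 :: ([30, 32, 31, 32, 31, 34, 33, 34, 33, 35, 36, 37] ++ [38]) := rfl

theorem ok_bruteProg : bruteProg.Ok := by
  simp [bruteProg, Prog.ok_forLoop, ok_considerProg, Prog.Ok, Expr.Ok]

theorem runs_bruteProg (hΩ : Ω ≤ Ξ) (h1 : 1 ≤ Ω) (hn : n * n ≤ Ω) (hb : Base n k m)
    (hsum : ∑ p ∈ Finset.range (n * n), m 2 p ≤ Ξ) {c : ℕ} (hc : m 21 0 = c) (hcΩ : c ≤ Ω)
    (h35 : m 35 0 = 0) :
    Runs Ω Ξ ((n * n + 1) * (c + 1)) bruteProg m (IsBest n k (m 2) {l | l < c}) := by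
  refine Runs.forLoop hΩ (by omega) hc (by simp [Prog.writes]) (by simp [Prog.writes])
    (by simp) (hcΩ.trans (le_lim hΩ _)) (fun j m' => IsBest n k (m 2) {l | l < j} m')
    (Or.inl ⟨by simp [h35], by simp⟩) ?_
  intro j m' hj hf hj' hI
  have ha : Agree m m' := Agree.of_frame (by
    simp [Prog.writes_forLoop, Prog.writes]) hf
  refine Runs.store_seq hΩ (by omega) (by simp [hj', lim]; omega) ?_
  have ha' : Agree m (m'.set 30 0 j) := ha.trans (Agree.set (by norm_num) _ _)
  have h2 : (m'.set 30 0 j) 2 = m 2 := ha' 2 (by norm_num) (by norm_num)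
  simp only [Expr.eval_const, Expr.eval_load, hj']
  have := runs_considerProg (S := {l | l < j}) hΩ h1 hn (hb.agree ha') (by rwa [h2])
    (by rw [h2]; exact hI.congr (by simp) (by simp) (by simp))
  rw [h2] at this
  refine this.mono le_rfl fun m'' _ _ h => ?_
  refine (h.subset ?_).congr (by simp) (by simp) (by simp)
  intro l hl
  simp only [Set.mem_ofPred_eq, Mem.set_self, Set.mem_insert_iff] at hl ⊢
  omega

/-- Writes the best mask to the output array. -/
def outProg : Prog :=
  .forLoop 33 4 (.store 3 (.var 33) (.mod (.div (.var 37) (.load 8 (.var 33))) (.const 2)))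

@[simp] theorem writes_outProg : outProg.writes = [33, 3, 33] := rfl

theorem ok_outProg : outProg.Ok := by
  simp [outProg, Prog.ok_forLoop, Prog.Ok, Expr.Ok, Expr.mod, Expr.Small]

theorem runs_outProg (hΩ : Ω ≤ Ξ) (h1 : 1 ≤ Ω) (hn : n ≤ Ω) (hb : Base n k m) :
    Runs Ω Ξ (n + 1) outProg m fun m' => ∀ v < n, m' 3 v = bit (m 37 0) v := by
  refine (Runs.forLoop (c := 1) (cnt := n) hΩ le_rfl (by simp [hb.n_eq])
    (by simp [Prog.writes]) (by simp [Prog.writes]) (by simp) (hn.trans (le_lim hΩ _))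
    (fun j m' => ∀ v < j, m' 3 v = bit (m 37 0) v)
    (by simp) ?_).mono (by omega) fun m' _ _ h => h
  intro j m' hj hf hj' hI
  simp only [Prog.writes_forLoop, Prog.writes, List.mem_cons, List.mem_append, List.not_mem_nil,
    not_or, or_false, and_imp] at hf
  have h37 : m' 37 0 = m 37 0 := by rw [hf 37] <;> simp
  have h8 : m' 8 j = 2 ^ j := by rw [hf 8] <;> simp [hb.pow_eq j hj]
  refine Runs.store hΩ le_rfl ?_ ?_
  · simp [hj', h8, lim]; omega
  · intro v hv
    rw [Mem.set_of_ne _ (by norm_num), Mem.set_apply]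
    simp only [Expr.eval_load, Expr.eval_const, hj', Expr.eval_mod, Expr.eval_div, h37, h8]
    split_ifs with h
    · rw [h]; rfl
    · exact hI v (by omega)

/-- Fills array `a` with the powers of `c` up to the exponent in array `b`. -/
def powProg (a b c : ℕ) : Prog :=
  .seq (.store a (.const 0) (.const 1))
    (.forLoop 31 b (.store a (.add (.var 31) (.const 1)) (.mul (.const c) (.load a (.var 31)))))

@[simp] theorem writes_powProg (a b c : ℕ) : (powProg a b c).writes = [a, 31, a, 31] := rfl

theorem ok_powProg (a b c : ℕ) : (powProg a b c).Ok := by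
  simp [powProg, Prog.ok_forLoop, Prog.Ok, Expr.Ok, Expr.Small]

theorem runs_powProg (hΩ : Ω ≤ Ξ) {a b c cnt : ℕ} (ha : a ≠ 31) (hab : b ≠ a) (hb : b ≠ 31)
    (hc : 1 ≤ c) (hcnt : m b 0 = cnt) (h1 : cnt ≤ Ω) (h2 : c ^ cnt ≤ Ω) :
    Runs Ω Ξ (cnt + 1) (powProg a b c) m fun m' => ∀ j ≤ cnt, m' a j = c ^ j := by
  have h3 : ∀ j ≤ cnt, c ^ j ≤ lim Ω Ξ a := fun j hj =>
    ((Nat.pow_le_pow_right hc hj).trans h2).trans (le_lim hΩ a)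
  refine Runs.store_seq hΩ (by omega) (by simpa using h3 0 (by omega)) ?_
  refine (Runs.forLoop (c := 1) (cnt := cnt) hΩ le_rfl (by simp [hab, hcnt])
    (by simp [Prog.writes, ha.symm]) (by simp [Prog.writes, hab]) hb (h1.trans (le_lim hΩ _))
    (fun j m' => ∀ v ≤ j, m' a v = c ^ v)
    (by simp [ha]) ?_).mono (by omega) fun m' _ _ h => h
  intro j m' hj hf hj' hI
  have hj0 := hI j le_rfl
  refine Runs.store hΩ le_rfl ?_ ?_
  · simp only [Expr.eval_load, Expr.eval_const, hj', Expr.eval_mul, hj0]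
    rw [← pow_succ']; exact h3 _ hj
  · intro v hv
    rw [Mem.set_of_ne _ ha, Mem.set_apply]
    simp only [Expr.eval_load, Expr.eval_const, hj', Expr.eval_mul, hj0, Expr.eval_add]
    split_ifs with h
    · rw [h, pow_succ']
    · exact hI v (by omega)

/-! ### Rounding the weights -/

/-- The minimum of `t` and `x / θ`, rounded up. -/
def rnd (θ x : ℕ) : ℕ → ℕ
  | 0 => 0
  | t + 1 => rnd θ x t + if rnd θ x t * θ < x then 1 else 0

theorem rnd_le (θ x t : ℕ) : rnd θ x t ≤ t := by
  induction t with
  | zero => exact le_rfl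
  | succ t ih => simp only [rnd]; split_ifs <;> omega

/-- A counter that ends below the cap has stopped, and it stops only once its multiple of `θ`
reaches `x`. -/
theorem le_rnd_mul {θ x t : ℕ} (h : rnd θ x t < t) : x ≤ rnd θ x t * θ := by
  induction t with
  | zero => omega
  | succ t ih =>
    simp only [rnd] at h ⊢
    have := rnd_le θ x t
    split_ifs at h ⊢ with h'
    · have := ih (by omega)
      omega
    · simpa using h'

/-- Before the last increment the multiple of `θ` was still below `x`. -/
theorem rnd_mul_le (θ x t : ℕ) : rnd θ x t * θ ≤ x + θ := by
  induction t with
  | zero => simp [rnd]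
  | succ t ih =>
    simp only [rnd]
    split_ifs with h'
    · rw [add_mul]; omega
    · simpa using ih

/-- Together with `le_rnd_mul` this makes `θ = 0` meaningful: weight 0 stays 0, and positive weights
receive the cap. This rounding serves optimal cuts of weight 0. -/
theorem rnd_zero_right (θ t : ℕ) : rnd θ 0 t = 0 := by
  induction t with
  | zero => rfl
  | succ t ih => simp [rnd, ih]

/-- The indicator of the arcs between the vertices below `2 s`. -/
def tyA (n s p : ℕ) : ℕ := (if p / n < 2 * s then 1 else 0) * (if p % n < 2 * s then 1 else 0)

/-- The indicator of the arcs between the vertices from `s` on. -/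
def tyD (n s p : ℕ) : ℕ := (if p / n < s then 0 else 1) * (if p % n < s then 0 else 1)

def Expr.tyA : Expr :=
  .mul (.lt (.div (.var 40) (.var 4)) (.mul (.const 2) (.var 10)))
    (.lt (.mod (.var 40) (.var 4)) (.mul (.const 2) (.var 10)))

def Expr.tyD : Expr :=
  .mul (.isZero (.lt (.div (.var 40) (.var 4)) (.var 10)))
    (.isZero (.lt (.mod (.var 40) (.var 4)) (.var 10)))

/-- Computes the weights, rounded in units of the weight with the index in array `38`, and
distributes them to the arrays `43`, `44`, `45`. -/
def roundProg : Prog :=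
  .seq (.store 39 (.const 0) (.load 2 (.var 38)))
    (.forLoop 40 7
      (.seq (.store 42 (.const 0) (.const 0))
      (.seq (.forLoop 41 16 (.store 42 (.const 0) (.add (.var 42)
        (.lt (.mul (.var 42) (.var 39)) (.mul (.load 2 (.var 40)) (.var 15))))))
      (.seq (.store 43 (.var 40) (.mul (.var 42) .tyA))
      (.seq (.store 44 (.var 40) (.mul (.var 42) (.mul (.isZero .tyA) .tyD)))
        (.store 45 (.var 40) (.mul (.var 42) (.mul (.isZero .tyA) (.isZero .tyD)))))))))

@[simp] theorem writes_roundProg :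
    roundProg.writes = [39, 40, 42, 41, 42, 41, 43, 44, 45, 40] := rfl

theorem ok_roundProg : roundProg.Ok := by
  simp [roundProg, Prog.ok_forLoop, Prog.Ok, Expr.Ok, Expr.mod, Expr.Small, Expr.tyA, Expr.tyD,
    Expr.lt, Expr.isZero]

/-- The rounded weight is found by counting up and comparing products of a small and a large number.
A division by `θ` would have two large operands and violate `Prog.Ok`. -/
theorem runs_roundProg (hΩ : Ω ≤ Ξ) (hn : n * n ≤ Ω) (hb : Base n k m) {s Q K i : ℕ}
    (hs : m 10 0 = s) (hQ : m 15 0 = Q) (hK : m 16 0 = K) (hi : m 38 0 = i) (hKΩ : K ≤ Ω) :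
    Runs Ω Ξ ((K + 1) * (n * n + 1)) roundProg m fun m' => ∀ p < n * n,
      m' 43 p = rnd (m 2 i) (m 2 p * Q) K * tyA n s p ∧
      m' 44 p = rnd (m 2 i) (m 2 p * Q) K * ((1 - tyA n s p) * tyD n s p) ∧
      m' 45 p = rnd (m 2 i) (m 2 p * Q) K * ((1 - tyA n s p) * (1 - tyD n s p)) := by
  refine Runs.of_bdd fun hbd => ?_
  refine Runs.store_seq hΩ (by nlinarith) ?_ ?_
  · simpa [lim] using hbd 2 (m 38 0)
  simp only [Expr.eval_const, Expr.eval_load, hi]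
  refine Runs.forLoop (c := K + 1) (cnt := n * n) hΩ (by omega) (by simp [hb.nn_eq])
    (by simp [Prog.writes, Prog.writes_forLoop]) (by simp [Prog.writes, Prog.writes_forLoop])
    (by simp) (hn.trans (le_lim hΩ _))
    (fun j m' => ∀ p < j, m' 43 p = rnd (m 2 i) (m 2 p * Q) K * tyA n s p ∧
      m' 44 p = rnd (m 2 i) (m 2 p * Q) K * ((1 - tyA n s p) * tyD n s p) ∧
      m' 45 p = rnd (m 2 i) (m 2 p * Q) K * ((1 - tyA n s p) * (1 - tyD n s p)))
    (by simp) ?_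
  intro j m₁ hj hf₁ hj₁ hI
  simp only [Prog.writes_forLoop, Prog.writes, List.mem_cons, List.mem_append, List.not_mem_nil,
    not_or, or_false, and_imp] at hf₁
  refine Runs.store_seq hΩ (by omega) (by simp) (Runs.seq ?_)
  have a2 : m₁ 2 = m 2 := by rw [hf₁] <;> simp
  have a39 : m₁ 39 0 = m 2 i := by rw [hf₁] <;> simp
  have a15 : m₁ 15 0 = Q := by rw [hf₁] <;> simp [hQ]
  have a16 : m₁ 16 0 = K := by rw [hf₁] <;> simp [hK]
  have a10 : m₁ 10 0 = s := by rw [hf₁] <;> simp [hs]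
  have a4 : m₁ 4 0 = n := by rw [hf₁] <;> simp [hb.n_eq]
  refine (Runs.forLoop (c := 1) (cnt := K) hΩ le_rfl (by simp [a16])
    (by simp [Prog.writes]) (by simp [Prog.writes]) (by simp) (hKΩ.trans (le_lim hΩ _))
    (fun t m' => m' 42 0 = rnd (m 2 i) (m 2 j * Q) t) (by simp [rnd]) ?_).mono (by omega) ?_
  · intro t m₂ ht hf₂ ht₂ hI₂
    simp only [Prog.writes_forLoop, Prog.writes, List.mem_cons, List.mem_append,
      List.not_mem_nil, not_or, or_false, and_imp] at hf₂
    have b2 : m₂ 2 = m 2 := by rw [hf₂] <;> simp [a2]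
    have b39 : m₂ 39 0 = m 2 i := by rw [hf₂] <;> simp [a39]
    have b15 : m₂ 15 0 = Q := by rw [hf₂] <;> simp [a15]
    have b40 : m₂ 40 0 = j := by rw [hf₂] <;> simp [hj₁]
    have hval : (Expr.add (.var 42) (.lt (.mul (.var 42) (.var 39))
        (.mul (.load 2 (.var 40)) (.var 15)))).eval m₂ = rnd (m 2 i) (m 2 j * Q) (t + 1) := by
      simp [rnd, hI₂, b2, b39, b15, b40]
    refine Runs.store hΩ le_rfl ?_ ?_
    · rw [hval]
      exact ((rnd_le _ _ _).trans (by omega : t + 1 ≤ Ω)).trans (le_lim hΩ _)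
    · rw [hval]; simp
  · intro m₂ _ hf₂ hr _
    simp only [Prog.writes_forLoop, Prog.writes, List.mem_cons, List.mem_append,
      List.not_mem_nil, not_or, or_false, and_imp] at hf₂
    have b40 : m₂ 40 0 = j := by rw [hf₂] <;> simp [hj₁]
    have b4 : m₂ 4 0 = n := by rw [hf₂] <;> simp [a4]
    have b10 : m₂ 10 0 = s := by rw [hf₂] <;> simp [a10]
    have b43 : m₂ 43 = m₁ 43 := by rw [hf₂] <;> simp
    have b44 : m₂ 44 = m₁ 44 := by rw [hf₂] <;> simp
    have b45 : m₂ 45 = m₁ 45 := by rw [hf₂] <;> simp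
    have eA : ∀ m' : Mem, m' 40 0 = j → m' 4 0 = n → m' 10 0 = s →
        Expr.tyA.eval m' = tyA n s j := by
      intro m' c1 c2 c3
      simp [Expr.tyA, c1, c2, c3, tyA]
    have eD : ∀ m' : Mem, m' 40 0 = j → m' 4 0 = n → m' 10 0 = s →
        Expr.tyD.eval m' = tyD n s j := by
      intro m' c1 c2 c3
      have hz : ∀ x s : ℕ, (if (if x < s then 1 else 0) = 0 then 1 else 0) =
          if x < s then 0 else 1 := by intro x s; split_ifs <;> simp_all
      simp only [Expr.tyD, Expr.eval_mul, Expr.eval_isZero, Expr.eval_lt, Expr.eval_div,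
        Expr.eval_mod, Expr.eval_load, Expr.eval_const, c1, c2, c3, hz, tyD]
    have hz : ∀ x : ℕ, x ≤ 1 → (if x = 0 then 1 else 0) = 1 - x := by
      intro x hx; split_ifs <;> omega
    have hA1 : tyA n s j ≤ 1 := by unfold tyA; split_ifs <;> simp
    have hD1 : tyD n s j ≤ 1 := by unfold tyD; split_ifs <;> simp
    have hr' : m₂ 42 0 ≤ Ω := by rw [hr]; exact (rnd_le _ _ _).trans hKΩ
    have hle : ∀ x : ℕ, x ≤ 1 → m₂ 42 0 * x ≤ Ω := fun x hx =>
      (Nat.mul_le_mul_left _ hx).trans (by omega)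
    have hm1 : ∀ x y : ℕ, x ≤ 1 → y ≤ 1 → x * y ≤ 1 := fun x y hx hy => Nat.mul_le_mul hx hy
    refine Runs.store_seq hΩ (by omega) ?_ ?_
    · refine le_trans ?_ (le_lim hΩ _)
      simp only [Expr.eval_mul, Expr.eval_load, Expr.eval_const, eA m₂ b40 b4 b10]
      exact hle _ hA1
    refine Runs.store_seq hΩ (by omega) ?_ ?_
    · refine le_trans ?_ (le_lim hΩ _)
      simp [Expr.eval_mul, eA, eD, b40, b4, b10, hz _ hA1]
      exact hle _ (hm1 _ _ (Nat.sub_le _ _) hD1)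
    refine Runs.store hΩ (by omega) ?_ ?_
    · refine le_trans ?_ (le_lim hΩ _)
      simp [Expr.eval_mul, eA, eD, b40, b4, b10, hz _ hA1, hz _ hD1]
      exact hle _ (hm1 _ _ (Nat.sub_le _ _) (Nat.sub_le _ _))
    · intro p hp
      simp [Mem.set_apply, eA, eD, b40, b4, b10, hz _ hA1, hz _ hD1, hr]
      by_cases h : p = j
      · simp [h]
      · simpa [h, b43, b44, b45] using hI p (by omega)

end RAM

namespace RAM

/-! ### Matrix multiplication in memory -/

/-- The sizes of an instance: `n`, `k`, `q`, the exponent `e` of the dimension `2 ^ e` of the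
bilinear algorithm, its number of products `R`, its denominator `D`, and the depth `h` of its
recursive use. -/
structure Params where
  (n k q e R D h : ℕ)

namespace Params

variable (P : Params)

/-- The dimension of the bilinear algorithm. -/
def d : ℕ := 2 ^ P.e
/-- The dimension of the matrices. -/
def N : ℕ := P.d ^ P.h
/-- The number of bits of the row indices. -/
def s : ℕ := P.e * P.h
/-- The maximal size of a layer. -/
def S : ℕ := P.R ^ P.h
/-- The modulus. -/
def M : ℕ := (P.D * P.d) ^ P.h + 1
/-- The scaling factor of the weights. -/
def Q : ℕ := P.n * P.n * P.q
/-- The maximal rounded weight. -/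
def K : ℕ := P.n * P.n * (P.Q + 1) + 1
/-- An upper bound on rounded cut weights. -/
def C : ℕ := P.n * P.n * P.K + 1
/-- The number of matrix products for one rounding. -/
def T : ℕ := (P.n + 1) * (P.C * P.C)

end Params

/-- The parameters are in their places. -/
structure Ctx (P : Params) (m : Mem) : Prop extends Base P.n P.k m where
  N_eq : m 9 0 = P.N
  s_eq : m 10 0 = P.s
  pow_d_eq : ∀ j ≤ P.h, m 11 j = P.d ^ j
  h_eq : m 12 0 = P.h
  S_eq : m 13 0 = P.S
  M_eq : m 14 0 = P.M
  Q_eq : m 15 0 = P.Q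
  K_eq : m 16 0 = P.K
  C_eq : m 17 0 = P.C
  T_eq : m 18 0 = P.T
  hS_eq : m 19 0 = P.h * P.S
  NN_eq : m 20 0 = P.N * P.N

theorem Ctx.agree {P : Params} {m m' : Mem} (h : Ctx P m) (ha : Agree m m') : Ctx P m' where
  toBase := h.toBase.agree ha
  N_eq := by rw [ha 9 (by norm_num) (by norm_num), h.N_eq]
  s_eq := by rw [ha 10 (by norm_num) (by norm_num), h.s_eq]
  pow_d_eq := by rw [ha 11 (by norm_num) (by norm_num)]; exact h.pow_d_eq
  h_eq := by rw [ha 12 (by norm_num) (by norm_num), h.h_eq]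
  S_eq := by rw [ha 13 (by norm_num) (by norm_num), h.S_eq]
  M_eq := by rw [ha 14 (by norm_num) (by norm_num), h.M_eq]
  Q_eq := by rw [ha 15 (by norm_num) (by norm_num), h.Q_eq]
  K_eq := by rw [ha 16 (by norm_num) (by norm_num), h.K_eq]
  C_eq := by rw [ha 17 (by norm_num) (by norm_num), h.C_eq]
  T_eq := by rw [ha 18 (by norm_num) (by norm_num), h.T_eq]
  hS_eq := by rw [ha 19 (by norm_num) (by norm_num), h.hS_eq]
  NN_eq := by rw [ha 20 (by norm_num) (by norm_num), h.NN_eq]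

/-- The numbers below `Ω` suffice for the instance. -/
structure Fits (P : Params) (Ω : ℕ) : Prop where
  n_le : P.n ≤ Ω
  nn_le : P.n * P.n ≤ Ω
  hS_le : P.h * P.S ≤ Ω
  M_le : P.M ≤ Ω
  N_le : P.N * P.N * P.N ≤ Ω
  C_le : 4 * P.C ≤ Ω
  T_le : P.T ≤ Ω
  h_pos : 1 ≤ P.h
  d_sq_le : P.d ^ 2 ≤ P.R

namespace Params

variable {P : Params}

theorem d_pos : 0 < P.d := Nat.two_pow_pos _
theorem N_pos : 0 < P.N := Nat.pow_pos d_pos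
theorem M_pos : 0 < P.M := Nat.succ_pos _

end Params

namespace Fits

variable {P : Params} {Ω : ℕ} (h : Fits P Ω)

include h

theorem R_pos : 0 < P.R := (Nat.pow_pos Params.d_pos).trans_le h.d_sq_le

theorem S_pos : 0 < P.S := Nat.pow_pos h.R_pos

theorem S_le : P.S ≤ Ω := (Nat.le_mul_of_pos_left _ h.h_pos).trans h.hS_le

theorem h_le : P.h ≤ Ω := (Nat.le_mul_of_pos_right _ h.S_pos).trans h.hS_le

theorem NN_le : P.N * P.N ≤ Ω := (Nat.le_mul_of_pos_right _ Params.N_pos).trans h.N_le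

theorem N_le' : P.N ≤ Ω := (Nat.le_mul_self _).trans h.NN_le

theorem one_le : 1 ≤ Ω := h.h_pos.trans h.h_le

theorem K_le : P.n * P.n * P.K ≤ Ω := by
  have := h.C_le; unfold Params.C at this; omega

/-- Layer `i` fits into an interval of length `S`. -/
theorem layer_lt {i : ℕ} (hi : i ≤ P.h) {ρ x y : ℕ} (hρ : ρ < P.R ^ i) (hx : x < P.d ^ (P.h - i))
    (hy : y < P.d ^ (P.h - i)) : (ρ * P.d ^ (P.h - i) + x) * P.d ^ (P.h - i) + y < P.S := by
  set D := P.d ^ (P.h - i)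
  calc (ρ * D + x) * D + y < (ρ * D + x) * D + D := by omega
    _ = (ρ * D + (x + 1)) * D := by ring
    _ ≤ (ρ * D + D) * D := by gcongr; omega
    _ = (ρ + 1) * (P.d ^ 2) ^ (P.h - i) := by
      rw [← pow_mul, mul_comm 2, pow_mul]; ring
    _ ≤ P.R ^ i * P.R ^ (P.h - i) :=
      Nat.mul_le_mul hρ (Nat.pow_le_pow_left h.d_sq_le _)
    _ = P.S := by rw [← pow_add, Nat.add_sub_cancel' hi]; rfl

end Fits

/-- The residue modulo the content of array `14` of the integer `f i`, where `i < c` is the value of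
an expression. -/
def Expr.coef (f : ℕ → ℤ) (c : ℕ) (e : Expr) : Expr :=
  .sum c fun r => .mul (.eq e (.const r))
    (.add (.const (f r).toNat) (.mul (.const (-f r).toNat) (.sub (.var 14) (.const 1))))

/-- The coefficients are constants of the program, selected by equality tests; a negative one is a
multiple of M - 1, which is -1 modulo M. -/
theorem Expr.cast_eval_coef {m : Mem} {M : ℕ} (hM : m 14 0 = M) (hpos : 0 < M) (f : ℕ → ℤ) {c : ℕ}
    {e : Expr} (he : e.eval m < c) : ((Expr.coef f c e).eval m : ZMod M) = (f (e.eval m) : ℤ) := by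
  have h1 : (Expr.coef f c e).eval m =
      (f (e.eval m)).toNat + (-f (e.eval m)).toNat * (M - 1) := by
    simp only [Expr.coef, Expr.eval_sum, Expr.eval_mul, Expr.eval_eq, Expr.eval_const,
      Expr.eval_add, Expr.eval_sub, Expr.eval_load, hM]
    rw [Finset.sum_eq_single_of_mem _ (Finset.mem_range.2 he) fun r _ hr => by
      simp [hr.symm]]
    simp
  have h2 : ((M - 1 : ℕ) : ZMod M) = -1 := by
    rw [Nat.cast_sub hpos]; simp
  rw [h1]
  push_cast
  rw [h2]
  have h3 : (f (e.eval m)) = ((f (e.eval m)).toNat : ℤ) - ((-f (e.eval m)).toNat : ℤ) := by omega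
  conv_rhs => rw [h3]
  push_cast
  ring

theorem Expr.small_sum (c : ℕ) (g : ℕ → Expr) (h : ∀ j, (g j).Small) : (Expr.sum c g).Small := by
  induction c with
  | zero => trivial
  | succ c ih => exact ⟨ih, h c⟩

theorem Expr.ok_sum (c : ℕ) (g : ℕ → Expr) (h : ∀ j, (g j).Ok) : (Expr.sum c g).Ok := by
  induction c with
  | zero => trivial
  | succ c ih => exact ⟨ih, h c⟩

theorem Expr.small_coef {f : ℕ → ℤ} {c : ℕ} {e : Expr} (h : e.Small) : (Expr.coef f c e).Small :=
  Expr.small_sum _ _ fun r => by simp [Expr.Small, Expr.eq, Expr.isZero, h]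

theorem Expr.ok_coef {f : ℕ → ℤ} {c : ℕ} {e : Expr} (h : e.Small) (h' : e.Ok) :
    (Expr.coef f c e).Ok :=
  Expr.ok_sum _ _ fun r => by simp [Expr.Ok, Expr.Small, Expr.eq, Expr.isZero, h, h']

/-- Splits the index in array `57` into the number of a layer and a position, and decodes the
position, where array `a` holds the dimension of the matrices of the layer. -/
def splitProg (e : Expr) (a : ℕ) : Prog :=
  .seq (.store 58 (.const 0) e)
  (.seq (.store 59 (.const 0) (.mod (.var 57) (.var 13)))
  (.seq (.store 60 (.const 0) (.load 11 (.sub (.sub (.var 12) (.const 1)) (.var 58))))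
  (.seq (.store 61 (.const 0) (.load 11 (.sub (.var 12) (.var 58))))
  (.seq (.store 62 (.const 0) (.div (.var 59) (.mul (.var a) (.var a))))
  (.seq (.store 63 (.const 0) (.mod (.div (.var 59) (.var a)) (.var a)))
    (.store 64 (.const 0) (.mod (.var 59) (.var a))))))))

/-- The downward pass on array `a`. -/
def downProg (d R : ℕ) (U : ℕ → ℕ → ℤ) (a : ℕ) : Prog :=
  .forLoop 57 19 (.seq (splitProg (.div (.var 57) (.var 13)) 60)
    (.store a (.add (.var 57) (.var 13)) (.mod
      (.sum d fun p => .sum d fun q =>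
        .mul (.coef (fun r => U r (p * d + q)) R (.mod (.var 62) (.const R)))
          (.load a (.add (.mul (.var 58) (.var 13)) (.add (.mul (.add
            (.mul (.div (.var 62) (.const R)) (.var 61))
            (.add (.mul (.const p) (.var 60)) (.var 63))) (.var 61))
            (.add (.mul (.const q) (.var 60)) (.var 64))))))
      (.var 14))))

/-- The products of the last layers. -/
def productProg : Prog :=
  .forLoop 57 13 (.store 56 (.add (.var 19) (.var 57))
    (.mod (.mul (.load 54 (.add (.var 19) (.var 57))) (.load 55 (.add (.var 19) (.var 57))))
      (.var 14)))

/-- The upward pass. -/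
def upProg (d R : ℕ) (W : ℕ → ℕ → ℤ) : Prog :=
  .forLoop 57 19 (.seq
    (splitProg (.sub (.sub (.var 12) (.const 1)) (.div (.var 57) (.var 13))) 61)
    (.store 56 (.add (.mul (.var 58) (.var 13)) (.var 59)) (.mod
      (.sum R fun r =>
        .mul (.coef (fun p => W p r) (d * d) (.add (.mul (.div (.var 63) (.var 60)) (.const d))
            (.div (.var 64) (.var 60))))
          (.load 56 (.add (.mul (.add (.var 58) (.const 1)) (.var 13)) (.add (.mul (.add
            (.mul (.add (.mul (.var 62) (.const R)) (.const r)) (.var 60))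
            (.mod (.var 63) (.var 60))) (.var 60)) (.mod (.var 64) (.var 60))))))
      (.var 14))))

@[simp] theorem writes_splitProg (e : Expr) (a : ℕ) :
    (splitProg e a).writes = [58, 59, 60, 61, 62, 63, 64] := rfl

@[simp] theorem writes_downProg (d R : ℕ) (U : ℕ → ℕ → ℤ) (a : ℕ) :
    (downProg d R U a).writes = [57, 58, 59, 60, 61, 62, 63, 64, a, 57] := rfl

@[simp] theorem writes_productProg : productProg.writes = [57, 56, 57] := rfl

@[simp] theorem writes_upProg (d R : ℕ) (W : ℕ → ℕ → ℤ) :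
    (upProg d R W).writes = [57, 58, 59, 60, 61, 62, 63, 64, 56, 57] := rfl

theorem ok_downProg (d R : ℕ) (U : ℕ → ℕ → ℤ) (a : ℕ) : (downProg d R U a).Ok := by
  simp only [downProg, Prog.ok_forLoop, splitProg, Prog.Ok]
  simp [Expr.Ok, Expr.Small, Expr.mod]
  exact Expr.ok_sum _ _ fun p => Expr.ok_sum _ _ fun q =>
    ⟨Expr.ok_coef (by simp [Expr.Small]) (by simp [Expr.Ok, Expr.Small]),
      by simp [Expr.Ok, Expr.Small], Or.inl (Expr.small_coef (by simp [Expr.Small]))⟩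

theorem ok_productProg : productProg.Ok := by
  simp [productProg, Prog.ok_forLoop, Prog.Ok, Expr.Ok, Expr.Small, Expr.mod]

theorem ok_upProg (d R : ℕ) (W : ℕ → ℕ → ℤ) : (upProg d R W).Ok := by
  simp only [upProg, Prog.ok_forLoop, splitProg, Prog.Ok]
  simp [Expr.Ok, Expr.Small, Expr.mod]
  exact Expr.ok_sum _ _ fun r =>
    ⟨Expr.ok_coef (by simp [Expr.Small]) (by simp [Expr.Ok, Expr.Small]),
      by simp [Expr.Ok, Expr.Small], Or.inl (Expr.small_coef (by simp [Expr.Small]))⟩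

theorem mul_add_eq {S i i' a b : ℕ} (ha : a < S) (hb : b < S) (h : i * S + a = i' * S + b) :
    i = i' ∧ a = b := by
  have hS : 0 < S := by omega
  have h1 := congrArg (· / S) h
  have h2 := congrArg (· % S) h
  simp only [mul_comm _ S, Nat.mul_add_div hS, Nat.div_eq_of_lt ha, Nat.div_eq_of_lt hb,
    Nat.mul_add_mod, Nat.mod_eq_of_lt ha, Nat.mod_eq_of_lt hb, add_zero] at h1 h2
  exact ⟨h1, h2⟩

theorem decode {ρ x y δ idx : ℕ} (hx : x < δ) (hy : y < δ) (h : (ρ * δ + x) * δ + y = idx) :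
    idx / (δ * δ) = ρ ∧ idx / δ % δ = x ∧ idx % δ = y := by
  have hδ : 0 < δ := by omega
  have f2 : idx / δ = ρ * δ + x := by
    rw [← h, mul_comm, Nat.mul_add_div hδ, Nat.div_eq_of_lt hy, add_zero, mul_comm]
  refine ⟨?_, ?_, ?_⟩
  · rw [← Nat.div_div_eq_div_mul, f2, mul_comm, Nat.mul_add_div hδ, Nat.div_eq_of_lt hx, add_zero]
  · rw [f2, mul_comm, Nat.mul_add_mod, Nat.mod_eq_of_lt hx]
  · rw [← h, mul_comm, Nat.mul_add_mod, Nat.mod_eq_of_lt hy]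

variable {Ω Ξ : ℕ} {m : Mem} {P : Params}

theorem runs_splitProg (hΩ : Ω ≤ Ξ) (hF : Fits P Ω) (hC : Ctx P m) {e : Expr} {a i t : ℕ}
    (ht : m 57 0 = t) (he : e.eval m = i) (hi : i < P.h) (ha : a = 60 ∨ a = 61) :
    Runs Ω Ξ 1 (splitProg e a) m fun m' => m' 58 0 = i ∧ m' 59 0 = t % P.S ∧
      m' 60 0 = P.d ^ (P.h - 1 - i) ∧ m' 61 0 = P.d ^ (P.h - i) ∧
      m' 62 0 = t % P.S / (m' a 0 * m' a 0) ∧ m' 63 0 = t % P.S / m' a 0 % m' a 0 ∧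
      m' 64 0 = t % P.S % m' a 0 := by
  have hSpos := hF.S_pos
  have hpd : ∀ j ≤ P.h, P.d ^ j ≤ Ω := fun j hj =>
    (Nat.pow_le_pow_right Params.d_pos hj).trans hF.N_le'
  have hS : t % P.S ≤ Ω := (Nat.mod_lt _ hSpos).le.trans hF.S_le
  have h1 := hC.pow_d_eq (P.h - 1 - i) (by omega)
  have h2 := hC.pow_d_eq (P.h - i) (by omega)
  refine Runs.store_seq hΩ le_rfl ?_ ?_
  · rw [he]; exact (hi.le.trans hF.h_le).trans (le_lim hΩ _)
  refine Runs.store_seq hΩ le_rfl ?_ ?_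
  · refine le_trans ?_ (le_lim hΩ _)
    simpa [ht, hC.S_eq] using hS
  refine Runs.store_seq hΩ le_rfl ?_ ?_
  · refine le_trans ?_ (le_lim hΩ _)
    simp only [Expr.eval_load, Expr.eval_sub, Expr.eval_const, Mem.set_self, ne_eq,
      Nat.reduceEqDiff, not_false_eq_true, Mem.set_of_ne, he, hC.h_eq, h1]
    exact hpd _ (by omega)
  refine Runs.store_seq hΩ le_rfl ?_ ?_
  · refine le_trans ?_ (le_lim hΩ _)
    simp only [Expr.eval_load, Expr.eval_sub, Expr.eval_const, Mem.set_self, ne_eq,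
      Nat.reduceEqDiff, not_false_eq_true, Mem.set_of_ne, he, hC.h_eq, h2]
    exact hpd _ (by omega)
  refine Runs.store_seq hΩ le_rfl ?_ ?_
  · refine le_trans ?_ (le_lim hΩ _)
    simp only [Expr.eval_load, Expr.eval_div, Expr.eval_const, Mem.set_self, ne_eq,
      Nat.reduceEqDiff, not_false_eq_true, Mem.set_of_ne, Expr.eval_mod, ht, hC.S_eq]
    exact (Nat.div_le_self _ _).trans hS
  refine Runs.store_seq hΩ le_rfl ?_ ?_
  · refine le_trans ?_ (le_lim hΩ _)
    simp only [Expr.eval_load, Expr.eval_div, Expr.eval_const, Mem.set_self, ne_eq,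
      Nat.reduceEqDiff, not_false_eq_true, Mem.set_of_ne, Expr.eval_mod, ht, hC.S_eq]
    exact (Nat.mod_le _ _).trans ((Nat.div_le_self _ _).trans hS)
  refine Runs.store hΩ le_rfl ?_ ?_
  · refine le_trans ?_ (le_lim hΩ _)
    simp only [Expr.eval_load, Expr.eval_const, Mem.set_self, ne_eq,
      Nat.reduceEqDiff, not_false_eq_true, Mem.set_of_ne, Expr.eval_mod, ht, hC.S_eq]
    exact (Nat.mod_le _ _).trans hS
  · rcases ha with rfl | rfl <;> simp [he, ht, hC.h_eq, hC.S_eq, h1, h2]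

/-- The loop index t = iS + j is a position `j` in layer `i`, and cell t + S of layer i + 1 is
written from cells of layer `i`. Positions outside the blocks receive values that are never used. -/
theorem runs_downProg (hΩ : Ω ≤ Ξ) (hF : Fits P Ω) (hC : Ctx P m) (U : ℕ → ℕ → ℤ) {a : ℕ}
    (ha : a = 54 ∨ a = 55) :
    Runs Ω Ξ (P.h * P.S + 1) (downProg P.d P.R U a) m fun m' =>
      (∀ j < P.S, m' a j = m a j) ∧
      ∀ i < P.h, ∀ ρ < P.R ^ i, ∀ r < P.R, ∀ x < P.d ^ (P.h - 1 - i), ∀ y < P.d ^ (P.h - 1 - i),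
        (m' a ((i + 1) * P.S + (((ρ * P.R + r) * P.d ^ (P.h - 1 - i) + x) * P.d ^ (P.h - 1 - i)
            + y)) : ZMod P.M) =
          ∑ p ∈ Finset.range P.d, ∑ q ∈ Finset.range P.d, (U r (p * P.d + q) : ZMod P.M) *
            m' a (i * P.S + ((ρ * P.d ^ (P.h - i) + (p * P.d ^ (P.h - 1 - i) + x)) *
              P.d ^ (P.h - i) + (q * P.d ^ (P.h - 1 - i) + y))) := by
  have ha30 : 30 ≤ a := by omega
  have ha57 : a ≠ 57 := by omega
  have hSpos := hF.S_pos
  have hRpos := hF.R_pos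
  -- bounds on the indices
  have hsrc : ∀ i < P.h, ∀ ρ < P.R ^ i, ∀ p < P.d, ∀ q < P.d, ∀ x < P.d ^ (P.h - 1 - i),
      ∀ y < P.d ^ (P.h - 1 - i), (ρ * P.d ^ (P.h - i) + (p * P.d ^ (P.h - 1 - i) + x)) *
        P.d ^ (P.h - i) + (q * P.d ^ (P.h - 1 - i) + y) < P.S := by
    intro i hi ρ hρ p hp q hq x hx y hy
    have e : P.d ^ (P.h - i) = P.d * P.d ^ (P.h - 1 - i) := by
      rw [← pow_succ']; congr 1; omega
    refine hF.layer_lt hi.le hρ ?_ ?_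
    · rw [e]; calc _ < p * P.d ^ (P.h - 1 - i) + P.d ^ (P.h - 1 - i) := by omega
        _ = (p + 1) * P.d ^ (P.h - 1 - i) := by ring
        _ ≤ _ := Nat.mul_le_mul_right _ hp
    · rw [e]; calc _ < q * P.d ^ (P.h - 1 - i) + P.d ^ (P.h - 1 - i) := by omega
        _ = (q + 1) * P.d ^ (P.h - 1 - i) := by ring
        _ ≤ _ := Nat.mul_le_mul_right _ hq
  have hdst : ∀ i < P.h, ∀ ρ < P.R ^ i, ∀ r < P.R, ∀ x < P.d ^ (P.h - 1 - i),
      ∀ y < P.d ^ (P.h - 1 - i),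
      ((ρ * P.R + r) * P.d ^ (P.h - 1 - i) + x) * P.d ^ (P.h - 1 - i) + y < P.S := by
    intro i hi ρ hρ r hr x hx y hy
    have hρ' : ρ * P.R + r < P.R ^ (i + 1) := by
      rw [pow_succ]
      calc _ < ρ * P.R + P.R := by omega
        _ = (ρ + 1) * P.R := by ring
        _ ≤ _ := Nat.mul_le_mul_right _ hρ
    have e : P.h - 1 - i = P.h - (i + 1) := by omega
    rw [e] at hx hy ⊢
    exact hF.layer_lt hi hρ' hx hy
  refine (Runs.forLoop (c := 1) (cnt := P.h * P.S) hΩ le_rfl hC.hS_eq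
    (by simp [Prog.writes, ha57.symm]) (by simp [Prog.writes]; omega) (by simp)
    (hF.hS_le.trans (le_lim hΩ _))
    (fun t m' => (∀ j < P.S, m' a j = m a j) ∧
      ∀ i < P.h, ∀ ρ < P.R ^ i, ∀ r < P.R, ∀ x < P.d ^ (P.h - 1 - i), ∀ y < P.d ^ (P.h - 1 - i),
        i * P.S + (((ρ * P.R + r) * P.d ^ (P.h - 1 - i) + x) * P.d ^ (P.h - 1 - i) + y) < t →
        (m' a ((i + 1) * P.S + (((ρ * P.R + r) * P.d ^ (P.h - 1 - i) + x) * P.d ^ (P.h - 1 - i)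
            + y)) : ZMod P.M) =
          ∑ p ∈ Finset.range P.d, ∑ q ∈ Finset.range P.d, (U r (p * P.d + q) : ZMod P.M) *
            m' a (i * P.S + ((ρ * P.d ^ (P.h - i) + (p * P.d ^ (P.h - 1 - i) + x)) *
              P.d ^ (P.h - i) + (q * P.d ^ (P.h - 1 - i) + y))))
    ⟨by simp [ha57], by simp⟩ ?_).mono (by omega) ?_
  · intro t m₁ ht hf ht₁ hI
    have hC₁ : Ctx P m₁ := hC.agree (Agree.of_frame (by
      simp [Prog.writes_forLoop, Prog.writes]; omega) hf)
    have e1 : t / P.S < P.h := Nat.div_lt_of_lt_mul (by rwa [mul_comm])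
    refine Runs.seq ((runs_splitProg (i := t / P.S) hΩ hF hC₁ ht₁ (by simp [ht₁, hC₁.S_eq]) e1
      (Or.inl rfl)).mono le_rfl ?_)
    rintro m₂ - hf₂ ⟨r58, r59, r60, r61, r62, r63, r64⟩ -
    rw [r60] at r62 r63 r64
    simp only [writes_splitProg, List.mem_cons, List.not_mem_nil, not_or, or_false, and_imp] at hf₂
    have r57 : m₂ 57 0 = t := by rw [hf₂] <;> simp [ht₁]
    have r13 : m₂ 13 0 = P.S := by rw [hf₂] <;> simp [hC₁.S_eq]
    have r14 : m₂ 14 0 = P.M := by rw [hf₂] <;> simp [hC₁.M_eq]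
    have ra : m₂ a = m₁ a := by rw [hf₂] <;> omega
    refine Runs.store hΩ le_rfl ?_ ?_
    · refine le_trans ?_ (le_lim hΩ _)
      simp only [Expr.eval_mod, Expr.eval_load, Expr.eval_const, r14]
      exact (Nat.mod_lt _ Params.M_pos).le.trans hF.M_le
    simp only [Expr.eval_mod, Expr.eval_load, Expr.eval_const, Expr.eval_add, r14, r57, r13,
      ne_eq, ha57, not_false_eq_true, Mem.set_of_ne]
    refine ⟨fun j hj => ?_, ?_⟩
    · rw [Mem.set_self_of_ne _ (by omega), ra]; exact hI.1 j hj
    intro i hi ρ hρ r hr x hx y hy hlt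
    have hd := hdst i hi ρ hρ r hr x hx y hy
    -- The cells on the right side of an equation recorded so far lie before `t + S`, the only cell
    -- that is written now, so recorded equations persist.
    have hread : ∀ p ∈ Finset.range P.d, ∀ q ∈ Finset.range P.d,
        i * P.S + ((ρ * P.d ^ (P.h - i) + (p * P.d ^ (P.h - 1 - i) + x)) *
          P.d ^ (P.h - i) + (q * P.d ^ (P.h - 1 - i) + y)) ≠ t + P.S := by
      intro p hp q hq
      rw [Finset.mem_range] at hp hq
      have := hsrc i hi ρ hρ p hp q hq x hx y hy
      intro h
      have h' : i * P.S ≤ t := by omega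
      have h'' := hdst i hi ρ hρ r hr x hx y hy
      omega
    rw [Finset.sum_congr rfl fun p hp => Finset.sum_congr rfl fun q hq => by
      rw [Mem.set_self_of_ne _ (hread p hp q hq)], ra]
    generalize hidx : ((ρ * P.R + r) * P.d ^ (P.h - 1 - i) + x) * P.d ^ (P.h - 1 - i) + y =
      idx at hlt hd ⊢
    by_cases hteq : i * P.S + idx = t
    · have ei : t / P.S = i := by
        rw [← hteq, mul_comm, Nat.mul_add_div hSpos, Nat.div_eq_of_lt hd, add_zero]
      have ej : t % P.S = idx := by
        rw [← hteq, mul_comm, Nat.mul_add_mod, Nat.mod_eq_of_lt hd]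
      rw [ei] at r58 r60 r61 r62 r63 r64
      rw [ej] at r62 r63 r64
      obtain ⟨f1, f2, f3⟩ := decode hx hy hidx
      rw [f1] at r62
      rw [f2] at r63
      rw [f3] at r64
      have f5 : (ρ * P.R + r) % P.R = r := by
        rw [mul_comm, Nat.mul_add_mod, Nat.mod_eq_of_lt hr]
      have f6 : (ρ * P.R + r) / P.R = ρ := by
        rw [mul_comm, Nat.mul_add_div hRpos, Nat.div_eq_of_lt hr, add_zero]
      have hadr : (i + 1) * P.S + idx = t + P.S := by rw [← hteq]; ring
      rw [hadr, Mem.set_self, ZMod.natCast_mod, Expr.eval_sum, Nat.cast_sum]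
      refine Finset.sum_congr rfl fun p _ => ?_
      rw [Expr.eval_sum, Nat.cast_sum]
      refine Finset.sum_congr rfl fun q _ => ?_
      rw [Expr.eval_mul, Nat.cast_mul, Expr.cast_eval_coef r14 Params.M_pos]
      · simp only [Expr.eval_mod, Expr.eval_load, Expr.eval_const, Expr.eval_add, Expr.eval_mul,
          Expr.eval_div, r58, r60, r61, r62, r63, r64, r13, f5, f6, ra]
      · simp only [Expr.eval_mod, Expr.eval_load, Expr.eval_const, r62, f5, hr]
    · rw [Mem.set_self_of_ne _ (by rw [add_mul]; omega)]
      have := hI.2 i hi ρ hρ r hr x hx y hy (by rw [hidx]; omega)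
      rw [ra]
      rwa [hidx] at this
  · intro m' _ _ h
    refine ⟨h.1, fun i hi ρ hρ r hr x hx y hy => h.2 i hi ρ hρ r hr x hx y hy ?_⟩
    have := hdst i hi ρ hρ r hr x hx y hy
    calc _ < i * P.S + P.S := by omega
      _ = (i + 1) * P.S := by ring
      _ ≤ _ := Nat.mul_le_mul_right _ hi

theorem runs_productProg (hΩ : Ω ≤ Ξ) (hF : Fits P Ω) (hC : Ctx P m) :
    Runs Ω Ξ (P.S + 1) productProg m fun m' =>
      ∀ j < P.S, m' 56 (P.h * P.S + j) =
        m 54 (P.h * P.S + j) * m 55 (P.h * P.S + j) % P.M := by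
  refine (Runs.forLoop (c := 1) (cnt := P.S) hΩ le_rfl hC.S_eq
    (by simp [Prog.writes]) (by simp [Prog.writes]) (by simp) (hF.S_le.trans (le_lim hΩ _))
    (fun t m' => ∀ j < t, m' 56 (P.h * P.S + j) =
        m 54 (P.h * P.S + j) * m 55 (P.h * P.S + j) % P.M) (by simp) ?_).mono (by omega)
        fun _ _ _ h => h
  intro t m₁ ht hf ht₁ hI
  have hC₁ : Ctx P m₁ := hC.agree (Agree.of_frame (by
    simp [Prog.writes_forLoop, Prog.writes]) hf)
  simp only [Prog.writes_forLoop, Prog.writes, List.mem_cons, List.mem_append,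
    List.not_mem_nil, not_or, or_false, and_imp] at hf
  have h4 : m₁ 54 = m 54 := by rw [hf] <;> simp
  have h5 : m₁ 55 = m 55 := by rw [hf] <;> simp
  refine Runs.store hΩ le_rfl ?_ ?_
  · refine le_trans ?_ (le_lim hΩ _)
    simp only [Expr.eval_mod, Expr.eval_load, Expr.eval_const, hC₁.M_eq]
    exact (Nat.mod_lt _ Params.M_pos).le.trans hF.M_le
  · intro j hj
    rw [Mem.set_of_ne _ (by norm_num), Mem.set_apply]
    simp only [Expr.eval_add, Expr.eval_load, Expr.eval_const, hC₁.hS_eq, ht₁, Expr.eval_mod,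
      Expr.eval_mul, hC₁.M_eq, h4, h5, add_right_inj]
    split_ifs with h
    · rw [h]
    · exact hI j (by omega)

/-- Here the loop index runs through the layers from `h - 1` down to 0. In addition to the
recursion, it is recorded that the entries are reduced modulo `P.M`. -/
theorem runs_upProg (hΩ : Ω ≤ Ξ) (hF : Fits P Ω) (hC : Ctx P m) (W : ℕ → ℕ → ℤ) :
    Runs Ω Ξ (P.h * P.S + 1) (upProg P.d P.R W) m fun m' =>
      (∀ j < P.S, m' 56 (P.h * P.S + j) = m 56 (P.h * P.S + j)) ∧
      ∀ i < P.h, ∀ ρ < P.R ^ i, ∀ α < P.d, ∀ β < P.d, ∀ x < P.d ^ (P.h - 1 - i),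
        ∀ y < P.d ^ (P.h - 1 - i),
        m' 56 (i * P.S + ((ρ * P.d ^ (P.h - i) + (α * P.d ^ (P.h - 1 - i) + x)) *
              P.d ^ (P.h - i) + (β * P.d ^ (P.h - 1 - i) + y))) < P.M ∧
        (m' 56 (i * P.S + ((ρ * P.d ^ (P.h - i) + (α * P.d ^ (P.h - 1 - i) + x)) *
              P.d ^ (P.h - i) + (β * P.d ^ (P.h - 1 - i) + y))) : ZMod P.M) =
          ∑ r ∈ Finset.range P.R, (W (α * P.d + β) r : ZMod P.M) *
            m' 56 ((i + 1) * P.S + (((ρ * P.R + r) * P.d ^ (P.h - 1 - i) + x) *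
              P.d ^ (P.h - 1 - i) + y)) := by
  have hSpos := hF.S_pos
  have hcol : ∀ i < P.h, ∀ α < P.d, ∀ x < P.d ^ (P.h - 1 - i),
      α * P.d ^ (P.h - 1 - i) + x < P.d ^ (P.h - i) := by
    intro i hi α hα x hx
    have e : P.d ^ (P.h - i) = P.d * P.d ^ (P.h - 1 - i) := by
      rw [← pow_succ']; congr 1; omega
    rw [e]
    calc _ < α * P.d ^ (P.h - 1 - i) + P.d ^ (P.h - 1 - i) := by omega
      _ = (α + 1) * P.d ^ (P.h - 1 - i) := by ring
      _ ≤ _ := Nat.mul_le_mul_right _ hα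
  have hdst : ∀ i < P.h, ∀ ρ < P.R ^ i, ∀ r < P.R, ∀ x < P.d ^ (P.h - 1 - i),
      ∀ y < P.d ^ (P.h - 1 - i),
      ((ρ * P.R + r) * P.d ^ (P.h - 1 - i) + x) * P.d ^ (P.h - 1 - i) + y < P.S := by
    intro i hi ρ hρ r hr x hx y hy
    have hρ' : ρ * P.R + r < P.R ^ (i + 1) := by
      rw [pow_succ]
      calc _ < ρ * P.R + P.R := by omega
        _ = (ρ + 1) * P.R := by ring
        _ ≤ _ := Nat.mul_le_mul_right _ hρ
    have e : P.h - 1 - i = P.h - (i + 1) := by omega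
    rw [e] at hx hy ⊢
    exact hF.layer_lt hi hρ' hx hy
  refine (Runs.forLoop (c := 1) (cnt := P.h * P.S) hΩ le_rfl hC.hS_eq
    (by simp [Prog.writes]) (by simp [Prog.writes]) (by simp) (hF.hS_le.trans (le_lim hΩ _))
    (fun t m' => (∀ j < P.S, m' 56 (P.h * P.S + j) = m 56 (P.h * P.S + j)) ∧
      ∀ i < P.h, ∀ ρ < P.R ^ i, ∀ α < P.d, ∀ β < P.d, ∀ x < P.d ^ (P.h - 1 - i),
        ∀ y < P.d ^ (P.h - 1 - i),
        (P.h - 1 - i) * P.S + ((ρ * P.d ^ (P.h - i) + (α * P.d ^ (P.h - 1 - i) + x)) *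
              P.d ^ (P.h - i) + (β * P.d ^ (P.h - 1 - i) + y)) < t →
        m' 56 (i * P.S + ((ρ * P.d ^ (P.h - i) + (α * P.d ^ (P.h - 1 - i) + x)) *
              P.d ^ (P.h - i) + (β * P.d ^ (P.h - 1 - i) + y))) < P.M ∧
        (m' 56 (i * P.S + ((ρ * P.d ^ (P.h - i) + (α * P.d ^ (P.h - 1 - i) + x)) *
              P.d ^ (P.h - i) + (β * P.d ^ (P.h - 1 - i) + y))) : ZMod P.M) =
          ∑ r ∈ Finset.range P.R, (W (α * P.d + β) r : ZMod P.M) *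
            m' 56 ((i + 1) * P.S + (((ρ * P.R + r) * P.d ^ (P.h - 1 - i) + x) *
              P.d ^ (P.h - 1 - i) + y)))
    ⟨by simp, by simp⟩ ?_).mono (by omega) ?_
  · intro t m₁ ht hf ht₁ hI
    have hC₁ : Ctx P m₁ := hC.agree (Agree.of_frame (by
      simp [Prog.writes_forLoop, Prog.writes]) hf)
    have e1 : t / P.S < P.h := Nat.div_lt_of_lt_mul (by rwa [mul_comm])
    have et : t / P.S * P.S + t % P.S = t := by rw [mul_comm]; exact Nat.div_add_mod _ _
    have hmod := Nat.mod_lt t hSpos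
    have hup : P.h - 1 - t / P.S < P.h :=
      (Nat.sub_le _ _).trans_lt (Nat.sub_lt hF.h_pos one_pos)
    refine Runs.seq ((runs_splitProg (i := P.h - 1 - t / P.S) hΩ hF hC₁ ht₁
      (by simp [ht₁, hC₁.S_eq, hC₁.h_eq]) hup (Or.inr rfl)).mono le_rfl ?_)
    rintro m₂ - hf₂ ⟨r58, r59, r60, r61, r62, r63, r64⟩ -
    rw [r61] at r62 r63 r64
    simp only [writes_splitProg, List.mem_cons, List.not_mem_nil, not_or, or_false, and_imp] at hf₂
    have r13 : m₂ 13 0 = P.S := by rw [hf₂] <;> simp [hC₁.S_eq]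
    have r14 : m₂ 14 0 = P.M := by rw [hf₂] <;> simp [hC₁.M_eq]
    have ra : m₂ 56 = m₁ 56 := by rw [hf₂] <;> omega
    refine Runs.store hΩ le_rfl ?_ ?_
    · refine le_trans ?_ (le_lim hΩ _)
      simp only [Expr.eval_mod, Expr.eval_load, Expr.eval_const, r14]
      exact (Nat.mod_lt _ Params.M_pos).le.trans hF.M_le
    simp only [Expr.eval_mod, Expr.eval_load, Expr.eval_const, Expr.eval_add, Expr.eval_mul, r14,
      r13, r58, r59, ne_eq, Nat.reduceEqDiff, not_false_eq_true, Mem.set_of_ne]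
    refine ⟨fun j hj => ?_, ?_⟩
    · rw [Mem.set_self_of_ne _ (fun h => hup.ne' (mul_add_eq hj hmod h).1), ra]
      exact hI.1 j hj
    intro i hi ρ hρ α hα β hβ x hx y hy hlt
    have hX := hcol i hi α hα x hx
    have hY := hcol i hi β hβ y hy
    have hd := hF.layer_lt hi.le hρ hX hY
    generalize hidx : (ρ * P.d ^ (P.h - i) + (α * P.d ^ (P.h - 1 - i) + x)) *
              P.d ^ (P.h - i) + (β * P.d ^ (P.h - 1 - i) + y) = idx at hlt hd ⊢
    -- A recorded equation reads layer `i + 1`, whereas the layer being written now is `i` or a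
    -- lower one.
    have hread : ∀ r ∈ Finset.range P.R, (i + 1) * P.S + (((ρ * P.R + r) *
        P.d ^ (P.h - 1 - i) + x) * P.d ^ (P.h - 1 - i) + y) ≠
        (P.h - 1 - t / P.S) * P.S + t % P.S := by
      intro r hr h
      rw [Finset.mem_range] at hr
      have h1 := (mul_add_eq (hdst i hi ρ hρ r hr x hx y hy) hmod h).1
      have h2 : t / P.S + 1 ≤ P.h - 1 - i := by omega
      have h3 := Nat.mul_le_mul_right P.S h2
      rw [add_mul] at h3
      omega
    rw [Finset.sum_congr rfl fun r hr => by rw [Mem.set_self_of_ne _ (hread r hr)], ra]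
    by_cases hteq : (P.h - 1 - i) * P.S + idx = t
    · have ei : t / P.S = P.h - 1 - i := by
        rw [← hteq, mul_comm, Nat.mul_add_div hSpos, Nat.div_eq_of_lt hd, add_zero]
      have ej : t % P.S = idx := by
        rw [← hteq, mul_comm, Nat.mul_add_mod, Nat.mod_eq_of_lt hd]
      have ei' : P.h - 1 - t / P.S = i := by omega
      rw [ei'] at r58 r60 r61 r62 r63 r64
      rw [ej] at r62 r63 r64
      obtain ⟨f1, f2, f3⟩ := decode hX hY hidx
      rw [f1] at r62
      rw [f2] at r63
      rw [f3] at r64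
      have hd1 : 0 < P.d ^ (P.h - 1 - i) := Nat.pow_pos Params.d_pos
      have g1 : ∀ α x, x < P.d ^ (P.h - 1 - i) →
          (α * P.d ^ (P.h - 1 - i) + x) / P.d ^ (P.h - 1 - i) = α ∧
          (α * P.d ^ (P.h - 1 - i) + x) % P.d ^ (P.h - 1 - i) = x := by
        intro α x hx
        rw [mul_comm, Nat.mul_add_mod, Nat.mod_eq_of_lt hx, Nat.mul_add_div hd1,
          Nat.div_eq_of_lt hx]
        simp
      rw [ei', ej, Mem.set_self]
      refine ⟨Nat.mod_lt _ Params.M_pos, ?_⟩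
      rw [ZMod.natCast_mod, Expr.eval_sum, Nat.cast_sum]
      refine Finset.sum_congr rfl fun r _ => ?_
      have hrt : (Expr.add (.mul (.div (.var 63) (.var 60)) (.const P.d))
          (.div (.var 64) (.var 60))).eval m₂ = α * P.d + β := by
        simp only [Expr.eval_add, Expr.eval_mul, Expr.eval_div, Expr.eval_load, Expr.eval_const,
          r63, r64, r60, (g1 α x hx).1, (g1 β y hy).1]
      rw [Expr.eval_mul, Nat.cast_mul, Expr.cast_eval_coef r14 Params.M_pos, hrt]
      · simp only [Expr.eval_mod, Expr.eval_load, Expr.eval_const, Expr.eval_add, Expr.eval_mul,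
          r58, r60, r62, r63, r64, r13, ra, (g1 α x hx).2, (g1 β y hy).2]
      · rw [hrt]
        calc _ < α * P.d + P.d := by omega
          _ = (α + 1) * P.d := by ring
          _ ≤ _ := Nat.mul_le_mul_right _ hα
    · have hne : i * P.S + idx ≠ (P.h - 1 - t / P.S) * P.S + t % P.S := by
        intro h
        obtain ⟨h1, h2⟩ := mul_add_eq hd hmod h
        have : P.h - 1 - i = t / P.S := by omega
        rw [this, h2] at hteq
        exact hteq et
      rw [Mem.set_self_of_ne _ hne, ra]
      have := hI.2 i hi ρ hρ α hα β hβ x hx y hy (by rw [hidx]; omega)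
      rwa [hidx] at this
  · intro m' _ _ h
    refine ⟨h.1, fun i hi ρ hρ α hα β hβ x hx y hy => h.2 i hi ρ hρ α hα β hβ x hx y hy ?_⟩
    have := hF.layer_lt hi.le hρ (hcol i hi α hα x hx) (hcol i hi β hβ y hy)
    calc _ < (P.h - 1 - i) * P.S + P.S := by omega
      _ = (P.h - 1 - i + 1) * P.S := by ring
      _ ≤ _ := Nat.mul_le_mul_right _ (by omega)

/-- Multiplies the matrices in the arrays `54` and `55` into array `56`, up to a constant factor. -/
def mulProg (d R : ℕ) (U V W : ℕ → ℕ → ℤ) : Prog :=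
  .seq (downProg d R U 54) (.seq (downProg d R V 55) (.seq productProg (upProg d R W)))

@[simp] theorem writes_mulProg (d R : ℕ) (U V W : ℕ → ℕ → ℤ) :
    (mulProg d R U V W).writes = [57, 58, 59, 60, 61, 62, 63, 64, 54, 57, 57, 58, 59, 60, 61, 62,
      63, 64, 55, 57, 57, 56, 57, 57, 58, 59, 60, 61, 62, 63, 64, 56, 57] := rfl

theorem ok_mulProg (d R : ℕ) (U V W : ℕ → ℕ → ℤ) : (mulProg d R U V W).Ok :=
  ⟨ok_downProg _ _ _ _, ok_downProg _ _ _ _, ok_productProg, ok_upProg _ _ _⟩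

/-- The recursion determines the result modulo `P.M`. For 0-1 matrices the exact value D^h·(AB) has
entries at most (D d)^h < M, so reduced residues are exact values. The factor D^h is left in place,
because only positivity of the entries is tested later. -/
theorem runs_mulProg (hΩ : Ω ≤ Ξ) (hF : Fits P Ω) (hC : Ctx P m) {U V W : ℕ → ℕ → ℤ}
    (hS : Arith.IsScheme P.d P.R P.D U V W) (hA : ∀ j < P.N * P.N, m 54 j ≤ 1)
    (hB : ∀ j < P.N * P.N, m 55 j ≤ 1) :
    Runs Ω Ξ (P.h * P.S + 1) (mulProg P.d P.R U V W) m fun m' =>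
      ∀ x < P.N, ∀ z < P.N, m' 56 (x * P.N + z) =
        P.D ^ P.h * ∑ y ∈ Finset.range P.N, m 54 (x * P.N + y) * m 55 (y * P.N + z) := by
  have hNS : ∀ x < P.N, ∀ y < P.N, x * P.N + y < P.S := by
    intro x hx y hy
    have := hF.layer_lt (i := 0) (ρ := 0) (Nat.zero_le _) (by simp) hx hy
    simpa [Params.N] using this
  have hNN : ∀ x < P.N, ∀ y < P.N, x * P.N + y < P.N * P.N := by
    intro x hx y hy
    calc _ < x * P.N + P.N := by omega
      _ = (x + 1) * P.N := by ring
      _ ≤ _ := Nat.mul_le_mul_right _ hx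
  have hSle : P.S + 1 ≤ P.h * P.S + 1 :=
    Nat.add_le_add_right (Nat.le_mul_of_pos_left _ hF.h_pos) 1
  refine Runs.seq ((runs_downProg hΩ hF hC U (Or.inl rfl)).mono le_rfl ?_)
  rintro m₁ - hf₁ ⟨hA₁, hA₂⟩ -
  have hC₁ : Ctx P m₁ := hC.agree (Agree.of_frame (by simp) hf₁)
  simp only [writes_downProg, List.mem_cons, List.not_mem_nil, not_or, or_false, and_imp] at hf₁
  have a55 : m₁ 55 = m 55 := by rw [hf₁] <;> simp
  refine Runs.seq ((runs_downProg hΩ hF hC₁ V (Or.inr rfl)).mono le_rfl ?_)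
  rintro m₂ - hf₂ ⟨hB₁, hB₂⟩ -
  have hC₂ : Ctx P m₂ := hC₁.agree (Agree.of_frame (by simp) hf₂)
  simp only [writes_downProg, List.mem_cons, List.not_mem_nil, not_or, or_false, and_imp] at hf₂
  have b54 : m₂ 54 = m₁ 54 := by rw [hf₂] <;> simp
  refine Runs.seq ((runs_productProg hΩ hF hC₂).mono hSle ?_)
  rintro m₃ - hf₃ hP -
  have hC₃ : Ctx P m₃ := hC₂.agree (Agree.of_frame (by simp) hf₃)
  refine (runs_upProg hΩ hF hC₃ W).mono le_rfl ?_
  rintro m₄ - hf₄ ⟨hU₁, hU₂⟩ x hx z hz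
  have main := hS.layers (A := ZMod P.M) Params.d_pos P.h
    (fun i j => (m₁ 54 (i * P.S + j) : ZMod P.M))
    (fun i j => (m₂ 55 (i * P.S + j) : ZMod P.M)) (fun i j => (m₄ 56 (i * P.S + j) : ZMod P.M))
    hA₂ hB₂ (fun i hi ρ hρ α hα β hβ x hx y hy => (hU₂ i hi ρ hρ α hα β hβ x hx y hy).2)
    (fun ρ hρ => by
      have hρS : ρ < P.S := hρ
      rw [hU₁ ρ hρS, hP ρ hρS, ZMod.natCast_mod, b54]
      push_cast; rfl) x hx z hz
  -- Since `h ≥ 1`, layer 0 was written by the upward pass and consists of reduced residues.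
  have hlt : m₄ 56 (x * P.N + z) < P.M := by
    have hd1 : 0 < P.d ^ (P.h - 1) := Nat.pow_pos Params.d_pos
    have split : ∀ x < P.N, x / P.d ^ (P.h - 1) < P.d ∧ x % P.d ^ (P.h - 1) < P.d ^ (P.h - 1) ∧
        x / P.d ^ (P.h - 1) * P.d ^ (P.h - 1) + x % P.d ^ (P.h - 1) = x := fun x hx =>
      ⟨Nat.div_lt_of_lt_mul (by
        rw [← pow_succ, Nat.sub_add_cancel hF.h_pos]; exact hx), Nat.mod_lt _ hd1, by
        rw [mul_comm]; exact Nat.div_add_mod _ _⟩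
    obtain ⟨s1, s2, s3⟩ := split x hx
    obtain ⟨s4, s5, s6⟩ := split z hz
    have := (hU₂ 0 hF.h_pos 0 (by simp) _ s1 _ s4 _ s2 _ s5).1
    simp only [Nat.sub_zero, s3, s6, zero_mul, zero_add] at this
    exact this
  have hsum : ∑ y ∈ Finset.range P.N, m 54 (x * P.N + y) * m 55 (y * P.N + z) ≤ P.N := by
    calc _ ≤ ∑ y ∈ Finset.range P.N, 1 := Finset.sum_le_sum fun y hy => by
          rw [Finset.mem_range] at hy
          exact Nat.mul_le_mul (hA _ (hNN x hx y hy)) (hB _ (hNN y hy z hz))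
      _ = P.N := by simp
  have hlt' : P.D ^ P.h * ∑ y ∈ Finset.range P.N, m 54 (x * P.N + y) * m 55 (y * P.N + z) <
      P.M := by
    refine Nat.lt_succ_of_le ((Nat.mul_le_mul_left _ hsum).trans ?_)
    rw [mul_pow]; rfl
  have hcast : ((m₄ 56 (x * P.N + z) : ℕ) : ZMod P.M) = ((P.D ^ P.h *
      ∑ y ∈ Finset.range P.N, m 54 (x * P.N + y) * m 55 (y * P.N + z) : ℕ) : ZMod P.M) := by
    simp only [zero_mul, zero_add] at main
    rw [show x * P.N + z = x * P.d ^ P.h + z from rfl, main]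
    push_cast
    congr 1
    refine Finset.sum_congr rfl fun y hy => ?_
    have hy' : y < P.N := Finset.mem_range.1 hy
    have e1 := hA₁ _ (hNS x hx y hy')
    have e2 := hB₁ _ (hNS y hy' z hz)
    rw [a55] at e2
    rw [← e1, ← e2]; rfl
  rw [ZMod.natCast_eq_natCast_iff', Nat.mod_eq_of_lt hlt, Nat.mod_eq_of_lt hlt'] at hcast
  exact hcast

end RAM

namespace RAM

/-! ### Minimization of small weights -/

/-- Fills array `54`: rows are indexed by the low parts of masks, columns by the middle parts. -/
def fillAProg : Prog :=
  .forLoop 53 20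
    (.seq (.store 30 (.const 0) (.mul (.mod (.var 53) (.var 9)) (.var 9)))
    (.seq popProg
    (.seq (.store 30 (.const 0) (.add (.div (.var 53) (.var 9))
      (.mul (.mod (.var 53) (.var 9)) (.var 9))))
    (.seq (costProg 43)
      (.store 54 (.var 53) (.mul (.eq (.var 34) (.var 50)) (.eq (.var 32) (.var 51))))))))

/-- Fills array `55`: rows are indexed by the middle parts of masks, columns by the high parts. -/
def fillBProg : Prog :=
  .forLoop 53 20
    (.seq (.store 30 (.const 0) (.mul (.add (.div (.var 53) (.var 9))
      (.mul (.mod (.var 53) (.var 9)) (.var 9))) (.var 9)))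
    (.seq (costProg 44)
      (.store 55 (.var 53) (.eq (.var 32) (.var 52)))))

/-- Searches the product matrix for a good combination of a low and a high part. -/
def scanProg : Prog :=
  .forLoop 53 20
    (.seq (.store 30 (.const 0) (.add (.div (.var 53) (.var 9))
      (.mul (.mod (.var 53) (.var 9)) (.mul (.var 9) (.var 9)))))
    (.seq popProg
    (.seq (costProg 45)
    (.ite (.mul (.mul (.lt (.const 0) (.load 56 (.var 53)))
        (.eq (.add (.var 34) (.var 50)) (.var 5)))
        (.lt (.add (.add (.var 51) (.var 52)) (.var 32)) (.var 46)))
      (.seq (.store 46 (.const 0) (.add (.add (.var 51) (.var 52)) (.var 32)))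
        (.store 47 (.const 0) (.var 30)))
      .skip))))

@[simp] theorem writes_fillAProg :
    fillAProg.writes = [53, 30, 34, 33, 34, 33, 30, 32, 31, 32, 31, 54, 53] := rfl
@[simp] theorem writes_fillBProg :
    fillBProg.writes = [53, 30, 32, 31, 32, 31, 55, 53] := rfl
@[simp] theorem writes_scanProg :
    scanProg.writes = [53, 30, 34, 33, 34, 33, 32, 31, 32, 31, 46, 47, 53] := rfl

theorem ok_fillAProg : fillAProg.Ok := by
  simp [fillAProg, Prog.ok_forLoop, ok_popProg, ok_costProg, Prog.Ok, Expr.Ok, Expr.Small,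
    Expr.mod, Expr.eq, Expr.isZero]

theorem ok_fillBProg : fillBProg.Ok := by
  simp [fillBProg, Prog.ok_forLoop, ok_costProg, Prog.Ok, Expr.Ok, Expr.Small,
    Expr.mod, Expr.eq, Expr.isZero]

theorem ok_scanProg : scanProg.Ok := by
  simp [scanProg, Prog.ok_forLoop, ok_popProg, ok_costProg, Prog.Ok, Expr.Ok, Expr.Small,
    Expr.mod, Expr.eq, Expr.isZero, Expr.lt]

variable {Ω Ξ : ℕ} {m : Mem} {P : Params}

theorem Fits.NN_le_S (hF : Fits P Ω) : P.N * P.N ≤ P.S := by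
  calc P.N * P.N = (P.d ^ 2) ^ P.h := by rw [Params.N, ← pow_mul, mul_comm 2, pow_mul, sq]
    _ ≤ _ := Nat.pow_le_pow_left hF.d_sq_le _

theorem mask_lt {N j : ℕ} (hj : j < N * N) : j / N < N ∧ j % N < N ∧
    j / N + j % N * N < N * N ∧ j / N * N + j % N = j := by
  have hN : 0 < N := Nat.pos_of_ne_zero fun h => by simp [h] at hj
  have h1 : j / N < N := Nat.div_lt_of_lt_mul hj
  have h2 : j % N < N := Nat.mod_lt _ hN
  refine ⟨h1, h2, ?_, by rw [mul_comm]; exact Nat.div_add_mod _ _⟩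
  calc _ < N + j % N * N := by omega
    _ = (j % N + 1) * N := by ring
    _ ≤ _ := Nat.mul_le_mul_right _ h2

/-- The condition on the size of the middle part enters this matrix only; the other matrix tests
just the value of its weight. -/
theorem runs_fillAProg (hΩ : Ω ≤ Ξ) (hF : Fits P Ω) (hC : Ctx P m)
    (hw : ∑ p ∈ Finset.range (P.n * P.n), m 43 p ≤ Ξ) :
    Runs Ω Ξ ((P.n * P.n + 1) * (P.N * P.N + 1)) fillAProg m fun m' => ∀ j < P.N * P.N,
      m' 54 j = (if pop P.n (j % P.N * P.N) = m 50 0 then 1 else 0) *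
        if cost P.n (m 43) (j / P.N + j % P.N * P.N) = m 51 0 then 1 else 0 := by
  refine Runs.forLoop (cnt := P.N * P.N) hΩ (by omega) hC.NN_eq
    (by simp [Prog.writes]) (by simp [Prog.writes]) (by simp) (hF.NN_le.trans (le_lim hΩ _))
    (fun t m' => ∀ j < t,
      m' 54 j = (if pop P.n (j % P.N * P.N) = m 50 0 then 1 else 0) *
        if cost P.n (m 43) (j / P.N + j % P.N * P.N) = m 51 0 then 1 else 0) (by simp) ?_
  intro t m₁ ht hf ht₁ hI
  have hC₁ : Ctx P m₁ := hC.agree (Agree.of_frame (by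
    simp [Prog.writes_forLoop, Prog.writes]) hf)
  simp only [Prog.writes_forLoop, Prog.writes, writes_popProg, writes_costProg, List.mem_cons,
    List.mem_append, List.not_mem_nil, not_or, or_false, and_imp] at hf
  obtain ⟨t1, t2, t3, -⟩ := mask_lt ht
  refine Runs.store_seq hΩ (by omega) ?_ ?_
  · refine le_trans ?_ (le_lim hΩ _)
    simp only [Expr.eval_mul, Expr.eval_mod, Expr.eval_load, Expr.eval_const, ht₁, hC₁.N_eq]
    exact (Nat.le_add_left _ _).trans (t3.le.trans hF.NN_le)
  have hC₂ := hC₁.agree (Agree.set (m := m₁) (a := 30) (by norm_num) 0 (t % P.N * P.N))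
  simp only [Expr.eval_mul, Expr.eval_mod, Expr.eval_load, Expr.eval_const, ht₁, hC₁.N_eq]
  refine Runs.seq ((runs_popProg hΩ hF.n_le hC₂.toBase).mono
    (by nlinarith [Nat.le_mul_self P.n]) ?_)
  intro m₂ _ hf₂ hp _
  have hC₂ : Ctx P m₂ := hC₂.agree (Agree.of_frame (by simp) hf₂)
  simp only [writes_popProg, List.mem_cons, List.not_mem_nil, not_or, or_false, and_imp] at hf₂
  have r53 : m₂ 53 0 = t := by rw [hf₂] <;> simp [ht₁]
  refine Runs.store_seq hΩ (by omega) ?_ ?_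
  · refine le_trans ?_ (le_lim hΩ _)
    simp only [Expr.eval_mul, Expr.eval_mod, Expr.eval_load, Expr.eval_const, Expr.eval_add,
      Expr.eval_div, r53, hC₂.N_eq]
    exact t3.le.trans hF.NN_le
  simp only [Expr.eval_mul, Expr.eval_mod, Expr.eval_load, Expr.eval_const, Expr.eval_add,
      Expr.eval_div, r53, hC₂.N_eq]
  have hC₃ := hC₂.agree (Agree.set (m := m₂) (a := 30) (by norm_num) 0 (t / P.N + t % P.N * P.N))
  have r43 : (m₂.set 30 0 (t / P.N + t % P.N * P.N)) 43 = m 43 := by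
    rw [Mem.set_of_ne _ (by norm_num), hf₂, Mem.set_of_ne, hf] <;> simp
  refine Runs.seq ((runs_costProg hΩ hF.nn_le hC₃.toBase (w := 43) (by norm_num) (by norm_num)
    (by rwa [r43])).mono le_rfl ?_)
  intro m₃ _ hf₃ hc _
  simp only [writes_costProg, List.mem_cons, List.not_mem_nil, not_or, or_false, and_imp] at hf₃
  rw [r43] at hc
  have s34 : m₃ 34 0 = pop P.n (t % P.N * P.N) := by rw [hf₃] <;> simp [hp]
  have s32 : m₃ 32 0 = cost P.n (m 43) (t / P.N + t % P.N * P.N) := by simpa using hc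
  have s50 : m₃ 50 0 = m 50 0 := by
    rw [hf₃, Mem.set_of_ne, hf₂, Mem.set_of_ne, hf] <;> simp
  have s51 : m₃ 51 0 = m 51 0 := by
    rw [hf₃, Mem.set_of_ne, hf₂, Mem.set_of_ne, hf] <;> simp
  have s53 : m₃ 53 0 = t := by
    rw [hf₃, Mem.set_of_ne, r53] <;> simp
  have s54 : m₃ 54 = m₁ 54 := by
    rw [hf₃, Mem.set_of_ne, hf₂, Mem.set_of_ne] <;> simp
  refine Runs.store hΩ (by omega) ?_ ?_
  · refine le_trans ?_ (le_lim hΩ _)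
    have := hF.one_le
    simp only [Expr.eval_mul, Expr.eval_eq]
    split_ifs <;> simp [this]
  · intro j hj
    rw [Mem.set_of_ne _ (by norm_num), Mem.set_apply]
    simp only [Expr.eval_mul, Expr.eval_eq, Expr.eval_load, Expr.eval_const, s34, s32, s50, s51,
      s53, s54]
    by_cases h : j = t
    · rw [if_pos h, h]
    · rw [if_neg h]; exact hI j (by omega)

theorem runs_fillBProg (hΩ : Ω ≤ Ξ) (hF : Fits P Ω) (hC : Ctx P m)
    (hw : ∑ p ∈ Finset.range (P.n * P.n), m 44 p ≤ Ξ) :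
    Runs Ω Ξ ((P.n * P.n + 1) * (P.N * P.N + 1)) fillBProg m fun m' => ∀ j < P.N * P.N,
      m' 55 j =
        if cost P.n (m 44) ((j / P.N + j % P.N * P.N) * P.N) = m 52 0 then 1 else 0 := by
  refine Runs.forLoop (cnt := P.N * P.N) hΩ (by omega) hC.NN_eq
    (by simp [Prog.writes]) (by simp [Prog.writes]) (by simp) (hF.NN_le.trans (le_lim hΩ _))
    (fun t m' => ∀ j < t, m' 55 j =
        if cost P.n (m 44) ((j / P.N + j % P.N * P.N) * P.N) = m 52 0 then 1 else 0) (by simp) ?_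
  intro t m₁ ht hf ht₁ hI
  have hC₁ : Ctx P m₁ := hC.agree (Agree.of_frame (by
    simp [Prog.writes_forLoop, Prog.writes]) hf)
  simp only [Prog.writes_forLoop, Prog.writes, writes_costProg, List.mem_cons,
    List.mem_append, List.not_mem_nil, not_or, or_false, and_imp] at hf
  obtain ⟨t1, t2, t3, -⟩ := mask_lt ht
  refine Runs.store_seq hΩ (by omega) ?_ ?_
  · refine le_trans ?_ (le_lim hΩ _)
    simp only [Expr.eval_mul, Expr.eval_mod, Expr.eval_load, Expr.eval_const, Expr.eval_add,
      Expr.eval_div, ht₁, hC₁.N_eq]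
    exact (Nat.mul_le_mul_right _ t3.le).trans hF.N_le
  simp only [Expr.eval_mul, Expr.eval_mod, Expr.eval_load, Expr.eval_const, Expr.eval_add,
      Expr.eval_div, ht₁, hC₁.N_eq]
  have hC₃ := hC₁.agree (Agree.set (m := m₁) (a := 30) (by norm_num) 0
    ((t / P.N + t % P.N * P.N) * P.N))
  have r44 : (m₁.set 30 0 ((t / P.N + t % P.N * P.N) * P.N)) 44 = m 44 := by
    rw [Mem.set_of_ne _ (by norm_num), hf] <;> simp
  refine Runs.seq ((runs_costProg hΩ hF.nn_le hC₃.toBase (w := 44) (by norm_num) (by norm_num)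
    (by rwa [r44])).mono le_rfl ?_)
  intro m₃ _ hf₃ hc _
  simp only [writes_costProg, List.mem_cons, List.not_mem_nil, not_or, or_false, and_imp] at hf₃
  rw [r44] at hc
  have s32 : m₃ 32 0 = cost P.n (m 44) ((t / P.N + t % P.N * P.N) * P.N) := by simpa using hc
  have s52 : m₃ 52 0 = m 52 0 := by
    rw [hf₃, Mem.set_of_ne, hf] <;> simp
  have s53 : m₃ 53 0 = t := by
    rw [hf₃, Mem.set_of_ne, ht₁] <;> simp
  have s55 : m₃ 55 = m₁ 55 := by
    rw [hf₃, Mem.set_of_ne] <;> simp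
  refine Runs.store hΩ (by omega) ?_ ?_
  · refine le_trans ?_ (le_lim hΩ _)
    have := hF.one_le
    simp only [Expr.eval_eq]
    split_ifs <;> simp [this]
  · intro j hj
    rw [Mem.set_of_ne _ (by norm_num), Mem.set_apply]
    simp only [Expr.eval_eq, Expr.eval_load, Expr.eval_const, s32, s52, s53, s55]
    by_cases h : j = t
    · rw [if_pos h, h]
    · rw [if_neg h]; exact hI j (by omega)

/-- The pairs of a value and the outer parts of a mask of size `k` with this value, for the masks
whose code is less than `t`, or equal to `t` with outer parts before position `j`. -/
def hits (P : Params) (wA wB wC : ℕ → ℕ) (t j : ℕ) : Set (ℕ × ℕ) :=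
  {vl | ∃ x < P.N, ∃ y < P.N, ∃ z < P.N, vl.2 = x + z * (P.N * P.N) ∧
    pop P.n vl.2 + pop P.n (y * P.N) = P.k ∧
    vl.1 = cost P.n wA (x + y * P.N) + cost P.n wB ((y + z * P.N) * P.N) + cost P.n wC vl.2 ∧
    ((pop P.n (y * P.N) * P.C + cost P.n wA (x + y * P.N)) * P.C +
        cost P.n wB ((y + z * P.N) * P.N) < t ∨
      (pop P.n (y * P.N) * P.C + cost P.n wA (x + y * P.N)) * P.C +
        cost P.n wB ((y + z * P.N) * P.N) = t ∧ x * P.N + z < j)}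

/-- The scalars `46` and `47` hold the pair in `H` with the least value. -/
def IsLow (c : ℕ) (H : Set (ℕ × ℕ)) (m : Mem) : Prop :=
  (∀ vl ∈ H, m 46 0 ≤ vl.1) ∧ (m 46 0 = c ∨ (m 46 0, m 47 0) ∈ H)

theorem IsLow.congr {c : ℕ} {H : Set (ℕ × ℕ)} {m m' : Mem} (h : IsLow c H m)
    (h6 : m' 46 = m 46) (h7 : m' 47 = m 47) : IsLow c H m' := by
  unfold IsLow; rw [h6, h7]; exact h

theorem indicator_ne_zero (A B C : Prop) [Decidable A] [Decidable B] [Decidable C] :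
    (if A then 1 else 0) * (if B then 1 else 0) * (if C then 1 else 0) ≠ (0 : ℕ) ↔
      (A ∧ B) ∧ C := by
  by_cases hA : A <;> by_cases hB : B <;> by_cases hC : C <;> simp [hA, hB, hC]

/-- The code `t` fixes the size `k₂` and the values `a`, `b`. A positive product entry certifies a
middle part with these data, so the total weight is known without knowing the middle part. -/
theorem runs_scanProg (hΩ : Ω ≤ Ξ) (hF : Fits P Ω) (hC : Ctx P m) {wA wB : ℕ → ℕ} {k₂ a b t : ℕ}
    (hw : ∑ p ∈ Finset.range (P.n * P.n), m 45 p ≤ Ξ)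
    (h50 : m 50 0 = k₂) (h51 : m 51 0 = a) (h52 : m 52 0 = b) (ha : a < P.C) (hb : b < P.C)
    (hcA : ∀ l, cost P.n wA l < P.C) (hcB : ∀ l, cost P.n wB l < P.C)
    (ht : (k₂ * P.C + a) * P.C + b = t)
    (h56 : ∀ x < P.N, ∀ z < P.N, 0 < m 56 (x * P.N + z) ↔ ∃ y < P.N, pop P.n (y * P.N) = k₂ ∧
      cost P.n wA (x + y * P.N) = a ∧ cost P.n wB ((y + z * P.N) * P.N) = b)
    (hI : IsLow (3 * P.C) (hits P wA wB (m 45) t 0) m) :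
    Runs Ω Ξ ((P.n * P.n + 1) * (P.N * P.N + 1)) scanProg m
      (IsLow (3 * P.C) (hits P wA wB (m 45) (t + 1) 0)) := by
  refine (Runs.forLoop (cnt := P.N * P.N) hΩ (by omega) hC.NN_eq
    (by simp [Prog.writes]) (by simp [Prog.writes]) (by simp) (hF.NN_le.trans (le_lim hΩ _))
    (fun j m' => IsLow (3 * P.C) (hits P wA wB (m 45) t j) m')
    (hI.congr (by simp) (by simp)) ?_).mono le_rfl ?_
  · intro j m₁ hj hf hj₁ hI
    have hC₁ : Ctx P m₁ := hC.agree (Agree.of_frame (by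
      simp [Prog.writes_forLoop, Prog.writes]) hf)
    simp only [Prog.writes_forLoop, Prog.writes, writes_popProg, writes_costProg, List.mem_cons,
      List.mem_append, List.not_mem_nil, not_or, or_false, and_imp] at hf
    obtain ⟨t1, t2, t3, t4⟩ := mask_lt hj
    set l := j / P.N + j % P.N * (P.N * P.N) with hl
    have hlN : l ≤ P.N * P.N * P.N := by
      calc l ≤ P.N * P.N + j % P.N * (P.N * P.N) := by
            have := Nat.le_mul_self P.N; omega
        _ = (j % P.N + 1) * (P.N * P.N) := by ring
        _ ≤ P.N * (P.N * P.N) := Nat.mul_le_mul_right _ t2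
        _ = _ := by ring
    refine Runs.store_seq hΩ (by omega) ?_ ?_
    · refine le_trans ?_ (le_lim hΩ _)
      simp only [Expr.eval_mul, Expr.eval_mod, Expr.eval_load, Expr.eval_const, Expr.eval_add,
        Expr.eval_div, hj₁, hC₁.N_eq]
      exact hlN.trans hF.N_le
    simp only [Expr.eval_mul, Expr.eval_mod, Expr.eval_load, Expr.eval_const, Expr.eval_add,
      Expr.eval_div, hj₁, hC₁.N_eq, ← hl]
    have hC₂ := hC₁.agree (Agree.set (m := m₁) (a := 30) (by norm_num) 0 l)
    refine Runs.seq ((runs_popProg hΩ hF.n_le hC₂.toBase).mono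
      (by nlinarith [Nat.le_mul_self P.n]) ?_)
    intro m₂ _ hf₂ hp _
    have hC₂ : Ctx P m₂ := hC₂.agree (Agree.of_frame (by simp) hf₂)
    simp only [writes_popProg, List.mem_cons, List.not_mem_nil, not_or, or_false, and_imp] at hf₂
    have r45 : m₂ 45 = m 45 := by
      rw [hf₂, Mem.set_of_ne, hf] <;> simp
    refine Runs.seq ((runs_costProg hΩ hF.nn_le hC₂.toBase (w := 45) (by norm_num) (by norm_num)
      (by rwa [r45])).mono le_rfl ?_)
    intro m₃ hbd₃ hf₃ hc _
    have hC₃ : Ctx P m₃ := hC₂.agree (Agree.of_frame (by simp) hf₃)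
    simp only [writes_costProg, List.mem_cons, List.not_mem_nil, not_or, or_false, and_imp] at hf₃
    have r30 : m₂ 30 0 = l := by rw [hf₂] <;> simp
    rw [r45, r30] at hc
    have s34 : m₃ 34 0 = pop P.n l := by rw [hf₃] <;> simp [hp]
    have s30 : m₃ 30 0 = l := by rw [hf₃] <;> simp [r30]
    have s50 : m₃ 50 0 = k₂ := by rw [hf₃, hf₂, Mem.set_of_ne, hf] <;> simp [h50]
    have s51 : m₃ 51 0 = a := by rw [hf₃, hf₂, Mem.set_of_ne, hf] <;> simp [h51]
    have s52 : m₃ 52 0 = b := by rw [hf₃, hf₂, Mem.set_of_ne, hf] <;> simp [h52]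
    have s53 : m₃ 53 0 = j := by rw [hf₃, hf₂, Mem.set_of_ne] <;> simp [hj₁]
    have s56 : m₃ 56 = m 56 := by rw [hf₃, hf₂, Mem.set_of_ne, hf] <;> simp
    have s46 : m₃ 46 = m₁ 46 := by rw [hf₃, hf₂, Mem.set_of_ne] <;> simp
    have s47 : m₃ 47 = m₁ 47 := by rw [hf₃, hf₂, Mem.set_of_ne] <;> simp
    have hI₃ : IsLow (3 * P.C) (hits P wA wB (m 45) t j) m₃ := hI.congr s46 s47
    have hlim46 := hbd₃ 46 0
    -- the new elements
    have hnew : ∀ vl ∈ hits P wA wB (m 45) t (j + 1), vl ∉ hits P wA wB (m 45) t j →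
        vl = (a + b + cost P.n (m 45) l, l) ∧ 0 < m 56 j ∧ pop P.n l + k₂ = P.k := by
      rintro ⟨v, l'⟩ ⟨x, hx, y, hy, z, hz, e1, e2, e3, e4⟩ hnot
      have hcode : (pop P.n (y * P.N) * P.C + cost P.n wA (x + y * P.N)) * P.C +
          cost P.n wB ((y + z * P.N) * P.N) = t ∧ x * P.N + z = j := by
        rcases e4 with h | ⟨h, h'⟩
        · exact absurd ⟨x, hx, y, hy, z, hz, e1, e2, e3, Or.inl h⟩ hnot
        · refine ⟨h, ?_⟩
          by_contra hne
          exact hnot ⟨x, hx, y, hy, z, hz, e1, e2, e3, Or.inr ⟨h, by omega⟩⟩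
      obtain ⟨hc1, hc2⟩ := hcode
      -- The values are below `P.C`, so equal codes have equal size and values.
      obtain ⟨f1, f2, f3⟩ := decode (hcA _) (hcB _) hc1
      obtain ⟨g1, g2, g3⟩ := decode ha hb ht
      rw [g1] at f1
      rw [g2] at f2
      rw [g3] at f3
      have hxz : x = j / P.N ∧ z = j % P.N := by
        refine mul_add_eq hz t2 ?_
        rw [hc2, t4]
      simp only at e1 e2 e3
      have el : l' = l := by rw [e1, hl, hxz.1, hxz.2]
      subst el
      refine ⟨?_, ?_, ?_⟩
      · rw [e3, ← f2, ← f3]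
      · rw [← hc2]; exact (h56 x hx z hz).2 ⟨y, hy, f1.symm, f2.symm, f3.symm⟩
      · rw [f1]; exact e2
    have hmono : hits P wA wB (m 45) t j ⊆ hits P wA wB (m 45) t (j + 1) := by
      rintro vl ⟨x, hx, y, hy, z, hz, e1, e2, e3, e4⟩
      exact ⟨x, hx, y, hy, z, hz, e1, e2, e3, e4.imp_right fun h => ⟨h.1, by omega⟩⟩
    have hmem : 0 < m 56 j → pop P.n l + k₂ = P.k →
        (a + b + cost P.n (m 45) l, l) ∈ hits P wA wB (m 45) t (j + 1) := by
      intro h1 h2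
      rw [← t4] at h1
      obtain ⟨y, hy, e1, e2, e3⟩ := (h56 _ t1 _ t2).1 h1
      exact ⟨_, t1, y, hy, _, t2, rfl, by rw [e1]; exact h2, by rw [e2, e3], Or.inr
        ⟨by rw [e1, e2, e3, ht], by rw [t4]; omega⟩⟩
    have htest : (Expr.mul (.mul (.lt (.const 0) (.load 56 (.var 53)))
        (.eq (.add (.var 34) (.var 50)) (.var 5)))
        (.lt (.add (.add (.var 51) (.var 52)) (.var 32)) (.var 46))).eval m₃ ≠ 0 ↔
        (0 < m 56 j ∧ pop P.n l + k₂ = P.k) ∧ a + b + cost P.n (m 45) l < m₃ 46 0 := by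
      simp only [Expr.eval_mul, Expr.eval_lt, Expr.eval_eq, Expr.eval_add, Expr.eval_load,
        Expr.eval_const, s34, s50, s51, s52, s53, s56, hC₃.k_eq, hc]
      exact indicator_ne_zero _ _ _
    refine Runs.ite hΩ (by omega) (fun h => ?_) fun h => ?_
    · obtain ⟨⟨h1, h2⟩, h3⟩ := htest.1 h
      refine Runs.store_seq hΩ (by omega) ?_ ?_
      · simp only [Expr.eval_add, Expr.eval_load, Expr.eval_const, s51, s52, hc]
        exact h3.le.trans hlim46
      refine Runs.store hΩ (by omega) ?_ ?_
      · refine le_trans ?_ (le_lim hΩ _)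
        simp [s30]
        exact hlN.trans hF.N_le
      · have q1 : (((m₃.set 46 0 (a + b + cost P.n (m 45) l)).set 47 0 l).set 53 0 (j + 1)) 46 0 =
            a + b + cost P.n (m 45) l := by simp
        have q2 : (((m₃.set 46 0 (a + b + cost P.n (m 45) l)).set 47 0 l).set 53 0 (j + 1)) 47 0 =
            l := by simp
        simp only [Expr.eval_add, Expr.eval_load, Expr.eval_const, s51, s52, hc, ne_eq,
          Nat.reduceEqDiff, not_false_eq_true, Mem.set_of_ne, s30]
        unfold IsLow
        rw [q1, q2]
        refine ⟨fun vl hvl => ?_, Or.inr (hmem h1 h2)⟩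
        by_cases hin : vl ∈ hits P wA wB (m 45) t j
        · exact h3.le.trans (hI₃.1 vl hin)
        · rw [(hnew vl hvl hin).1]
    · refine Runs.skip (by omega) ?_
      refine IsLow.congr (m := m₃) ?_ (by simp) (by simp)
      refine ⟨fun vl hvl => ?_, hI₃.2.imp_right fun h => hmono h⟩
      by_cases hin : vl ∈ hits P wA wB (m 45) t j
      · exact hI₃.1 vl hin
      · obtain ⟨e1, e2, e3⟩ := hnew vl hvl hin
        rw [e1]
        by_contra hlt
        exact absurd h (htest.2 ⟨⟨e2, e3⟩, not_le.1 hlt⟩)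
  · intro m' _ _ h
    -- After all positions have been scanned, code `t` is exhausted.
    have : hits P wA wB (m 45) t (P.N * P.N) = hits P wA wB (m 45) (t + 1) 0 := by
      ext vl
      constructor
      · rintro ⟨x, hx, y, hy, z, hz, e1, e2, e3, e4⟩
        exact ⟨x, hx, y, hy, z, hz, e1, e2, e3, Or.inl (by omega)⟩
      · rintro ⟨x, hx, y, hy, z, hz, e1, e2, e3, e4⟩
        refine ⟨x, hx, y, hy, z, hz, e1, e2, e3, ?_⟩
        have hxz : x * P.N + z < P.N * P.N := by
          calc _ < x * P.N + P.N := by omega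
            _ = (x + 1) * P.N := by ring
            _ ≤ _ := Nat.mul_le_mul_right _ hx
        omega
    rwa [this] at h

end RAM

/-! ### Minimizing over all sizes and values, and reassembling masks. -/

namespace RAM

/-- The pairs of a value and the outer parts of a mask of size `k` with this value. -/
def allHits (P : Params) (wA wB wC : ℕ → ℕ) : Set (ℕ × ℕ) :=
  {vl | ∃ x < P.N, ∃ y < P.N, ∃ z < P.N, vl.2 = x + z * (P.N * P.N) ∧
    pop P.n vl.2 + pop P.n (y * P.N) = P.k ∧
    vl.1 = cost P.n wA (x + y * P.N) + cost P.n wB ((y + z * P.N) * P.N) + cost P.n wC vl.2}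

/-- Minimizes the sum of the weights in the arrays `43`, `44`, `45`, up to the middle part of the
mask. -/
def solveProg (d R : ℕ) (U V W : ℕ → ℕ → ℤ) : Prog :=
  .seq (.store 46 (.const 0) (.mul (.const 3) (.var 17)))
    (.forLoop 49 18
      (.seq (.store 50 (.const 0) (.div (.var 49) (.mul (.var 17) (.var 17))))
      (.seq (.store 51 (.const 0) (.mod (.div (.var 49) (.var 17)) (.var 17)))
      (.seq (.store 52 (.const 0) (.mod (.var 49) (.var 17)))
      (.seq fillAProg (.seq fillBProg (.seq (mulProg d R U V W) scanProg)))))))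

/-- Considers all masks with the outer parts in array `47`. -/
def finalProg : Prog :=
  .forLoop 65 9 (.seq (.store 30 (.const 0) (.add (.var 47) (.mul (.var 65) (.var 9))))
    considerProg)

/-- Considers the masks that are optimal for some rounding of the weights. -/
def candProg (d R : ℕ) (U V W : ℕ → ℕ → ℤ) : Prog :=
  .forLoop 38 7 (.seq roundProg (.seq (solveProg d R U V W) finalProg))

@[simp] theorem writes_solveProg (d R : ℕ) (U V W : ℕ → ℕ → ℤ) :
    (solveProg d R U V W).writes = 46 :: 49 :: (50 :: 51 :: 52 :: (fillAProg.writes ++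
      (fillBProg.writes ++ ((mulProg d R U V W).writes ++ scanProg.writes))) ++ [49]) := rfl

@[simp] theorem writes_finalProg :
    finalProg.writes = 65 :: (30 :: considerProg.writes ++ [65]) := rfl

@[simp] theorem writes_candProg (d R : ℕ) (U V W : ℕ → ℕ → ℤ) :
    (candProg d R U V W).writes = 38 :: (roundProg.writes ++
      ((solveProg d R U V W).writes ++ finalProg.writes) ++ [38]) := rfl

theorem ok_solveProg (d R : ℕ) (U V W : ℕ → ℕ → ℤ) : (solveProg d R U V W).Ok := by
  simp [solveProg, Prog.ok_forLoop, ok_fillAProg, ok_fillBProg, ok_mulProg, ok_scanProg, Prog.Ok,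
    Expr.Ok, Expr.Small, Expr.mod]

theorem ok_finalProg : finalProg.Ok := by
  simp [finalProg, Prog.ok_forLoop, ok_considerProg, Prog.Ok, Expr.Ok, Expr.Small]

theorem ok_candProg (d R : ℕ) (U V W : ℕ → ℕ → ℤ) : (candProg d R U V W).Ok := by
  simp [candProg, Prog.ok_forLoop, ok_roundProg, ok_solveProg, ok_finalProg, Prog.Ok]

variable {Ω Ξ : ℕ} {m : Mem} {P : Params}

theorem runs_solveBody (hΩ : Ω ≤ Ξ) (hF : Fits P Ω) {U V W : ℕ → ℕ → ℤ}
    (hS : Arith.IsScheme P.d P.R P.D U V W) (hD : 0 < P.D) {m₂ : Mem} (hC₂ : Ctx P m₂)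
    {k₂ a b t : ℕ} (hab : (k₂ * P.C + a) * P.C + b = t) (haC : a < P.C) (hbC : b < P.C)
    (hA : ∑ p ∈ Finset.range (P.n * P.n), m₂ 43 p ≤ P.n * P.n * P.K)
    (hB : ∑ p ∈ Finset.range (P.n * P.n), m₂ 44 p ≤ P.n * P.n * P.K)
    (hW : ∑ p ∈ Finset.range (P.n * P.n), m₂ 45 p ≤ P.n * P.n * P.K)
    (c50 : m₂ 50 0 = k₂) (c51 : m₂ 51 0 = a) (c52 : m₂ 52 0 = b)
    (cI : IsLow (3 * P.C) (hits P (m₂ 43) (m₂ 44) (m₂ 45) t 0) m₂) :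
    Runs Ω Ξ ((P.n * P.n + 1) * (P.h * P.S + 1))
      (.seq fillAProg (.seq fillBProg (.seq (mulProg P.d P.R U V W) scanProg))) m₂
      (IsLow (3 * P.C) (hits P (m₂ 43) (m₂ 44) (m₂ 45) (t + 1) 0)) := by
  have hKΞ : P.n * P.n * P.K ≤ Ξ := hF.K_le.trans hΩ
  have hcost : ∀ a, (∑ p ∈ Finset.range (P.n * P.n), m₂ a p ≤ P.n * P.n * P.K) →
      ∀ l, cost P.n (m₂ a) l < P.C := fun a ha l =>
    Nat.lt_succ_of_le ((cost_le _ _ _).trans ha)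
  have hinner : (P.n * P.n + 1) * (P.N * P.N + 1) ≤ (P.n * P.n + 1) * (P.h * P.S + 1) :=
    Nat.mul_le_mul_left _ (Nat.add_le_add_right (hF.NN_le_S.trans
      (Nat.le_mul_of_pos_left _ hF.h_pos)) 1)
  refine Runs.seq ((runs_fillAProg hΩ hF hC₂ (by exact hA.trans hKΞ)).mono hinner ?_)
  intro m₃ _ hf₃ h54 _
  have hC₃ : Ctx P m₃ := hC₂.agree (Agree.of_frame (by simp) hf₃)
  simp only [writes_fillAProg, List.mem_cons, List.not_mem_nil, not_or, or_false, and_imp] at hf₃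
  rw [c50, c51] at h54
  have d44 : m₃ 44 = m₂ 44 := by rw [hf₃] <;> simp
  have d45 : m₃ 45 = m₂ 45 := by rw [hf₃] <;> simp
  have d50 : m₃ 50 0 = k₂ := by rw [hf₃, c50] <;> simp
  have d51 : m₃ 51 0 = a := by rw [hf₃, c51] <;> simp
  have d52 : m₃ 52 0 = b := by rw [hf₃, c52] <;> simp
  have dI := cI.congr (m' := m₃) (by rw [hf₃] <;> simp) (by rw [hf₃] <;> simp)
  refine Runs.seq ((runs_fillBProg hΩ hF hC₃ (by rw [d44]; exact hB.trans hKΞ)).mono hinner ?_)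
  intro m₄ _ hf₄ h55 _
  have hC₄ : Ctx P m₄ := hC₃.agree (Agree.of_frame (by simp) hf₄)
  simp only [writes_fillBProg, List.mem_cons, List.not_mem_nil, not_or, or_false, and_imp] at hf₄
  rw [d44, d52] at h55
  have e45 : m₄ 45 = m₂ 45 := by rw [hf₄, d45] <;> simp
  have e50 : m₄ 50 0 = k₂ := by rw [hf₄, d50] <;> simp
  have e51 : m₄ 51 0 = a := by rw [hf₄, d51] <;> simp
  have e52 : m₄ 52 0 = b := by rw [hf₄, d52] <;> simp
  have e54 : m₄ 54 = m₃ 54 := by rw [hf₄] <;> simp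
  have eI := dI.congr (m' := m₄) (by rw [hf₄] <;> simp) (by rw [hf₄] <;> simp)
  rw [← e54] at h54
  have g54 : ∀ j < P.N * P.N, m₄ 54 j ≤ 1 := fun j hj => by rw [h54 j hj]; split_ifs <;> simp
  have g55 : ∀ j < P.N * P.N, m₄ 55 j ≤ 1 := fun j hj => by rw [h55 j hj]; split_ifs <;> simp
  refine Runs.seq ((runs_mulProg hΩ hF hC₄ hS g54 g55).mono
    (Nat.le_mul_of_pos_left _ (by omega)) ?_)
  intro m₅ _ hf₅ h56 _
  have hC₅ : Ctx P m₅ := hC₄.agree (Agree.of_frame (by simp) hf₅)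
  simp only [writes_mulProg, List.mem_cons, List.not_mem_nil, not_or, or_false, and_imp] at hf₅
  have f45 : m₅ 45 = m₂ 45 := by rw [hf₅, e45] <;> simp
  have f50 : m₅ 50 0 = k₂ := by rw [hf₅, e50] <;> simp
  have f51 : m₅ 51 0 = a := by rw [hf₅, e51] <;> simp
  have f52 : m₅ 52 0 = b := by rw [hf₅, e52] <;> simp
  have fI := eI.congr (m' := m₅) (by rw [hf₅] <;> simp) (by rw [hf₅] <;> simp)
  rw [← f45] at fI
  have hNpos : 0 < P.N := Params.N_pos
  -- A sum of products of indicators is positive if and only if some middle part satisfies all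
  -- conditions.
  have hcase : ∀ x < P.N, ∀ z < P.N, 0 < m₅ 56 (x * P.N + z) ↔
      ∃ y < P.N, pop P.n (y * P.N) = k₂ ∧
      cost P.n (m₂ 43) (x + y * P.N) = a ∧ cost P.n (m₂ 44) ((y + z * P.N) * P.N) = b := by
    intro x hx z hz
    have hidx : ∀ x < P.N, ∀ y < P.N, (x * P.N + y) / P.N = x ∧ (x * P.N + y) % P.N = y ∧
        x * P.N + y < P.N * P.N := by
      intro x hx y hy
      refine ⟨?_, ?_, ?_⟩
      · rw [mul_comm, Nat.mul_add_div hNpos, Nat.div_eq_of_lt hy, add_zero]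
      · rw [mul_comm, Nat.mul_add_mod, Nat.mod_eq_of_lt hy]
      · calc _ < x * P.N + P.N := by omega
          _ = (x + 1) * P.N := by ring
          _ ≤ _ := Nat.mul_le_mul_right _ hx
    have hterm : ∀ y < P.N, 0 < m₄ 54 (x * P.N + y) * m₄ 55 (y * P.N + z) ↔
        pop P.n (y * P.N) = k₂ ∧
        cost P.n (m₂ 43) (x + y * P.N) = a ∧ cost P.n (m₂ 44) ((y + z * P.N) * P.N) = b := by
      intro y hy
      obtain ⟨i1, i2, i3⟩ := hidx x hx y hy
      obtain ⟨j1, j2, j3⟩ := hidx y hy z hz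
      rw [h54 _ i3, h55 _ j3, i1, i2, j1, j2, Nat.pos_iff_ne_zero, indicator_ne_zero, and_assoc]
    rw [h56 x hx z hz, Nat.mul_pos_iff_of_pos_left (Nat.pow_pos hD), Finset.sum_pos_iff]
    simp only [Finset.mem_range]
    exact ⟨fun ⟨y, hy, h⟩ => ⟨y, hy, (hterm y hy).1 h⟩,
      fun ⟨y, hy, h⟩ => ⟨y, hy, (hterm y hy).2 h⟩⟩
  refine (runs_scanProg hΩ hF hC₅ (by rw [f45]; exact hW.trans hKΞ) f50 f51 f52 haC hbC
    (hcost 43 hA) (hcost 44 hB) hab hcase fI).mono hinner ?_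
  intro m₆ _ _ h
  rw [f45] at h
  exact h

/-- The loop index enumerates all triples of a size and two values. The initial value `3 * P.C` is a
sentinel: three parts of weight below `P.C` never add up to it. -/
theorem runs_solveProg (hΩ : Ω ≤ Ξ) (hF : Fits P Ω) (hC : Ctx P m) {U V W : ℕ → ℕ → ℤ}
    (hS : Arith.IsScheme P.d P.R P.D U V W) (hD : 0 < P.D)
    (hA : ∑ p ∈ Finset.range (P.n * P.n), m 43 p ≤ P.n * P.n * P.K)
    (hB : ∑ p ∈ Finset.range (P.n * P.n), m 44 p ≤ P.n * P.n * P.K)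
    (hW : ∑ p ∈ Finset.range (P.n * P.n), m 45 p ≤ P.n * P.n * P.K) :
    Runs Ω Ξ ((P.n * P.n + 1) * (P.h * P.S + 1) * (P.T + 1)) (solveProg P.d P.R U V W) m
      (IsLow (3 * P.C) (allHits P (m 43) (m 44) (m 45))) := by
  have hcost : ∀ a, (∑ p ∈ Finset.range (P.n * P.n), m a p ≤ P.n * P.n * P.K) →
      ∀ l, cost P.n (m a) l < P.C := fun a ha l =>
    Nat.lt_succ_of_le ((cost_le _ _ _).trans ha)
  have hpos : 1 ≤ (P.n * P.n + 1) * (P.h * P.S + 1) := Nat.mul_pos (by omega) (by omega)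
  refine Runs.store_seq hΩ (Nat.mul_pos hpos (by omega)) ?_ ?_
  · refine le_trans ?_ (le_lim hΩ _)
    have := hF.C_le
    simp [hC.C_eq]; omega
  simp only [Expr.eval_mul, Expr.eval_const, Expr.eval_load, hC.C_eq]
  refine (Runs.forLoop (c := (P.n * P.n + 1) * (P.h * P.S + 1)) (cnt := P.T) hΩ hpos
    (by simp [hC.T_eq]) (by simp [Prog.writes]) (by simp [Prog.writes]) (by simp)
    (hF.T_le.trans (le_lim hΩ _))
    (fun t m' => IsLow (3 * P.C) (hits P (m 43) (m 44) (m 45) t 0) m') ?_ ?_).mono le_rfl ?_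
  -- No code is below 0 and no position precedes 0, so there are no hits yet.
  · refine ⟨?_, Or.inl (by simp)⟩
    rintro vl ⟨x, hx, y, hy, z, hz, e1, e2, e3, e4⟩
    omega
  · intro t m₁ ht hf ht₁ hI
    have hC₁ : Ctx P m₁ := (hC.agree (Agree.set (a := 46) (by norm_num) 0 (3 * P.C))).agree
      (Agree.of_frame (by simp [Prog.writes_forLoop, Prog.writes]) hf)
    simp [Prog.writes_forLoop, Prog.writes] at hf
    have b43 : m₁ 43 = m 43 := by rw [hf] <;> simp
    have b44 : m₁ 44 = m 44 := by rw [hf] <;> simp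
    have b45 : m₁ 45 = m 45 := by rw [hf] <;> simp
    have hCpos : 0 < P.C := Nat.succ_pos _
    refine Runs.store_seq hΩ hpos ?_ ?_
    · refine le_trans ?_ (le_lim hΩ _)
      simp only [Expr.eval_mul, Expr.eval_div, Expr.eval_const, Expr.eval_load, ht₁]
      exact (Nat.div_le_self _ _).trans (ht.le.trans hF.T_le)
    refine Runs.store_seq hΩ hpos ?_ ?_
    · refine le_trans ?_ (le_lim hΩ _)
      simp only [Expr.eval_div, Expr.eval_const, Expr.eval_load, Expr.eval_mod, ne_eq,
        Nat.reduceEqDiff, not_false_eq_true, Mem.set_of_ne, ht₁]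
      exact (Nat.mod_le _ _).trans ((Nat.div_le_self _ _).trans (ht.le.trans hF.T_le))
    refine Runs.store_seq hΩ hpos ?_ ?_
    · refine le_trans ?_ (le_lim hΩ _)
      simp only [Expr.eval_const, Expr.eval_load, Expr.eval_mod, ne_eq,
        Nat.reduceEqDiff, not_false_eq_true, Mem.set_of_ne, ht₁]
      exact (Nat.mod_le _ _).trans (ht.le.trans hF.T_le)
    simp only [Expr.eval_mul, Expr.eval_div, Expr.eval_const, Expr.eval_load, Expr.eval_mod, ne_eq,
        Nat.reduceEqDiff, not_false_eq_true, Mem.set_of_ne, ht₁, hC₁.C_eq]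
    set k₂ := t / (P.C * P.C) with hk₂
    set a := t / P.C % P.C with ha
    set b := t % P.C with hb
    have hab : (k₂ * P.C + a) * P.C + b = t := by
      rw [hk₂, ha, hb, ← Nat.div_div_eq_div_mul, mul_comm (t / P.C / P.C), Nat.div_add_mod,
        mul_comm, Nat.div_add_mod]
    have haC : a < P.C := Nat.mod_lt _ hCpos
    have hbC : b < P.C := Nat.mod_lt _ hCpos
    set m₂ := ((m₁.set 50 0 k₂).set 51 0 a).set 52 0 b with hm₂
    have hC₂ : Ctx P m₂ := hC₁.agree (((Agree.set (by norm_num) _ _).trans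
      (Agree.set (by norm_num) _ _)).trans (Agree.set (by norm_num) _ _))
    have c43 : m₂ 43 = m 43 := by simp [hm₂, b43]
    have c44 : m₂ 44 = m 44 := by simp [hm₂, b44]
    have c45 : m₂ 45 = m 45 := by simp [hm₂, b45]
    have c50 : m₂ 50 0 = k₂ := by simp [hm₂]
    have c51 : m₂ 51 0 = a := by simp [hm₂]
    have c52 : m₂ 52 0 = b := by simp [hm₂]
    have cI : IsLow (3 * P.C) (hits P (m 43) (m 44) (m 45) t 0) m₂ :=
      hI.congr (by simp [hm₂]) (by simp [hm₂])
    have := runs_solveBody hΩ hF hS hD hC₂ hab haC hbC (by rwa [c43]) (by rwa [c44])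
      (by rwa [c45]) c50 c51 c52 (by rwa [c43, c44, c45])
    rw [c43, c44, c45] at this
    exact this.mono le_rfl fun m' _ _ h => h.congr (by simp) (by simp)
  · intro m' _ _ h
    have : hits P (m 43) (m 44) (m 45) P.T 0 = allHits P (m 43) (m 44) (m 45) := by
      ext vl
      constructor
      · rintro ⟨x, hx, y, hy, z, hz, e1, e2, e3, e4⟩
        exact ⟨x, hx, y, hy, z, hz, e1, e2, e3⟩
      · rintro ⟨x, hx, y, hy, z, hz, e1, e2, e3⟩
        refine ⟨x, hx, y, hy, z, hz, e1, e2, e3, Or.inl ?_⟩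
        -- Sizes are at most `n` and values are below `P.C`, so every code is below `P.T`.
        have h1 := hcost 43 hA (x + y * P.N)
        have h2 := hcost 44 hB ((y + z * P.N) * P.N)
        have h3 := pop_le P.n (y * P.N)
        calc _ < (pop P.n (y * P.N) * P.C + cost P.n (m 43) (x + y * P.N)) * P.C + P.C := by omega
          _ = (pop P.n (y * P.N) * P.C + (cost P.n (m 43) (x + y * P.N) + 1)) * P.C := by ring
          _ ≤ (P.n * P.C + P.C) * P.C := by gcongr; omega
          _ = P.T := by unfold Params.T; ring
    rwa [this] at h

/-- The search produced only the outer parts; trying all `N` middle parts is cheap compared with one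
matrix product. The comparison uses the true weights in array `2`. -/
theorem runs_finalProg (hΩ : Ω ≤ Ξ) (hF : Fits P Ω) (hC : Ctx P m)
    (hsum : ∑ p ∈ Finset.range (P.n * P.n), m 2 p ≤ Ξ) {S : Set ℕ} (hS : IsBest P.n P.k (m 2) S m)
    (hl : ∀ y < P.N, m 47 0 + y * P.N ≤ Ω) :
    Runs Ω Ξ ((P.n * P.n + 1) * (P.N + 1)) finalProg m
      (IsBest P.n P.k (m 2) (S ∪ {l | ∃ y < P.N, l = m 47 0 + y * P.N})) := by
  refine Runs.forLoop (c := P.n * P.n + 1) (cnt := P.N) hΩ (by omega) hC.N_eq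
    (by simp [Prog.writes]) (by simp [Prog.writes])
    (by simp) (hF.N_le'.trans (le_lim hΩ _))
    (fun j m' => IsBest P.n P.k (m 2) (S ∪ {l | ∃ y < j, l = m 47 0 + y * P.N}) m')
    ((hS.subset (by rintro l (h | ⟨y, hy, -⟩); exacts [h, absurd hy (by omega)])).congr
      (by simp) (by simp) (by simp)) ?_
  intro j m₁ hj hf hj₁ hI
  have ha : Agree m m₁ := Agree.of_frame (by
    simp [Prog.writes_forLoop, Prog.writes]) hf
  simp only [Prog.writes_forLoop, Prog.writes, writes_considerProg, List.mem_cons,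
    List.mem_append, List.not_mem_nil, not_or, or_false, and_imp] at hf
  have h47 : m₁ 47 0 = m 47 0 := by rw [hf] <;> simp
  have hC₁ := hC.agree ha
  refine Runs.store_seq hΩ (by omega) ?_ ?_
  · refine le_trans ?_ (le_lim hΩ _)
    simp only [Expr.eval_add, Expr.eval_mul, Expr.eval_load, Expr.eval_const, h47, hj₁, hC₁.N_eq]
    exact hl j hj
  simp only [Expr.eval_add, Expr.eval_mul, Expr.eval_load, Expr.eval_const, h47, hj₁, hC₁.N_eq]
  have ha' : Agree m (m₁.set 30 0 (m 47 0 + j * P.N)) := ha.trans (Agree.set (by norm_num) _ _)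
  have h2 : (m₁.set 30 0 (m 47 0 + j * P.N)) 2 = m 2 := ha' 2 (by norm_num) (by norm_num)
  have := runs_considerProg (k := P.k) (S := S ∪ {l | ∃ y < j, l = m 47 0 + y * P.N}) hΩ hF.one_le
    hF.nn_le (hC.agree ha').toBase (by rwa [h2])
    (by rw [h2]; exact hI.congr (by simp) (by simp) (by simp))
  rw [h2] at this
  refine this.mono le_rfl fun m'' _ _ h => ?_
  refine (h.subset ?_).congr (by simp) (by simp) (by simp)
  rintro l (h | ⟨y, hy, rfl⟩)
  · exact Or.inr (Or.inl h)
  · rcases Nat.lt_succ_iff_lt_or_eq.1 hy with h | rfl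
    · exact Or.inr (Or.inr ⟨y, h, rfl⟩)
    · exact Or.inl (by simp)

/-! ### Combining the parts of a mask -/

/-- Binary expansions are concatenated. All later formulas for the bits of parts come from writing a
mask as 2^s·a + b. -/
theorem bit_cat {s a b : ℕ} (hb : b < 2 ^ s) (u : ℕ) :
    bit (2 ^ s * a + b) u = if u < s then bit b u else bit a (u - s) := by
  unfold bit
  rw [← Nat.toNat_testBit, ← Nat.toNat_testBit, ← Nat.toNat_testBit,
    Nat.testBit_two_pow_mul_add a hb]
  split_ifs <;> rfl

theorem bit_zero (u : ℕ) : bit 0 u = 0 := by simp [bit]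

theorem bit_eq_zero {s b u : ℕ} (hb : b < 2 ^ s) (hu : s ≤ u) : bit b u = 0 := by
  unfold bit
  rw [Nat.div_eq_of_lt (hb.trans_le (Nat.pow_le_pow_right two_pos hu))]

theorem bit_whole {s x y : ℕ} (hx : x < 2 ^ s) (hy : y < 2 ^ s) (z u : ℕ) :
    bit (x + y * 2 ^ s + z * (2 ^ s * 2 ^ s)) u =
    if u < s then bit x u else if u - s < s then bit y (u - s) else bit z (u - s - s) := by
  rw [show x + y * 2 ^ s + z * (2 ^ s * 2 ^ s) = 2 ^ s * (2 ^ s * z + y) + x by ring,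
    bit_cat hx, bit_cat hy]

theorem bit_low_mid {s x : ℕ} (hx : x < 2 ^ s) (y u : ℕ) : bit (x + y * 2 ^ s) u =
    if u < s then bit x u else bit y (u - s) := by
  rw [show x + y * 2 ^ s = 2 ^ s * y + x by ring, bit_cat hx]

theorem bit_mid_high {s y : ℕ} (hy : y < 2 ^ s) (z u : ℕ) : bit ((y + z * 2 ^ s) * 2 ^ s) u =
    if u < s then 0 else if u - s < s then bit y (u - s) else bit z (u - s - s) := by
  rw [show (y + z * 2 ^ s) * 2 ^ s = 2 ^ s * (2 ^ s * z + y) + 0 by ring,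
    bit_cat (Nat.two_pow_pos s), bit_cat hy, bit_zero]

theorem bit_low_high {s x : ℕ} (hx : x < 2 ^ s) (z u : ℕ) : bit (x + z * (2 ^ s * 2 ^ s)) u =
    if u < s then bit x u else if u - s < s then 0 else bit z (u - s - s) := by
  rw [show x + z * (2 ^ s * 2 ^ s) = 2 ^ s * (2 ^ s * z + 0) + x by ring,
    bit_cat hx, bit_cat (Nat.two_pow_pos s), bit_zero]

theorem bit_mid (s y u : ℕ) : bit (y * 2 ^ s) u = if u < s then 0 else bit y (u - s) := by
  rw [show y * 2 ^ s = 2 ^ s * y + 0 by ring, bit_cat (Nat.two_pow_pos s), bit_zero]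

theorem pop_whole {s x y : ℕ} (hx : x < 2 ^ s) (hy : y < 2 ^ s) (z n : ℕ) :
    pop n (x + z * (2 ^ s * 2 ^ s)) + pop n (y * 2 ^ s) =
    pop n (x + y * 2 ^ s + z * (2 ^ s * 2 ^ s)) := by
  unfold pop
  rw [← Finset.sum_add_distrib]
  refine Finset.sum_congr rfl fun u _ => ?_
  rw [bit_whole hx hy, bit_low_high hx, bit_mid]
  split_ifs with h1 h2
  · simp
  · simp
  · rw [bit_eq_zero hy (by omega)]; simp

/-- Each arc belongs to exactly one of the three classes, and in its class the partial mask agrees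
with the whole mask at both ends. Arcs inside the middle block are counted in the first class only,
by the factor `1 - tyA`. -/
theorem cost_whole {s x y : ℕ} (hx : x < 2 ^ s) (hy : y < 2 ^ s) (z n : ℕ) (w : ℕ → ℕ) :
    cost n (fun p => w p * tyA n s p) (x + y * 2 ^ s) +
      cost n (fun p => w p * ((1 - tyA n s p) * tyD n s p)) ((y + z * 2 ^ s) * 2 ^ s) +
      cost n (fun p => w p * ((1 - tyA n s p) * (1 - tyD n s p))) (x + z * (2 ^ s * 2 ^ s)) =
    cost n w (x + y * 2 ^ s + z * (2 ^ s * 2 ^ s)) := by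
  unfold cost
  rw [← Finset.sum_add_distrib, ← Finset.sum_add_distrib]
  refine Finset.sum_congr rfl fun p _ => ?_
  beta_reduce
  generalize hu : p / n = u
  generalize hv : p % n = v
  by_cases hA : u < 2 * s ∧ v < 2 * s
  · have e1 : tyA n s p = 1 := by simp [tyA, hu, hv, hA]
    have h : ∀ u < 2 * s, bit (x + y * 2 ^ s) u =
        bit (x + y * 2 ^ s + z * (2 ^ s * 2 ^ s)) u := by
      intro u hu
      rw [bit_whole hx hy, bit_low_mid hx]
      split_ifs <;> first | rfl | omega
    rw [e1, h u hA.1, h v hA.2]; simp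
  · have e1 : tyA n s p = 0 := by
      simp only [tyA, hu, hv]
      rcases not_and_or.1 hA with h | h <;> simp [h]
    by_cases hD : s ≤ u ∧ s ≤ v
    · have e2 : tyD n s p = 1 := by
        simp [tyD, hu, hv, not_lt.2 hD.1, not_lt.2 hD.2]
      have h : ∀ u, s ≤ u → bit ((y + z * 2 ^ s) * 2 ^ s) u =
          bit (x + y * 2 ^ s + z * (2 ^ s * 2 ^ s)) u := by
        intro u hu
        rw [bit_whole hx hy, bit_mid_high hy, if_neg (not_lt.2 hu), if_neg (not_lt.2 hu)]
      rw [e1, e2, h u hD.1, h v hD.2]; simp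
    · have e2 : tyD n s p = 0 := by
        simp only [tyD, hu, hv]
        rcases not_and_or.1 hD with h | h <;> simp [not_le.1 h]
      have h : ∀ u, u < s ∨ 2 * s ≤ u → bit (x + z * (2 ^ s * 2 ^ s)) u =
          bit (x + y * 2 ^ s + z * (2 ^ s * 2 ^ s)) u := by
        intro u hu
        rw [bit_whole hx hy, bit_low_high hx]
        split_ifs <;> first | rfl | omega
      rw [e1, e2, h u (by omega), h v (by omega)]; simp

theorem exists_parts {N l : ℕ} (hl : l < N * N * N) : ∃ x < N, ∃ y < N, ∃ z < N,
    l = x + y * N + z * (N * N) := by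
  have hN : 0 < N := Nat.pos_of_ne_zero fun h => by simp [h] at hl
  refine ⟨l % N, Nat.mod_lt _ hN, l / N % N, Nat.mod_lt _ hN, l / N / N, ?_, ?_⟩
  · rw [Nat.div_div_eq_div_mul]
    exact Nat.div_lt_of_lt_mul (by rwa [mul_assoc] at hl ⊢)
  · have h1 := Nat.div_add_mod l N
    have h2 := Nat.div_add_mod (l / N) N
    calc l = N * (N * (l / N / N) + l / N % N) + l % N := by rw [h2, h1]
      _ = _ := by ring

end RAM

/-! ### Masks that are optimal for a rounding. -/

namespace RAM

theorem cost_congr {n : ℕ} {w w' : ℕ → ℕ} (h : ∀ p < n * n, w p = w' p) (l : ℕ) :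
    cost n w l = cost n w' l :=
  Finset.sum_congr rfl fun p hp => by rw [h p (Finset.mem_range.1 hp)]

theorem Params.N_eq_two_pow (P : Params) : P.N = 2 ^ P.s := by
  unfold Params.N Params.d Params.s; rw [pow_mul]

theorem part_lt {N x y z : ℕ} (hx : x < N) (hy : y < N) (hz : z < N) :
    x + y * N + z * (N * N) < N * N * N := by
  calc _ < N + y * N + z * (N * N) := by omega
    _ = (y + 1) * N + z * (N * N) := by ring
    _ ≤ N * N + z * (N * N) := Nat.add_le_add_right (Nat.mul_le_mul_right _ hy) _
    _ = (z + 1) * (N * N) := by ring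
    _ ≤ N * (N * N) := Nat.mul_le_mul_right _ hz
    _ = _ := by ring

/-- The mask `l` has size `k`, and it is optimal for the weights rounded in units of `θ`. -/
def IsCand (P : Params) (w : ℕ → ℕ) (θ l : ℕ) : Prop :=
  pop P.n l = P.k ∧ ∀ l' < P.N * P.N * P.N, pop P.n l' = P.k →
    cost P.n (fun p => rnd θ (w p * P.Q) P.K) l ≤ cost P.n (fun p => rnd θ (w p * P.Q) P.K) l'

variable {Ω Ξ : ℕ} {m : Mem} {P : Params}

/-- Every mask of size `k` gives a hit with its rounded weight, and every hit comes from such a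
mask. Hence the least hit is the minimum, attained by some middle part. -/
theorem exists_isCand (hex : ∃ l < P.N * P.N * P.N, pop P.n l = P.k) {wA wB wC w : ℕ → ℕ}
    {θ v o : ℕ} {m : Mem} (hv : m 46 0 = v) (ho : m 47 0 = o)
    (hA : ∀ p < P.n * P.n, wA p = rnd θ (w p * P.Q) P.K * tyA P.n P.s p)
    (hB : ∀ p < P.n * P.n, wB p = rnd θ (w p * P.Q) P.K * ((1 - tyA P.n P.s p) * tyD P.n P.s p))
    (hW : ∀ p < P.n * P.n, wC p =
      rnd θ (w p * P.Q) P.K * ((1 - tyA P.n P.s p) * (1 - tyD P.n P.s p)))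
    (hcA : ∀ l, cost P.n wA l < P.C) (hcB : ∀ l, cost P.n wB l < P.C)
    (hcC : ∀ l, cost P.n wC l < P.C) (h : IsLow (3 * P.C) (allHits P wA wB wC) m) :
    (∀ y < P.N, o + y * P.N < P.N * P.N * P.N) ∧ ∃ y < P.N, IsCand P w θ (o + y * P.N) := by
  have hval : ∀ x < P.N, ∀ y < P.N, ∀ z,
      cost P.n wA (x + y * P.N) + cost P.n wB ((y + z * P.N) * P.N) +
        cost P.n wC (x + z * (P.N * P.N)) =
      cost P.n (fun p => rnd θ (w p * P.Q) P.K) (x + y * P.N + z * (P.N * P.N)) := by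
    intro x hx y hy z
    rw [cost_congr hA, cost_congr hB, cost_congr hW]
    rw [P.N_eq_two_pow] at hx hy ⊢
    exact cost_whole hx hy z P.n _
  have hpop : ∀ x < P.N, ∀ y < P.N, ∀ z, pop P.n (x + z * (P.N * P.N)) + pop P.n (y * P.N) =
      pop P.n (x + y * P.N + z * (P.N * P.N)) := by
    intro x hx y hy z
    rw [P.N_eq_two_pow] at hx hy ⊢
    exact pop_whole hx hy z P.n
  have hle : ∀ l' < P.N * P.N * P.N, pop P.n l' = P.k →
      v ≤ cost P.n (fun p => rnd θ (w p * P.Q) P.K) l' ∧ v < 3 * P.C := by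
    intro l' hl' hk
    obtain ⟨x, hx, y, hy, z, hz, rfl⟩ := exists_parts hl'
    have := h.1 (cost P.n (fun p => rnd θ (w p * P.Q) P.K) (x + y * P.N + z * (P.N * P.N)),
      x + z * (P.N * P.N)) ⟨x, hx, y, hy, z, hz, rfl, by rw [hpop x hx y hy, hk],
        (hval x hx y hy z).symm⟩
    rw [hv] at this
    refine ⟨this, this.trans_lt ?_⟩
    have h1 := hval x hx y hy z
    have h2 := hcA (x + y * P.N)
    have h3 := hcB ((y + z * P.N) * P.N)
    have h4 := hcC (x + z * (P.N * P.N))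
    dsimp only
    omega
  obtain ⟨l₀, hl₀, hk₀⟩ := hex
  have hlt := (hle l₀ hl₀ hk₀).2
  -- A mask of size `k` exists, so the sentinel has been replaced by a hit.
  rcases h.2 with h2 | ⟨x, hx, y, hy, z, hz, e1, e2, e3⟩
  · omega
  · simp only [hv, ho] at e1 e2 e3
    rw [e1] at e2 e3
    rw [hval x hx y hy] at e3
    rw [hpop x hx y hy] at e2
    have hswap : ∀ y, o + y * P.N = x + y * P.N + z * (P.N * P.N) := fun y => by omega
    refine ⟨fun y hy => by rw [hswap]; exact part_lt hx hy hz, y, hy, ?_, fun l' hl' hk => ?_⟩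
    · rw [hswap, e2]
    · rw [hswap, ← e3]; exact (hle l' hl' hk).1

/-- The number of cost units for one rounding of the weights. -/
def Params.round (P : Params) : ℕ := (P.n * P.n + 1) * (P.h * P.S + 1) * (P.T + 1)

/-- The set of considered masks only grows, and this round adds at least one minimizer of the
weights rounded in units of `m 2 i`. -/
theorem runs_candBody (hΩ : Ω ≤ Ξ) (hF : Fits P Ω) (hC : Ctx P m) {U V W : ℕ → ℕ → ℤ}
    (hS : Arith.IsScheme P.d P.R P.D U V W) (hD : 0 < P.D) (hn : 1 ≤ P.n)
    (hsum : ∑ p ∈ Finset.range (P.n * P.n), m 2 p ≤ Ξ)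
    (hex : ∃ l < P.N * P.N * P.N, pop P.n l = P.k) {i : ℕ} (hi : m 38 0 = i) {S : Set ℕ}
    (hB : IsBest P.n P.k (m 2) S m) :
    Runs Ω Ξ P.round (.seq roundProg (.seq (solveProg P.d P.R U V W) finalProg)) m fun m' =>
      ∃ S', S ⊆ S' ∧ IsBest P.n P.k (m 2) S' m' ∧ ∃ l ∈ S', IsCand P (m 2) (m 2 i) l := by
  have hnn : 1 ≤ P.n * P.n := Nat.mul_pos hn hn
  have hKC : P.K ≤ P.C := by
    unfold Params.C; exact (Nat.le_mul_of_pos_left _ hnn).trans (Nat.le_succ _)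
  have hCT : P.C ≤ P.T := by
    unfold Params.T
    exact (Nat.le_mul_self _).trans (Nat.le_mul_of_pos_left _ (Nat.succ_pos _))
  have hKΩ : P.K ≤ Ω := (hKC.trans hCT).trans hF.T_le
  have hNS : P.N + 1 ≤ P.h * P.S + 1 := by
    have h1 := Nat.le_mul_self P.N
    have h2 := hF.NN_le_S
    have h3 : P.S ≤ P.h * P.S := Nat.le_mul_of_pos_left _ hF.h_pos
    omega
  refine Runs.seq ((runs_roundProg hΩ hF.nn_le hC.toBase hC.s_eq hC.Q_eq hC.K_eq hi hKΩ).mono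
    ?_ ?_)
  · unfold Params.round
    calc _ ≤ (P.T + 1) * ((P.n * P.n + 1) * (P.h * P.S + 1)) := Nat.mul_le_mul (by omega)
          (Nat.le_mul_of_pos_right _ (Nat.succ_pos _))
      _ = _ := mul_comm _ _
  intro m₁ _ hf₁ hw _
  have hA₁ : Agree m m₁ := Agree.of_frame (by simp) hf₁
  have hC₁ := hC.agree hA₁
  simp only [writes_roundProg, List.mem_cons, List.not_mem_nil, not_or, or_false, and_imp] at hf₁
  have hB₁ : IsBest P.n P.k (m 2) S m₁ := hB.congr (by rw [hf₁] <;> simp) (by rw [hf₁] <;> simp)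
    (by rw [hf₁] <;> simp)
  have hbd : ∀ (g : ℕ → ℕ), (∀ p < P.n * P.n, g p ≤ P.K) →
      ∑ p ∈ Finset.range (P.n * P.n), g p ≤ P.n * P.n * P.K := by
    intro g hg
    calc _ ≤ ∑ p ∈ Finset.range (P.n * P.n), P.K :=
          Finset.sum_le_sum fun p hp => hg p (Finset.mem_range.1 hp)
      _ = _ := by simp
  have htyA : ∀ p, tyA P.n P.s p ≤ 1 := fun p => by unfold tyA; split_ifs <;> simp
  have htyD : ∀ p, tyD P.n P.s p ≤ 1 := fun p => by unfold tyD; split_ifs <;> simp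
  have hmul : ∀ p c, c ≤ 1 → rnd (m 2 i) (m 2 p * P.Q) P.K * c ≤ P.K := fun p c hc =>
    (Nat.mul_le_mul (rnd_le _ _ _) hc).trans (by omega)
  have s43 := hbd (m₁ 43) fun p hp => by rw [(hw p hp).1]; exact hmul p _ (htyA p)
  have s44 := hbd (m₁ 44) fun p hp => by
    rw [(hw p hp).2.1]
    exact hmul p _ ((Nat.mul_le_mul (Nat.sub_le _ _) (htyD p)).trans (by omega))
  have s45 := hbd (m₁ 45) fun p hp => by
    rw [(hw p hp).2.2]
    exact hmul p _ ((Nat.mul_le_mul (Nat.sub_le _ _) (Nat.sub_le _ _)).trans (by omega))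
  refine Runs.seq ((runs_solveProg hΩ hF hC₁ hS hD s43 s44 s45).mono le_rfl ?_)
  intro m₂ _ hf₂ hlow _
  have hA₂ : Agree m m₂ := hA₁.trans (Agree.of_frame (by simp) hf₂)
  have hC₂ := hC.agree hA₂
  have e2 : m₂ 2 = m 2 := hA₂ 2 (by norm_num) (by norm_num)
  have hcost : ∀ g : ℕ → ℕ, ∑ p ∈ Finset.range (P.n * P.n), g p ≤ P.n * P.n * P.K →
      ∀ l, cost P.n g l < P.C := fun g hg l => Nat.lt_succ_of_le ((cost_le _ _ _).trans hg)
  obtain ⟨hl, y, hy, hcand⟩ := exists_isCand hex rfl rfl (fun p hp => (hw p hp).1)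
    (fun p hp => (hw p hp).2.1) (fun p hp => (hw p hp).2.2) (hcost _ s43) (hcost _ s44)
    (hcost _ s45) hlow
  have hB₂ : IsBest P.n P.k (m 2) S m₂ := hB₁.congr (hf₂ 35 (by simp)) (hf₂ 36 (by simp))
    (hf₂ 37 (by simp))
  rw [← e2] at hB₂ hsum
  have := runs_finalProg hΩ hF hC₂ hsum hB₂ fun y hy => (hl y hy).le.trans hF.N_le
  rw [e2] at this
  refine this.mono ?_ fun m₃ _ _ h => ⟨_, Set.subset_union_left, h, _, Or.inr ⟨y, hy, rfl⟩, hcand⟩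
  unfold Params.round
  exact (Nat.mul_le_mul_left _ hNS).trans (Nat.le_mul_of_pos_right _ (Nat.succ_pos _))

theorem runs_candProg (hΩ : Ω ≤ Ξ) (hF : Fits P Ω) (hC : Ctx P m) {U V W : ℕ → ℕ → ℤ}
    (hS : Arith.IsScheme P.d P.R P.D U V W) (hD : 0 < P.D) (hn : 1 ≤ P.n)
    (hsum : ∑ p ∈ Finset.range (P.n * P.n), m 2 p ≤ Ξ)
    (hex : ∃ l < P.N * P.N * P.N, pop P.n l = P.k) (h35 : m 35 0 = 0) :
    Runs Ω Ξ (P.round * (P.n * P.n + 1)) (candProg P.d P.R U V W) m fun m' =>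
      ∃ S, IsBest P.n P.k (m 2) S m' ∧ ∀ i < P.n * P.n, ∃ l ∈ S, IsCand P (m 2) (m 2 i) l := by
  refine Runs.forLoop (cnt := P.n * P.n) hΩ (Nat.mul_pos (Nat.mul_pos (Nat.succ_pos _)
    (Nat.succ_pos _)) (Nat.succ_pos _)) hC.nn_eq (by simp [Prog.writes])
    (by simp [Prog.writes]) (by simp)
    (hF.nn_le.trans (le_lim hΩ _))
    (fun j m' => ∃ S, IsBest P.n P.k (m 2) S m' ∧ ∀ i < j, ∃ l ∈ S, IsCand P (m 2) (m 2 i) l)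
    ⟨∅, Or.inl ⟨by simpa using h35, by simp⟩, by simp⟩ ?_
  rintro j m₁ hj hf hj₁ ⟨S, hB, hI⟩
  have ha : Agree m m₁ := Agree.of_frame (by simp [Prog.writes_forLoop, Prog.writes]) hf
  have e2 : m₁ 2 = m 2 := ha 2 (by norm_num) (by norm_num)
  rw [← e2] at hB hsum
  have := runs_candBody hΩ hF (hC.agree ha) hS hD hn hsum hex hj₁ hB
  rw [e2] at this
  refine this.mono le_rfl ?_
  rintro m₂ _ _ ⟨S', hSS, hB', l, hl, hc⟩
  refine ⟨S', hB'.congr (by simp) (by simp) (by simp), fun i hi => ?_⟩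
  rcases Nat.lt_succ_iff_lt_or_eq.1 hi with h | rfl
  · obtain ⟨l', hl', hc'⟩ := hI i h
    exact ⟨l', hSS hl', hc'⟩
  · exact ⟨l, hl, hc⟩

end RAM

namespace RAM

/-! ### The program -/

/-- Computes the parameters that are needed for evaluating masks, and the number of masks. -/
def baseProg : Prog :=
  .seq (.store 4 (.const 0) (.load 0 (.const 0)))
  (.seq (.store 5 (.const 0) (.load 0 (.const 1)))
  (.seq (.store 6 (.const 0) (.load 0 (.const 2)))
  (.seq (.store 7 (.const 0) (.mul (.var 4) (.var 4)))
  (.seq (powProg 8 4 2)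
    (.store 21 (.const 0) (.load 8 (.var 4)))))))

/-- Computes the tables of powers for a bilinear algorithm. -/
def tableProg (e R D : ℕ) : Prog :=
  .seq (.store 12 (.const 0) (.div (.add (.var 4) (.const (3 * e - 1))) (.const (3 * e))))
  (.seq (powProg 11 12 (2 ^ e)) (.seq (powProg 22 12 R) (powProg 23 12 (D * 2 ^ e))))

/-- Computes the remaining parameters. -/
def scalarProg (e : ℕ) : Prog :=
  .seq (.store 9 (.const 0) (.load 11 (.var 12)))
  (.seq (.store 10 (.const 0) (.mul (.const e) (.var 12)))
  (.seq (.store 13 (.const 0) (.load 22 (.var 12)))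
  (.seq (.store 14 (.const 0) (.add (.load 23 (.var 12)) (.const 1)))
  (.seq (.store 15 (.const 0) (.mul (.var 7) (.var 6)))
  (.seq (.store 16 (.const 0) (.add (.mul (.var 7) (.add (.var 15) (.const 1))) (.const 1)))
  (.seq (.store 17 (.const 0) (.add (.mul (.var 7) (.var 16)) (.const 1)))
  (.seq (.store 18 (.const 0) (.mul (.add (.var 4) (.const 1)) (.mul (.var 17) (.var 17))))
  (.seq (.store 19 (.const 0) (.mul (.var 12) (.var 13)))
    (.store 20 (.const 0) (.mul (.var 9) (.var 9)))))))))))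

/-- The approximation algorithm; if the precision parameter is at least the number of vertex sets,
it tries all of them. -/
def mainProg (e R D : ℕ) (U V W : ℕ → ℕ → ℤ) : Prog :=
  .seq baseProg (.seq (.ite (.lt (.var 6) (.var 21))
    (.seq (tableProg e R D) (.seq (scalarProg e) (candProg (2 ^ e) R U V W))) bruteProg) outProg)

@[simp] theorem writes_baseProg : baseProg.writes = [4, 5, 6, 7, 8, 31, 8, 31, 21] := rfl

@[simp] theorem writes_tableProg (e R D : ℕ) : (tableProg e R D).writes =
    [12, 11, 31, 11, 31, 22, 31, 22, 31, 23, 31, 23, 31] := rfl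

@[simp] theorem writes_scalarProg (e : ℕ) : (scalarProg e).writes =
    [9, 10, 13, 14, 15, 16, 17, 18, 19, 20] := rfl

theorem ok_mainProg (e R D : ℕ) (U V W : ℕ → ℕ → ℤ) : (mainProg e R D U V W).Ok := by
  simp [mainProg, baseProg, tableProg, scalarProg, ok_powProg, ok_candProg, ok_bruteProg,
    ok_outProg, Prog.Ok, Expr.Ok, Expr.Small, Expr.lt, Expr.isZero]

variable {Ω Ξ : ℕ} {m : Mem}

theorem runs_baseProg (hΩ : Ω ≤ Ξ) {n k q : ℕ} (hn : m 0 0 = n) (hk : m 0 1 = k) (hq : m 0 2 = q)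
    (hnn : n * n ≤ Ω) (hkΩ : k ≤ Ω) (hqΩ : q ≤ Ω) (h2 : 2 ^ n ≤ Ω) :
    Runs Ω Ξ (n + 1) baseProg m fun m' => Base n k m' ∧ m' 6 0 = q ∧ m' 21 0 = 2 ^ n := by
  have hnΩ : n ≤ Ω := (Nat.le_mul_self n).trans hnn
  refine Runs.store_seq hΩ (by omega) (le_trans ?_ (le_lim hΩ _)) ?_
  · simpa [hn] using hnΩ
  refine Runs.store_seq hΩ (by omega) (le_trans ?_ (le_lim hΩ _)) ?_
  · simpa [hk] using hkΩ
  refine Runs.store_seq hΩ (by omega) (le_trans ?_ (le_lim hΩ _)) ?_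
  · simpa [hq] using hqΩ
  refine Runs.store_seq hΩ (by omega) (le_trans ?_ (le_lim hΩ _)) ?_
  · simpa [hn] using hnn
  simp only [Expr.eval_const, Expr.eval_load, ne_eq, Nat.reduceEqDiff, not_false_eq_true,
    Mem.set_of_ne, OfNat.zero_ne_ofNat, hn, hk, hq, Expr.eval_mul, Mem.set_self]
  refine Runs.seq ((runs_powProg hΩ (cnt := n) (by norm_num) (by norm_num) (by norm_num)
    (by norm_num) (by simp) hnΩ h2).mono le_rfl ?_)
  intro m₁ _ hf h8 _
  simp only [writes_powProg, List.mem_cons, List.not_mem_nil, not_or, or_false, and_imp] at hf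
  have h4 : m₁ 4 0 = n := by rw [hf] <;> simp
  refine Runs.store hΩ (by omega) (le_trans ?_ (le_lim hΩ _)) ?_
  · simpa [h4, h8 n le_rfl] using h2
  · refine ⟨⟨?_, ?_, ?_, fun u hu => ?_⟩, ?_, ?_⟩
    · simpa using h4
    · rw [Mem.set_of_ne _ (by norm_num), hf] <;> simp
    · rw [Mem.set_of_ne _ (by norm_num), hf] <;> simp
    · rw [Mem.set_of_ne _ (by norm_num), h8 u hu.le]
    · rw [Mem.set_of_ne _ (by norm_num), hf] <;> simp
    · simp [h4, h8 n le_rfl]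

theorem runs_tableProg (hΩ : Ω ≤ Ξ) {P : Params} (hF : Fits P Ω) (hn : m 4 0 = P.n) (hD : 0 < P.D)
    (hh : (P.n + (3 * P.e - 1)) / (3 * P.e) = P.h) :
    Runs Ω Ξ (P.h + 1) (tableProg P.e P.R P.D) m fun m' => m' 12 0 = P.h ∧
      (∀ j ≤ P.h, m' 11 j = P.d ^ j) ∧ m' 22 P.h = P.S ∧ m' 23 P.h + 1 = P.M := by
  refine Runs.store_seq hΩ (by omega) (le_trans ?_ (le_lim hΩ _)) ?_
  · simpa [hn, hh] using hF.h_le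
  simp only [Expr.eval_div, Expr.eval_add, Expr.eval_load, Expr.eval_const, hn, hh]
  refine Runs.seq ((runs_powProg hΩ (cnt := P.h) (by norm_num) (by norm_num) (by norm_num)
    Nat.one_le_two_pow (by simp) hF.h_le hF.N_le').mono le_rfl ?_)
  intro m₁ _ hf₁ h11 _
  simp only [writes_powProg, List.mem_cons, List.not_mem_nil, not_or, or_false, and_imp] at hf₁
  have h12 : m₁ 12 0 = P.h := by rw [hf₁] <;> simp
  refine Runs.seq ((runs_powProg hΩ (cnt := P.h) (by norm_num) (by norm_num) (by norm_num)
    hF.R_pos h12 hF.h_le hF.S_le).mono le_rfl ?_)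
  intro m₂ _ hf₂ h22 _
  simp only [writes_powProg, List.mem_cons, List.not_mem_nil, not_or, or_false, and_imp] at hf₂
  have h12' : m₂ 12 0 = P.h := by rw [hf₂, h12] <;> simp
  refine (runs_powProg hΩ (cnt := P.h) (by norm_num) (by norm_num) (by norm_num)
    (Nat.mul_pos hD (Nat.two_pow_pos _)) h12' hF.h_le
    ((Nat.le_succ _).trans hF.M_le)).mono le_rfl ?_
  intro m₃ _ hf₃ h23
  simp only [writes_powProg, List.mem_cons, List.not_mem_nil, not_or, or_false, and_imp] at hf₃
  refine ⟨by rw [hf₃, h12'] <;> simp, fun j hj => ?_, ?_, ?_⟩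
  · rw [hf₃, hf₂, h11 j hj] <;> first | rfl | simp
  · rw [hf₃, h22 _ le_rfl] <;> first | rfl | simp
  · rw [h23 _ le_rfl]; rfl

theorem runs_scalarProg (hΩ : Ω ≤ Ξ) {P : Params} (hF : Fits P Ω) (hn : 1 ≤ P.n)
    (hb : Base P.n P.k m) (h6 : m 6 0 = P.q) (h12 : m 12 0 = P.h)
    (h11 : ∀ j ≤ P.h, m 11 j = P.d ^ j) (h22 : m 22 P.h = P.S) (h23 : m 23 P.h + 1 = P.M) :
    Runs Ω Ξ 1 (scalarProg P.e) m (Ctx P) := by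
  have hnn : 1 ≤ P.n * P.n := Nat.mul_pos hn hn
  have hCΩ : P.C ≤ Ω := by have := hF.C_le; omega
  have hKC : P.K ≤ P.C := by
    unfold Params.C; exact (Nat.le_mul_of_pos_left _ hnn).trans (Nat.le_succ _)
  have hQK : P.Q ≤ P.K := by
    unfold Params.K
    calc _ ≤ P.Q + 1 := Nat.le_succ _
      _ ≤ P.n * P.n * (P.Q + 1) := Nat.le_mul_of_pos_left _ hnn
      _ ≤ _ := Nat.le_succ _
  have hsN : P.s ≤ P.N := by rw [P.N_eq_two_pow]; exact Nat.lt_two_pow_self.le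
  have hN : m 11 P.h = P.N := h11 _ le_rfl
  have eQ : P.n * P.n * P.q = P.Q := rfl
  have eK : P.n * P.n * (P.Q + 1) + 1 = P.K := rfl
  have eC : P.n * P.n * P.K + 1 = P.C := rfl
  have eT : (P.n + 1) * (P.C * P.C) = P.T := rfl
  have es : P.e * P.h = P.s := rfl
  refine Runs.store_seq hΩ le_rfl (le_trans ?_ (le_lim hΩ _)) ?_
  · simpa [h12, hN] using hF.N_le'
  refine Runs.store_seq hΩ le_rfl (le_trans ?_ (le_lim hΩ _)) ?_
  · simpa [h12, es] using hsN.trans hF.N_le'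
  refine Runs.store_seq hΩ le_rfl (le_trans ?_ (le_lim hΩ _)) ?_
  · simpa [h12, h22] using hF.S_le
  refine Runs.store_seq hΩ le_rfl (le_trans ?_ (le_lim hΩ _)) ?_
  · simpa [h12, h23] using hF.M_le
  simp only [Expr.eval_const, Expr.eval_load, ne_eq, Nat.reduceEqDiff, not_false_eq_true,
    Mem.set_of_ne, Expr.eval_mul, Expr.eval_add, h12, h22, h23, hN, es]
  refine Runs.store_seq hΩ le_rfl (le_trans ?_ (le_lim hΩ _)) ?_
  · simpa [hb.nn_eq, h6, eQ] using (hQK.trans hKC).trans hCΩ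
  refine Runs.store_seq hΩ le_rfl (le_trans ?_ (le_lim hΩ _)) ?_
  · simpa [hb.nn_eq, h6, eQ, eK] using hKC.trans hCΩ
  simp only [Expr.eval_const, Expr.eval_load, ne_eq, Nat.reduceEqDiff, not_false_eq_true,
    Mem.set_of_ne, Mem.set_self, Expr.eval_mul, Expr.eval_add, hb.nn_eq, h6, eQ, eK]
  refine Runs.store_seq hΩ le_rfl (le_trans ?_ (le_lim hΩ _)) ?_
  · simpa [hb.nn_eq, eC] using hCΩ
  refine Runs.store_seq hΩ le_rfl (le_trans ?_ (le_lim hΩ _)) ?_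
  · simpa [hb.nn_eq, hb.n_eq, eC, eT] using hF.T_le
  simp only [Expr.eval_const, Expr.eval_load, ne_eq, Nat.reduceEqDiff, not_false_eq_true,
    Mem.set_of_ne, Mem.set_self, Expr.eval_mul, Expr.eval_add, hb.nn_eq, hb.n_eq, eC, eT]
  refine Runs.store_seq hΩ le_rfl (le_trans ?_ (le_lim hΩ _)) ?_
  · simpa [h12] using hF.hS_le
  refine Runs.store hΩ le_rfl (le_trans ?_ (le_lim hΩ _)) ?_
  · simpa using hF.NN_le
  simp only [Expr.eval_const, Expr.eval_load, ne_eq, Nat.reduceEqDiff, not_false_eq_true,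
    Mem.set_of_ne, Mem.set_self, Expr.eval_mul, h12]
  refine ⟨⟨?_, ?_, ?_, ?_⟩, ?_, ?_, ?_, ?_, ?_, ?_, ?_, ?_, ?_, ?_, ?_, ?_⟩
  · simpa using hb.n_eq
  · simpa using hb.k_eq
  · simpa using hb.nn_eq
  · simpa using hb.pow_eq
  · simp
  · simp
  · simpa using h11
  · simpa using h12
  all_goals simp

/-- The result of an approximation run. -/
def FastResult (P : Params) (w : ℕ → ℕ) (m : Mem) : Prop :=
  ∃ l, pop P.n l = P.k ∧ (∀ i < P.n * P.n, ∃ l', IsCand P w (w i) l' ∧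
    cost P.n w l ≤ cost P.n w l') ∧ ∀ v < P.n, m 3 v = bit l v

/-- The result of an exhaustive search. -/
def BruteResult (n k : ℕ) (w : ℕ → ℕ) (m : Mem) : Prop :=
  ∃ l, pop n l = k ∧ (∀ l' < 2 ^ n, pop n l' = k → cost n w l ≤ cost n w l') ∧
    ∀ v < n, m 3 v = bit l v

theorem runs_mainProg_fast (hΩ : Ω ≤ Ξ) {P : Params} (hF : Fits P Ω) {U V W : ℕ → ℕ → ℤ}
    (hS : Arith.IsScheme P.d P.R P.D U V W) (hD : 0 < P.D) (hn : 1 ≤ P.n)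
    (hsum : ∑ p ∈ Finset.range (P.n * P.n), m 2 p ≤ Ξ) (hkΩ : P.k ≤ Ω) (hqΩ : P.q ≤ Ω)
    (hnΩ : 2 ^ P.n ≤ Ω) (hq : P.q < 2 ^ P.n) (h0 : m 0 0 = P.n) (h1 : m 0 1 = P.k)
    (h2 : m 0 2 = P.q) (hh : (P.n + (3 * P.e - 1)) / (3 * P.e) = P.h)
    (hex : ∃ l < P.N * P.N * P.N, pop P.n l = P.k) (h35 : m 35 0 = 0) :
    Runs Ω Ξ (P.round * (P.n * P.n + 1)) (mainProg P.e P.R P.D U V W) m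
      (FastResult P (m 2)) := by
  have hr : P.h + 1 ≤ P.round := by
    unfold Params.round
    calc _ ≤ P.h * P.S + 1 := Nat.add_le_add_right (Nat.le_mul_of_pos_right _ hF.S_pos) 1
      _ ≤ (P.n * P.n + 1) * (P.h * P.S + 1) := Nat.le_mul_of_pos_left _ (Nat.succ_pos _)
      _ ≤ _ := Nat.le_mul_of_pos_right _ (Nat.succ_pos _)
  have hrh : P.h + 1 ≤ P.round * (P.n * P.n + 1) :=
    hr.trans (Nat.le_mul_of_pos_right _ (Nat.succ_pos _))
  have hrn : P.n + 1 ≤ P.round * (P.n * P.n + 1) :=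
    (Nat.add_le_add_right (Nat.le_mul_self _) 1).trans (Nat.le_mul_of_pos_left _ (by omega))
  refine Runs.seq ((runs_baseProg hΩ h0 h1 h2 hF.nn_le hkΩ hqΩ hnΩ).mono hrn ?_)
  rintro m₁ _ hf₁ ⟨hb₁, h6, h21⟩ _
  simp only [writes_baseProg, List.mem_cons, List.not_mem_nil, not_or, or_false, and_imp] at hf₁
  have e2 : m₁ 2 = m 2 := by rw [hf₁] <;> simp
  have e35 : m₁ 35 = m 35 := by rw [hf₁] <;> simp
  refine Runs.seq ?_
  refine Runs.ite hΩ (by omega) (fun _ => ?_) (fun h => ?_)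
  swap
  -- The exhaustive branch is excluded by `q < 2 ^ n`.
  · simp [h6, h21, hq] at h
  refine Runs.seq ((runs_tableProg hΩ hF hb₁.n_eq hD hh).mono hrh ?_)
  rintro m₂ _ hf₂ ⟨g12, g11, g22, g23⟩ _
  simp only [writes_tableProg, List.mem_cons, List.not_mem_nil, not_or, or_false, and_imp] at hf₂
  have g2 : m₂ 2 = m 2 := by rw [hf₂, e2] <;> simp
  have g6 : m₂ 6 0 = P.q := by rw [hf₂, h6] <;> simp
  have g35 : m₂ 35 = m 35 := by rw [hf₂, e35] <;> simp
  have hb₂ : Base P.n P.k m₂ := ⟨by rw [hf₂, hb₁.n_eq] <;> simp, by rw [hf₂, hb₁.k_eq] <;> simp,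
    by rw [hf₂, hb₁.nn_eq] <;> simp, by rw [hf₂] <;> first | exact hb₁.pow_eq | simp⟩
  refine Runs.seq ((runs_scalarProg hΩ hF hn hb₂ g6 g12 g11 g22 g23).mono (by omega) ?_)
  intro m₃ _ hf₃ hC _
  have i2 : m₃ 2 = m 2 := by rw [hf₃ 2 (by simp), g2]
  have i35 : m₃ 35 0 = 0 := by rw [hf₃ 35 (by simp), g35, h35]
  have := runs_candProg hΩ hF hC hS hD hn (by rwa [i2]) hex i35
  rw [i2] at this
  refine this.mono le_rfl ?_
  rintro m₄ _ hf₄ ⟨S, hB, hcand⟩ _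
  have hC₄ : Ctx P m₄ := hC.agree (Agree.of_frame (by simp) hf₄)
  refine (runs_outProg hΩ hF.one_le hF.n_le hC₄.toBase).mono hrn fun m₅ _ _ hout => ?_
  have hnn : 0 < P.n * P.n := Nat.mul_pos hn hn
  -- The candidate for entry 0 has size `k`, so a best mask has been found.
  rcases hB with ⟨-, hB⟩ | ⟨-, hk, -, hB⟩
  · obtain ⟨l, hl, hc⟩ := hcand 0 hnn
    exact absurd hc.1 (hB l hl)
  · refine ⟨_, hk, fun i hi => ?_, hout⟩
    obtain ⟨l, hl, hc⟩ := hcand i hi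
    exact ⟨l, hc, hB l hl hc.1⟩

theorem runs_mainProg_brute (hΩ : Ω ≤ Ξ) {n k q e R D : ℕ} {U V W : ℕ → ℕ → ℤ}
    (hsum : ∑ p ∈ Finset.range (n * n), m 2 p ≤ Ξ) (hnn : n * n ≤ Ω) (hkΩ : k ≤ Ω) (hqΩ : q ≤ Ω)
    (hnΩ : 2 ^ n ≤ Ω) (hq : 2 ^ n ≤ q) (h0 : m 0 0 = n) (h1 : m 0 1 = k)
    (h2 : m 0 2 = q) (hex : ∃ l < 2 ^ n, pop n l = k) (h35 : m 35 0 = 0) :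
    Runs Ω Ξ ((n * n + 1) * (2 ^ n + 1)) (mainProg e R D U V W) m (BruteResult n k (m 2)) := by
  have hrn : n + 1 ≤ (n * n + 1) * (2 ^ n + 1) :=
    (Nat.add_le_add_right (Nat.le_mul_self _) 1).trans (Nat.le_mul_of_pos_right _ (by omega))
  have hΩ1 : 1 ≤ Ω := Nat.one_le_two_pow.trans hnΩ
  refine Runs.seq ((runs_baseProg hΩ h0 h1 h2 hnn hkΩ hqΩ hnΩ).mono hrn ?_)
  rintro m₁ _ hf₁ ⟨hb₁, h6, h21⟩ _
  simp only [writes_baseProg, List.mem_cons, List.not_mem_nil, not_or, or_false, and_imp] at hf₁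
  have e2 : m₁ 2 = m 2 := by rw [hf₁] <;> simp
  have e35 : m₁ 35 0 = 0 := by rw [hf₁, h35] <;> simp
  refine Runs.seq ?_
  refine Runs.ite hΩ (by omega) (fun h => ?_) (fun _ => ?_)
  · simp [h6, h21] at h; omega
  have := runs_bruteProg hΩ hΩ1 hnn hb₁ (by rwa [e2]) h21 hnΩ e35
  rw [e2] at this
  refine this.mono le_rfl ?_
  rintro m₂ _ hf₂ hB _
  have hb₂ : Base n k m₂ := hb₁.agree (Agree.of_frame (by simp) hf₂)
  refine (runs_outProg hΩ hΩ1 ((Nat.le_mul_self n).trans hnn) hb₂).mono hrn fun m₃ _ _ hout => ?_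
  rcases hB with ⟨-, hB⟩ | ⟨-, hk, -, hB⟩
  · obtain ⟨l, hl, hc⟩ := hex
    exact absurd hc (hB l hl)
  · exact ⟨_, hk, fun l hl hc => hB l hl hc, hout⟩

end RAM

namespace RAM

/-! ### The approximation guarantee -/

/-- The chain is w(l)·Q ≤ r(l)·θ ≤ r(l')·θ ≤ w(l')·Q + n²θ, where r denotes the rounded weights. As
θ is at most w(l'), dividing by n² gives the claim. -/
theorem IsCand.approx {P : Params} {w : ℕ → ℕ} {l l' θ : ℕ} (hn : 1 ≤ P.n)
    (h : IsCand P w θ l) (hl' : l' < P.N * P.N * P.N) (hk : pop P.n l' = P.k)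
    (hθ : ∀ p < P.n * P.n, bit l' (p % P.n) * (1 - bit l' (p / P.n)) ≠ 0 → w p ≤ θ)
    (hθ' : θ ≤ cost P.n w l') : P.q * cost P.n w l ≤ (P.q + 1) * cost P.n w l' := by
  have hnn : 0 < P.n * P.n := Nat.mul_pos hn hn
  have hc1 : ∀ l p, bit l (p % P.n) * (1 - bit l (p / P.n)) ≤ 1 := fun l p =>
    (Nat.mul_le_mul (bit_le _ _) (Nat.sub_le _ _)).trans (by omega)
  set r : ℕ → ℕ := fun p => rnd θ (w p * P.Q) P.K with hr
  have hle : cost P.n r l ≤ cost P.n r l' := h.2 l' hl' hk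
  have h1 : cost P.n r l' ≤ P.n * P.n * (P.Q + 1) := by
    calc _ ≤ ∑ p ∈ Finset.range (P.n * P.n), (P.Q + 1) := by
          refine Finset.sum_le_sum fun p hp => ?_
          by_cases hz : bit l' (p % P.n) * (1 - bit l' (p / P.n)) = 0
          · rw [hz]; omega
          · have hw := hθ p (Finset.mem_range.1 hp) hz
            refine (Nat.mul_le_mul_left _ (hc1 l' p)).trans ?_
            rw [mul_one]
            -- For `θ = 0` one cannot cancel `θ`, but then the arc has weight 0 and so has its
            -- rounding.
            rcases Nat.eq_zero_or_pos θ with h0 | hpos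
            · have : w p = 0 := by omega
              simp [hr, this, rnd_zero_right]
            · refine Nat.le_of_mul_le_mul_right (c := θ) ?_ hpos
              calc _ ≤ w p * P.Q + θ := rnd_mul_le _ _ _
                _ ≤ θ * P.Q + θ := by gcongr
                _ = _ := by ring
      _ = _ := by simp
  -- The cap was chosen one above the bound for `l'`, so the minimizer `l` cuts no arc whose rounded
  -- weight reaches the cap.
  have hK : cost P.n r l < P.K := by unfold Params.K; omega
  have h2 : cost P.n w l * P.Q ≤ cost P.n r l * θ := by
    unfold cost at hK ⊢
    rw [Finset.sum_mul, Finset.sum_mul]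
    refine Finset.sum_le_sum fun p hp => ?_
    by_cases hz : bit l (p % P.n) * (1 - bit l (p / P.n)) = 0
    · rw [hz]; simp
    · have e1 : bit l (p % P.n) * (1 - bit l (p / P.n)) = 1 := by
        have := hc1 l p; omega
      have hlt := (Finset.single_le_sum
        (f := fun p => r p * (bit l (p % P.n) * (1 - bit l (p / P.n))))
        (fun _ _ => Nat.zero_le _) hp).trans_lt hK
      simp only [e1, mul_one] at hlt ⊢
      exact le_rnd_mul hlt
  -- Each of the at most n² arcs loses at most one unit `θ` by rounding.
  have h3 : cost P.n r l' * θ ≤ cost P.n w l' * P.Q + P.n * P.n * θ := by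
    calc _ ≤ ∑ p ∈ Finset.range (P.n * P.n),
          (w p * (bit l' (p % P.n) * (1 - bit l' (p / P.n))) * P.Q + θ) := by
          unfold cost
          rw [Finset.sum_mul]
          refine Finset.sum_le_sum fun p hp => ?_
          have := rnd_mul_le θ (w p * P.Q) P.K
          have hc := hc1 l' p
          interval_cases hb : bit l' (p % P.n) * (1 - bit l' (p / P.n))
          · simp
          · simpa using this
      _ = _ := by
          unfold cost
          rw [Finset.sum_add_distrib, Finset.sum_mul]; simp
  have h4 : P.n * P.n * (P.q * cost P.n w l) ≤ P.n * P.n * ((P.q + 1) * cost P.n w l') := by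
    calc _ = cost P.n w l * P.Q := by unfold Params.Q; ring
      _ ≤ cost P.n r l' * θ := h2.trans (Nat.mul_le_mul_right _ hle)
      _ ≤ cost P.n w l' * P.Q + P.n * P.n * cost P.n w l' :=
        h3.trans (Nat.add_le_add_left (Nat.mul_le_mul_left _ hθ') _)
      _ = _ := by unfold Params.Q; ring
  exact Nat.le_of_mul_le_mul_left h4 hnn

/-- This is the guess that works for the mask `l`: the heaviest arc of its cut, which is at most the
weight of the whole cut. -/
theorem exists_max_weight {n : ℕ} (hn : 1 ≤ n) {w : ℕ → ℕ} (hw : w 0 = 0) (l : ℕ) :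
    ∃ i < n * n, (∀ p < n * n, bit l (p % n) * (1 - bit l (p / n)) ≠ 0 → w p ≤ w i) ∧
      w i ≤ cost n w l := by
  have hnn : 0 < n * n := Nat.mul_pos hn hn
  set c : ℕ → ℕ := fun p => bit l (p % n) * (1 - bit l (p / n)) with hc
  obtain ⟨i, hi, hmax⟩ := Finset.exists_max_image (Finset.range (n * n)) (fun p => w p * c p)
    ⟨0, Finset.mem_range.2 hnn⟩
  have hc1 : ∀ p, c p ≤ 1 := fun p =>
    (Nat.mul_le_mul (bit_le _ _) (Nat.sub_le _ _)).trans (by omega)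
  have key : ∀ p < n * n, c p ≠ 0 → w p ≤ w i * c i := fun p hp h0 => by
    have h1 : c p = 1 := by have := hc1 p; omega
    have := hmax p (Finset.mem_range.2 hp)
    rwa [h1, mul_one] at this
  -- If the maximum is attained outside the cut, all cut weights vanish, and entry 0, of weight 0,
  -- serves as the guess.
  by_cases h0 : c i = 0
  · refine ⟨0, hnn, fun p hp h => ?_, by rw [hw]; exact Nat.zero_le _⟩
    have := key p hp h
    rw [h0] at this
    omega
  · have h1 : c i = 1 := by have := hc1 i; omega
    rw [h1, mul_one] at key
    refine ⟨i, Finset.mem_range.1 hi, key, ?_⟩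
    have := Finset.single_le_sum (f := fun p => w p * c p) (fun _ _ => Nat.zero_le _) hi
    rwa [h1, mul_one] at this

theorem FastResult.approx {P : Params} {w : ℕ → ℕ} {m : Mem} (hn : 1 ≤ P.n) (hw : w 0 = 0)
    (hN : 2 ^ P.n ≤ P.N * P.N * P.N) (h : FastResult P w m) :
    ∃ l, pop P.n l = P.k ∧ (∀ l' < 2 ^ P.n, pop P.n l' = P.k →
      P.q * cost P.n w l ≤ (P.q + 1) * cost P.n w l') ∧ ∀ v < P.n, m 3 v = bit l v := by
  obtain ⟨l, hk, hl, hout⟩ := h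
  refine ⟨l, hk, fun l' hl' hk' => ?_, hout⟩
  obtain ⟨i, hi, h1, h2⟩ := exists_max_weight hn hw l'
  obtain ⟨l'', hc, hle⟩ := hl i hi
  exact (Nat.mul_le_mul_left _ hle).trans (hc.approx hn (hl'.trans_le hN) hk' h1 h2)

/-! ### Vertex sets and masks -/

theorem exists_mask {n : ℕ} (S : Finset (Fin n)) :
    ∃ l < 2 ^ n, ∀ v : Fin n, v ∈ S ↔ bit l v ≠ 0 := by
  refine ⟨Nat.ofBits fun v : Fin n => decide (v ∈ S), Nat.ofBits_lt_two_pow _, fun v => ?_⟩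
  unfold bit
  rw [← Nat.toNat_testBit, Nat.testBit_ofBits_lt _ _ v.2]
  simp

theorem card_eq_pop {n l : ℕ} {S : Finset (Fin n)} (h : ∀ v : Fin n, v ∈ S ↔ bit l v ≠ 0) :
    S.card = pop n l := by
  unfold pop
  rw [Finset.sum_range, ← Finset.filter_univ_mem S, Finset.card_filter]
  refine Finset.sum_congr rfl fun v _ => ?_
  have h1 := bit_le l v
  have h2 := h v
  split_ifs with hv
  · have := h2.1 hv; omega
  · have := mt h2.2 hv; omega

variable {n : ℕ} (G : ArcWeightedDigraph n)

theorem sum_encode (k q : ℕ) (g : ℕ → ℕ) :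
    ∑ p ∈ Finset.range (n * n), G.encode k q 2 p * g p =
      ∑ e : G.arcs, G.weight e * g (e.1.1.val * n + e.1.2.val) := by
  have hlt : ∀ u v : Fin n, u.val * n + v.val < n * n := by
    intro u v
    calc _ < u.val * n + n := by omega
      _ = (u.val + 1) * n := by ring
      _ ≤ _ := Nat.mul_le_mul_right _ u.2
  simp only [ArcWeightedDigraph.encode, Finset.sum_mul]
  rw [Finset.sum_comm]
  refine Finset.sum_congr rfl fun e _ => ?_
  rw [Finset.sum_eq_single_of_mem _ (Finset.mem_range.2 (hlt e.1.1 e.1.2))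
    fun p _ hp => by rw [if_neg hp, zero_mul], if_pos rfl]

theorem cutWeight_eq_cost (k q : ℕ) {l : ℕ} {S : Finset (Fin n)}
    (h : ∀ v : Fin n, v ∈ S ↔ bit l v ≠ 0) : G.cutWeight S = cost n (G.encode k q 2) l := by
  unfold cost ArcWeightedDigraph.cutWeight
  rw [sum_encode]
  refine Finset.sum_congr rfl fun e _ => ?_
  have hn : 0 < n := e.1.1.pos
  have e1 : (e.1.1.val * n + e.1.2.val) % n = e.1.2.val := by
    rw [mul_comm, Nat.mul_add_mod, Nat.mod_eq_of_lt e.1.2.2]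
  have e2 : (e.1.1.val * n + e.1.2.val) / n = e.1.1.val := by
    rw [mul_comm, Nat.mul_add_div hn, Nat.div_eq_of_lt e.1.2.2, add_zero]
  simp only [e1, e2, h]
  have h1 := bit_le l e.1.1
  have h2 := bit_le l e.1.2
  interval_cases bit l e.1.1 <;> interval_cases bit l e.1.2 <;> simp

theorem encode_le_sum (k q p : ℕ) : G.encode k q 2 p ≤ ∑ e, G.weight e :=
  Finset.sum_le_sum fun e _ => by split_ifs <;> simp

theorem sum_weight_le : ∑ e, G.weight e ≤ n * n * G.wMax := by
  calc _ ≤ ∑ _e : G.arcs, G.wMax := Finset.sum_le_sum fun e _ => Finset.le_sup (Finset.mem_univ e)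
    _ = G.arcs.card * G.wMax := by simp
    _ ≤ _ := by
      gcongr
      simpa using G.arcs.card_le_univ

/-- Cell 0 belongs to the pair (0, 0), which is a loop and hence no arc. So 0 always occurs among
the guesses. -/
theorem encode_zero (k q : ℕ) : G.encode k q 2 0 = 0 := by
  refine Finset.sum_eq_zero fun e _ => if_neg fun h => ?_
  have hn : 0 < n := e.1.1.pos
  have h1 : e.1.1.val * n = 0 := by omega
  have h2 : e.1.2.val = 0 := by omega
  have h3 : e.1.1.val = 0 := by
    rcases Nat.mul_eq_zero.1 h1 with h | h <;> omega
  have : e.1.1 = e.1.2 := Fin.ext (h3.trans h2.symm)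
  refine G.loopless e.1.1 ?_
  have he := e.2
  rwa [show e.1 = (e.1.1, e.1.1) from Prod.ext rfl this.symm] at he

theorem bdd_encode {Ω k q : ℕ} (hk : k ≤ n) (hn : n * n ≤ Ω) (hq : q ≤ Ω) (hW : 1 ≤ G.wMax) :
    Bdd Ω (Ω * G.wMax) (G.encode k q) := by
  have hΩ : Ω ≤ Ω * G.wMax := Nat.le_mul_of_pos_right _ hW
  have hn' := (Nat.le_mul_self n).trans hn
  intro a i
  match a with
  | 0 =>
    refine le_trans ?_ (le_lim hΩ _)
    match i with
    | 0 => exact hn'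
    | 1 => exact hk.trans hn'
    | 2 => exact hq
    | i + 3 => exact Nat.zero_le _
  | 1 =>
    refine le_trans ?_ (le_lim hΩ _)
    calc _ ≤ ∑ _e : G.arcs, 1 := Finset.sum_le_sum fun e _ => by split_ifs <;> simp
      _ ≤ n * n := by simpa using G.arcs.card_le_univ
      _ ≤ Ω := hn
  | 2 =>
    have : lim Ω (Ω * G.wMax) 2 = Ω * G.wMax := by simp [lim]
    rw [this]
    exact (encode_le_sum G k q i).trans ((sum_weight_le G).trans (Nat.mul_le_mul_right _ hn))
  | a + 3 => exact Nat.zero_le _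

/-- From q·x ≤ (q + 1)·y and 1 ≤ εq one gets q·x ≤ q(1 + ε)·y, and `q` is positive. -/
theorem isApproxMinCut {k q : ℕ} {ε : ℝ} {m : Mem} (hε : 1 ≤ ε * q) {l : ℕ} (hk : pop n l = k)
    (hl : ∀ l' < 2 ^ n, pop n l' = k →
      q * cost n (G.encode k q 2) l ≤ (q + 1) * cost n (G.encode k q 2) l')
    (hout : ∀ v < n, m 3 v = bit l v) :
    G.IsApproxMinCut k ε (ArcWeightedDigraph.output n m) := by
  have hmem : ∀ v : Fin n, v ∈ ArcWeightedDigraph.output n m ↔ bit l v ≠ 0 := fun v => by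
    simp [ArcWeightedDigraph.output, hout v v.2]
  refine ⟨(card_eq_pop hmem).trans hk, fun S hS => ?_⟩
  obtain ⟨l', hl', hS'⟩ := exists_mask S
  rw [cutWeight_eq_cost G k q hmem, cutWeight_eq_cost G k q hS']
  have h := hl l' hl' ((card_eq_pop hS').symm.trans hS)
  set x := cost n (G.encode k q 2) l
  set y := cost n (G.encode k q 2) l'
  have h' : (q : ℝ) * x ≤ (q + 1) * y := by exact_mod_cast h
  have hq : (0 : ℝ) < q := by
    rcases Nat.eq_zero_or_pos q with rfl | h
    · norm_num at hε
    · exact_mod_cast h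
  have hy : (0 : ℝ) ≤ y := Nat.cast_nonneg _
  refine le_of_mul_le_mul_left ?_ hq
  nlinarith

end RAM

namespace RAM

/-! ### The running time -/

theorem exists_pow_le (j : ℕ) {r : ℝ} (hr : 1 < r) :
    ∃ C : ℝ, 0 ≤ C ∧ ∀ n : ℕ, (n : ℝ) ^ j ≤ C * r ^ n := by
  obtain ⟨C, hC⟩ := (tendsto_pow_const_div_const_pow_of_one_lt j hr).bddAbove_range
  refine ⟨max C 0, le_max_right _ _, fun n => ?_⟩
  have hpos : 0 < r ^ n := pow_pos (by linarith) n
  rw [← div_le_iff₀ hpos]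
  exact (hC ⟨n, rfl⟩).trans (le_max_left _ _)

theorem two_pow_le_of_lt_len {x j : ℕ} (h : j + 1 < len x) : 2 ^ j ≤ x :=
  Nat.lt_size.1 (by unfold len at h; omega)

theorem two_pow_len_le {x : ℕ} (hx : 1 ≤ x) : 2 ^ len x ≤ 4 * x := by
  have h1 : 1 ≤ Nat.size x := Nat.size_pos.2 hx
  have h := two_pow_le_of_lt_len (x := x) (j := Nat.size x - 1) (by unfold len; omega)
  calc 2 ^ len x = 2 ^ (Nat.size x - 1) * 4 := by
        rw [show len x = Nat.size x - 1 + 2 by unfold len; omega, pow_add]; norm_num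
    _ ≤ x * 4 := Nat.mul_le_mul_right _ h
    _ = _ := mul_comm _ _

theorem lt_len_of_two_pow_le {x j : ℕ} (h : 2 ^ j ≤ x) : j < len x :=
  (Nat.lt_size.2 h).trans (Nat.lt_succ_self _)

theorem len_pow_le (b n : ℕ) : len (b ^ n) ≤ n * len b + 2 := by
  induction n with
  | zero => simp [len]
  | succ n ih =>
    rw [pow_succ, add_mul]
    have := len_mul_le (b ^ n) b
    omega

/-- The length is the integer part of the binary logarithm plus 2. As log 2 ≥ 1/2, the first is at
most 2 log W, and 2 ≤ 4 log W because W ≥ 2. -/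
theorem len_le_log {W : ℕ} (hW : 2 ≤ W) : (len W : ℝ) ≤ 6 * Real.log W := by
  have h2 : 1 ≤ Nat.size W := Nat.size_pos.2 (by omega)
  have h := two_pow_le_of_lt_len (x := W) (j := Nat.size W - 1) (by unfold len; omega)
  have hl2 : (1 / 2 : ℝ) ≤ Real.log 2 := by linarith [Real.log_two_gt_d9]
  have h3 : ((Nat.size W - 1 : ℕ) : ℝ) * Real.log 2 ≤ Real.log W := by
    rw [← Real.log_pow]
    exact Real.log_le_log (by positivity) (by exact_mod_cast h)
  have h4 : Real.log 2 ≤ Real.log W := Real.log_le_log (by norm_num) (by exact_mod_cast hW)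
  have h5 : (len W : ℝ) = ((Nat.size W - 1 : ℕ) : ℝ) + 2 := by
    rw [show len W = Nat.size W - 1 + 2 by unfold len; omega]; push_cast; ring
  have h6 : (0 : ℝ) ≤ ((Nat.size W - 1 : ℕ) : ℝ) := Nat.cast_nonneg _
  rw [h5]
  nlinarith

/-- The time of the exhaustive search, up to a constant factor. -/
theorem brute_units_le {n q W : ℕ} (hq : 2 ^ n ≤ q) :
    len (n * n * q) * len (n * n * q * W) * ((n * n + 1) * (2 ^ n + 1)) ≤
      48 * (len q ^ 4 * len W * q) := by
  set L := len q with hL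
  set w := len W with hw
  have hL1 : 1 ≤ L := one_le_len q
  have hw1 : 1 ≤ w := one_le_len W
  have hnL : n ≤ L := (lt_len_of_two_pow_le hq).le
  have hnq : len n ≤ L := len_mono (Nat.lt_two_pow_self.le.trans hq)
  have h1 : len (n * n * q) ≤ 3 * L := by
    have e1 := len_mul_le (n * n) q
    have e2 := len_mul_le n n
    omega
  have h2 : len (n * n * q * W) ≤ 4 * (L * w) := by
    have e1 := len_mul_le (n * n * q) W
    nlinarith
  have h3 : n * n + 1 ≤ 2 * (L * L) := by nlinarith
  have h4 : 2 ^ n + 1 ≤ 2 * q := by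
    have := Nat.one_le_two_pow (n := n); omega
  -- Both `n` and `len n` are at most `len q`, because 2^n ≤ q. All polynomial factors thus become
  -- powers of `len q`.
  calc _ ≤ 3 * L * (4 * (L * w)) * (2 * (L * L) * (2 * q)) :=
        Nat.mul_le_mul (Nat.mul_le_mul h1 h2) (Nat.mul_le_mul h3 h4)
    _ = _ := by ring

theorem Params.C_le {P : Params} (hn : 1 ≤ P.n) (hq : 1 ≤ P.q) : P.C ≤ 4 * (P.n ^ 6 * P.q) := by
  have h1 : 1 ≤ P.n ^ 2 := Nat.pow_pos hn
  have h4 : P.n ^ 2 ≤ P.n ^ 4 * P.q := (Nat.pow_le_pow_right hn (by norm_num)).trans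
    (Nat.le_mul_of_pos_right _ hq)
  have hK : P.K ≤ 3 * (P.n ^ 4 * P.q) := by
    calc P.K = P.n ^ 4 * P.q + P.n ^ 2 + 1 := by unfold Params.K Params.Q; ring
      _ ≤ _ := by omega
  have h6 : 1 ≤ P.n ^ 6 * P.q := Nat.mul_pos (Nat.pow_pos hn) hq
  calc P.C = P.n * P.n * P.K + 1 := rfl
    _ ≤ P.n * P.n * (3 * (P.n ^ 4 * P.q)) + P.n ^ 6 * P.q := by gcongr
    _ = _ := by ring

theorem Params.T_le {P : Params} (hn : 1 ≤ P.n) (hq : 1 ≤ P.q) :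
    P.T ≤ 32 * (P.n ^ 13 * P.q ^ 2) := by
  calc P.T = (P.n + 1) * (P.C * P.C) := rfl
    _ ≤ (2 * P.n) * (4 * (P.n ^ 6 * P.q) * (4 * (P.n ^ 6 * P.q))) :=
      Nat.mul_le_mul (by omega) (Nat.mul_le_mul (P.C_le hn hq) (P.C_le hn hq))
    _ = _ := by ring

/-- The base of an exponential bound on the numbers. -/
def Params.base (P : Params) : ℕ := 2 ^ 20 * P.R * (P.D * P.d) * P.d ^ 3

/-- The factors of `Params.base` cover the layers (`R`), the modulus (`D d`), the masks (`d ^ 3`)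
and the counters (`2 ^ 20`). The exponent 20 comes from `T_le` with n ≤ 2^n and q ≤ 2^n, which give
5 + 15n ≤ 20n. -/
theorem fits_base {P : Params} (hn : 1 ≤ P.n) (hq : 1 ≤ P.q) (hqn : P.q ≤ 2 ^ P.n) (hD : 0 < P.D)
    (hR : P.d ^ 2 ≤ P.R) (h1 : 1 ≤ P.h) (hh : P.h ≤ P.n) : Fits P (P.base ^ P.n) := by
  have hd : 0 < P.d := Params.d_pos
  have hR0 : 0 < P.R := (Nat.pow_pos hd).trans_le hR
  have hDd : 0 < P.D * P.d := Nat.mul_pos hD hd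
  have hd3 : 0 < P.d ^ 3 := Nat.pow_pos hd
  have hb : ∀ {x b : ℕ}, x ≤ b ^ P.n → b ≤ P.base → x ≤ P.base ^ P.n := fun hx hb =>
    hx.trans (Nat.pow_le_pow_left hb _)
  have b1 : 2 ^ 20 * P.R ≤ P.base := by
    unfold Params.base; rw [mul_assoc]; exact Nat.le_mul_of_pos_right _ (Nat.mul_pos hDd hd3)
  have b2 : 2 * (P.D * P.d) ≤ P.base := by
    unfold Params.base
    calc _ ≤ 2 ^ 20 * P.R * (P.D * P.d) := Nat.mul_le_mul_right _ (by omega)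
      _ ≤ _ := Nat.le_mul_of_pos_right _ hd3
  have b3 : P.d ^ 3 ≤ P.base := by
    unfold Params.base
    exact Nat.le_mul_of_pos_left _ (Nat.mul_pos (by omega) hDd)
  have b0 : 2 ^ 20 ≤ P.base := (Nat.le_mul_of_pos_right _ hR0).trans b1
  have hn2 : P.n ≤ 2 ^ P.n := Nat.lt_two_pow_self.le
  have hnj : ∀ j, P.n ^ j ≤ 2 ^ (P.n * j) := fun j => by
    rw [pow_mul]; exact Nat.pow_le_pow_left hn2 j
  refine ⟨hb hn2 (by omega), hb (b := 2 ^ 2) ?_ (by omega), hb (b := 2 * P.R) ?_ (by omega),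
    hb ?_ b2,
    hb ?_ b3, hb (b := 2 ^ 20) ?_ b0, hb (b := 2 ^ 20) ?_ b0, h1, hR⟩
  · calc _ = P.n ^ 2 := (sq _).symm
      _ ≤ 2 ^ (P.n * 2) := hnj 2
      _ = _ := by rw [mul_comm, pow_mul]
  · calc P.h * P.R ^ P.h ≤ 2 ^ P.n * P.R ^ P.n :=
          Nat.mul_le_mul (hh.trans hn2) (Nat.pow_le_pow_right hR0 hh)
      _ = _ := (mul_pow _ _ _).symm
  · calc (P.D * P.d) ^ P.h + 1 ≤ (P.D * P.d) ^ P.n + (P.D * P.d) ^ P.n :=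
          Nat.add_le_add (Nat.pow_le_pow_right hDd hh) (Nat.pow_pos hDd)
      _ = 2 * (P.D * P.d) ^ P.n := (two_mul _).symm
      _ ≤ 2 ^ P.n * (P.D * P.d) ^ P.n := Nat.mul_le_mul_right _ (Nat.le_self_pow (by omega) 2)
      _ = _ := (mul_pow _ _ _).symm
  · calc P.d ^ P.h * P.d ^ P.h * P.d ^ P.h = (P.d ^ 3) ^ P.h := by ring
      _ ≤ _ := Nat.pow_le_pow_right hd3 hh
  · calc 4 * P.C ≤ 4 * (4 * (P.n ^ 6 * P.q)) := Nat.mul_le_mul_left _ (P.C_le hn hq)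
      _ ≤ 4 * (4 * (2 ^ (P.n * 6) * 2 ^ P.n)) :=
        Nat.mul_le_mul_left _ (Nat.mul_le_mul_left _ (Nat.mul_le_mul (hnj 6) hqn))
      _ = 2 ^ (4 + (P.n * 6 + P.n)) := by rw [pow_add, pow_add]; ring
      _ ≤ 2 ^ (20 * P.n) := Nat.pow_le_pow_right two_pos (by omega)
      _ = _ := pow_mul _ _ _
  · calc P.T ≤ 32 * (P.n ^ 13 * P.q ^ 2) := P.T_le hn hq
      _ ≤ 32 * (2 ^ (P.n * 13) * (2 ^ P.n) ^ 2) :=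
        Nat.mul_le_mul_left _ (Nat.mul_le_mul (hnj 13) (Nat.pow_le_pow_left hqn 2))
      _ = 2 ^ (5 + (P.n * 13 + P.n * 2)) := by rw [pow_add, pow_add, pow_mul 2 P.n 2]; ring
      _ ≤ 2 ^ (20 * P.n) := Nat.pow_le_pow_right two_pos (by omega)
      _ = _ := pow_mul _ _ _

/-- The time of the approximation, up to a constant factor. -/
theorem fast_units_le {P : Params} {W : ℕ} (hn : 1 ≤ P.n) (hq : 1 ≤ P.q) (hh : P.h ≤ P.n)
    (hR : 1 ≤ P.R) :
    len (P.base ^ P.n) * len (P.base ^ P.n * W) * (P.round * (P.n * P.n + 1)) ≤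
      528 * (len P.base + 2) ^ 2 * (P.n ^ 20 * P.R ^ P.h * len W * P.q ^ 2) := by
  set β := len P.base + 2 with hβ
  set w := len W with hw
  have hw1 : 1 ≤ w := one_le_len W
  have hβn : len (P.base ^ P.n) ≤ β * P.n := by
    have := len_pow_le P.base P.n
    rw [hβ]; nlinarith
  have hβn1 : 1 ≤ β * P.n := Nat.mul_pos (by omega) hn
  have h2 : len (P.base ^ P.n * W) ≤ 2 * (β * P.n * w) := by
    have := len_mul_le (P.base ^ P.n) W
    nlinarith
  have h3 : P.n * P.n + 1 ≤ 2 * (P.n * P.n) := by nlinarith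
  have h4 : P.h * P.S + 1 ≤ 2 * (P.n * P.R ^ P.h) := by
    have e1 : 1 ≤ P.R ^ P.h := Nat.pow_pos hR
    have e2 : P.h * P.S ≤ P.n * P.R ^ P.h := Nat.mul_le_mul_right _ hh
    have e3 : 1 ≤ P.n * P.R ^ P.h := Nat.mul_pos hn e1
    omega
  have h5 : P.T + 1 ≤ 33 * (P.n ^ 13 * P.q ^ 2) := by
    have e1 := P.T_le hn hq
    have e2 : 1 ≤ P.n ^ 13 * P.q ^ 2 := Nat.mul_pos (Nat.pow_pos hn) (Nat.pow_pos hq)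
    omega
  unfold Params.round
  -- The factors bound, in order, the two bit lengths, the evaluation of a mask, one matrix product,
  -- the number of codes, and the number of roundings.
  calc _ ≤ β * P.n * (2 * (β * P.n * w)) * (2 * (P.n * P.n) * (2 * (P.n * P.R ^ P.h)) *
        (33 * (P.n ^ 13 * P.q ^ 2)) * (2 * (P.n * P.n))) :=
        Nat.mul_le_mul (Nat.mul_le_mul hβn h2)
          (Nat.mul_le_mul (Nat.mul_le_mul (Nat.mul_le_mul h3 h4) h5) h3)
    _ = _ := by ring

/-- The fourth power of `len q` is O(2^(len q)) = O(q), so the search, which costs `q` up to such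
factors, stays below `q ^ 2`. -/
theorem exists_brute_bound : ∃ C : ℝ, 0 ≤ C ∧ ∀ n q W : ℕ, 2 ^ n ≤ q → 2 ≤ W →
    ((len (n * n * q) * len (n * n * q * W) * ((n * n + 1) * (2 ^ n + 1)) : ℕ) : ℝ) ≤
      C * (Real.log W * (q : ℝ) ^ 2) := by
  obtain ⟨C, hC, h⟩ := exists_pow_le 4 one_lt_two
  refine ⟨48 * (C * 4) * 6, by positivity, fun n q W hq hW => ?_⟩
  have hq1 : 1 ≤ q := Nat.one_le_two_pow.trans hq
  have h1 : (len q : ℝ) ^ 4 ≤ C * (4 * q) :=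
    (h (len q)).trans (mul_le_mul_of_nonneg_left (by exact_mod_cast two_pow_len_le hq1) hC)
  have h2 := len_le_log hW
  have h3 : (0 : ℝ) ≤ Real.log W := Real.log_natCast_nonneg W
  calc _ ≤ ((48 * (len q ^ 4 * len W * q) : ℕ) : ℝ) := by exact_mod_cast brute_units_le hq
    _ = 48 * ((len q : ℝ) ^ 4 * len W * q) := by push_cast; ring
    _ ≤ 48 * (C * (4 * q) * (6 * Real.log W) * q) := by gcongr
    _ = _ := by ring

/-- The recursion has R^h ≤ 2^(σeh) leaves, and 3eh exceeds n by at most the constant 3e. The factor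
n^20 is absorbed by r^n with r = 2^((τ - σ)/3), which turns σ into τ. -/
theorem exists_fast_bound {e R D : ℕ} {τ σ : ℝ} (hστ : σ < τ) (hσ : 0 ≤ σ) (hR1 : 1 ≤ R)
    (hR : (R : ℝ) ≤ (2 : ℝ) ^ (σ * e)) :
    ∃ C : ℝ, 0 ≤ C ∧ ∀ n k q h W : ℕ, 1 ≤ n → 1 ≤ q → h ≤ n → 3 * e * h ≤ n + 3 * e →
      2 ≤ W → ((len ((⟨n, k, q, e, R, D, h⟩ : Params).base ^ n) *
        len ((⟨n, k, q, e, R, D, h⟩ : Params).base ^ n * W) *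
        ((⟨n, k, q, e, R, D, h⟩ : Params).round * (n * n + 1)) : ℕ) : ℝ) ≤
      C * ((2 : ℝ) ^ (τ * n / 3) * Real.log W * (q : ℝ) ^ 2) := by
  set r : ℝ := (2 : ℝ) ^ ((τ - σ) / 3) with hr
  obtain ⟨C, hC, hpoly⟩ := exists_pow_le 20 (r := r)
    (Real.one_lt_rpow one_lt_two (by linarith))
  set β : ℕ := len (2 ^ 20 * R * (D * 2 ^ e) * (2 ^ e) ^ 3) + 2 with hβ
  refine ⟨528 * (β : ℝ) ^ 2 * (C * (2 : ℝ) ^ (σ * e) * 6), by positivity,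
    fun n k q h W hn hq hh hle hW => ?_⟩
  have hRh : (R : ℝ) ^ h ≤ (2 : ℝ) ^ (σ * e) * (2 : ℝ) ^ (σ * n / 3) := by
    calc _ ≤ ((2 : ℝ) ^ (σ * e)) ^ h := pow_le_pow_left₀ (Nat.cast_nonneg _) hR h
      _ = (2 : ℝ) ^ (σ * e * h) := by rw [← Real.rpow_natCast, ← Real.rpow_mul (by norm_num)]
      _ ≤ (2 : ℝ) ^ (σ * e + σ * n / 3) := by
        refine Real.rpow_le_rpow_of_exponent_le one_le_two ?_
        have : (3 * e * h : ℝ) ≤ n + 3 * e := by exact_mod_cast hle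
        nlinarith
      _ = _ := Real.rpow_add two_pos _ _
  have hlog := len_le_log hW
  have hpow : r ^ n * (2 : ℝ) ^ (σ * n / 3) = (2 : ℝ) ^ (τ * n / 3) := by
    rw [hr, ← Real.rpow_natCast, ← Real.rpow_mul (by norm_num), ← Real.rpow_add two_pos]
    congr 1; ring
  have hunits := fast_units_le (P := ⟨n, k, q, e, R, D, h⟩) (W := W) hn hq hh hR1
  change _ ≤ 528 * β ^ 2 * (n ^ 20 * R ^ h * len W * q ^ 2) at hunits
  calc _ ≤ ((528 * β ^ 2 * (n ^ 20 * R ^ h * len W * q ^ 2) : ℕ) : ℝ) := by exact_mod_cast hunits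
    _ = 528 * (β : ℝ) ^ 2 * ((n : ℝ) ^ 20 * (R : ℝ) ^ h * len W * (q : ℝ) ^ 2) := by push_cast; ring
    _ ≤ 528 * (β : ℝ) ^ 2 * ((C * r ^ n) * ((2 : ℝ) ^ (σ * e) * (2 : ℝ) ^ (σ * n / 3)) *
        (6 * Real.log W) * (q : ℝ) ^ 2) := by
      have := hpoly n
      gcongr
    _ = 528 * (β : ℝ) ^ 2 * (C * (2 : ℝ) ^ (σ * e) * 6) *
        ((r ^ n * (2 : ℝ) ^ (σ * n / 3)) * Real.log W * (q : ℝ) ^ 2) := by ring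
    _ = _ := by rw [hpow]

theorem exists_mask_pop {n k : ℕ} (hk : k ≤ n) : ∃ l < 2 ^ n, pop n l = k := by
  obtain ⟨S, -, hS⟩ := Finset.exists_subset_card_eq (s := (Finset.univ : Finset (Fin n)))
    (n := k) (by simpa using hk)
  obtain ⟨l, hl, h⟩ := exists_mask S
  exact ⟨l, hl, (card_eq_pop h).symm.trans hS⟩

/-! ### Executions on encoded instances. -/

variable {n : ℕ} (G : ArcWeightedDigraph n)

/-- Here Ω = n²q suffices, since q ≥ 2^n already bounds all masks. The search is exact, which is
stronger than the factor (q + 1)/q. -/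
theorem exec_mainProg_brute {k q e R D : ℕ} {U V W : ℕ → ℕ → ℤ} {ε : ℝ} (hn : 1 ≤ n) (hk : k ≤ n)
    (hε : 1 ≤ ε * q) (hq : 2 ^ n ≤ q) (hW : 2 ≤ G.wMax) :
    ∃ t m, Exec (mainProg e R D U V W) (G.encode k q) t m ∧
      G.IsApproxMinCut k ε (ArcWeightedDigraph.output n m) ∧
      t ≤ (mainProg e R D U V W).wt *
        (len (n * n * q) * len (n * n * q * G.wMax) * ((n * n + 1) * (2 ^ n + 1))) := by
  have hnn : 1 ≤ n * n := Nat.mul_pos hn hn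
  have hq1 : 1 ≤ q := Nat.one_le_two_pow.trans hq
  have hqΩ : q ≤ n * n * q := Nat.le_mul_of_pos_left _ hnn
  have hnΩ : n * n ≤ n * n * q := Nat.le_mul_of_pos_right _ hq1
  have hsum : ∑ p ∈ Finset.range (n * n), G.encode k q 2 p ≤ n * n * q * G.wMax := by
    have := sum_encode G k q fun _ => 1
    simp only [mul_one] at this
    rw [this]
    exact (sum_weight_le G).trans (Nat.mul_le_mul_right _ hnΩ)
  obtain ⟨t, m, hE, ht, -, -, l, hl, hopt, hout⟩ := runs_mainProg_brute (n := n) (k := k) (q := q)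
    (e := e) (R := R) (D := D) (U := U) (V := V) (W := W)
    (Nat.le_mul_of_pos_right (n * n * q) (by omega : 0 < G.wMax)) hsum hnΩ
    (hk.trans ((Nat.le_mul_self n).trans hnΩ)) hqΩ (hq.trans hqΩ) hq rfl rfl rfl
    (exists_mask_pop hk) rfl (ok_mainProg e R D U V W) (bdd_encode G hk hnΩ hqΩ (by omega))
  refine ⟨t, m, hE, isApproxMinCut G hε hl (fun l' hl' hk' => ?_) hout, ht⟩
  exact Nat.mul_le_mul (Nat.le_succ q) (hopt l' hl' hk')

/-- The inequality n ≤ 3eh makes three parts of eh bits large enough for all masks of n bits; the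
surplus bits belong to no vertex. -/
theorem exec_mainProg_fast {k q e R D h : ℕ} {U V W : ℕ → ℕ → ℤ} {ε : ℝ} (hn : 1 ≤ n) (hk : k ≤ n)
    (hε : 1 ≤ ε * q) (hq1 : 1 ≤ q) (hq : q < 2 ^ n) (hW : 2 ≤ G.wMax)
    (hS : Arith.IsScheme (2 ^ e) R D U V W) (hD : 0 < D) (hR : (2 ^ e) ^ 2 ≤ R)
    (hh : (n + (3 * e - 1)) / (3 * e) = h) (h1 : 1 ≤ h) (hhn : h ≤ n) (hnh : n ≤ 3 * e * h) :
    ∃ t m, Exec (mainProg e R D U V W) (G.encode k q) t m ∧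
      G.IsApproxMinCut k ε (ArcWeightedDigraph.output n m) ∧
      t ≤ (mainProg e R D U V W).wt * (len ((⟨n, k, q, e, R, D, h⟩ : Params).base ^ n) *
        len ((⟨n, k, q, e, R, D, h⟩ : Params).base ^ n * G.wMax) *
        ((⟨n, k, q, e, R, D, h⟩ : Params).round * (n * n + 1))) := by
  set P : Params := ⟨n, k, q, e, R, D, h⟩ with hP
  have hF : Fits P (P.base ^ n) := fits_base (P := P) hn hq1 hq.le hD hR h1 hhn
  have h2Ω : 2 ^ n ≤ P.base ^ n := by
    refine Nat.pow_le_pow_left ?_ n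
    unfold Params.base
    calc 2 ≤ 2 ^ 20 * (1 * 1 * 1) := by norm_num
      _ ≤ 2 ^ 20 * (P.R * (P.D * P.d) * P.d ^ 3) := by
        gcongr
        · exact hF.R_pos
        · exact Nat.mul_pos hD Params.d_pos
        · exact Nat.pow_pos Params.d_pos
      _ = _ := by ring
  have hqΩ : q ≤ P.base ^ n := hq.le.trans h2Ω
  have hsum : ∑ p ∈ Finset.range (n * n), G.encode k q 2 p ≤ P.base ^ n * G.wMax := by
    have := sum_encode G k q fun _ => 1
    simp only [mul_one] at this
    rw [this]
    exact (sum_weight_le G).trans (Nat.mul_le_mul_right _ hF.nn_le)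
  have hN : 2 ^ n ≤ P.N * P.N * P.N := by
    calc 2 ^ n ≤ 2 ^ (3 * e * h) := Nat.pow_le_pow_right two_pos hnh
      _ = 2 ^ P.s * 2 ^ P.s * 2 ^ P.s := by
        rw [← pow_add, ← pow_add]; congr 1; simp only [hP, Params.s]; ring
      _ = _ := by rw [P.N_eq_two_pow]
  obtain ⟨l₀, hl₀, hk₀⟩ := exists_mask_pop hk
  obtain ⟨t, m, hE, ht, -, -, hres⟩ := runs_mainProg_fast
    (Nat.le_mul_of_pos_right (P.base ^ n) (by omega : 0 < G.wMax)) hF hS hD hn hsum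
    (hk.trans hF.n_le) hqΩ h2Ω hq rfl rfl rfl hh ⟨l₀, hl₀.trans_le hN, hk₀⟩ rfl
    (ok_mainProg e R D U V W) (bdd_encode G hk hF.nn_le hqΩ (by omega))
  obtain ⟨l, hl, hopt, hout⟩ := hres.approx hn (encode_zero G k q) hN
  exact ⟨t, m, hE, isApproxMinCut G hε hl hopt hout, ht⟩

/-- The depth is n/(3e) rounded up. -/
theorem depth_bounds {n e h : ℕ} (hn : 1 ≤ n) (he : 1 ≤ e) (hh : (n + (3 * e - 1)) / (3 * e) = h) :
    1 ≤ h ∧ h ≤ n ∧ n ≤ 3 * e * h ∧ 3 * e * h ≤ n + 3 * e := by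
  have h1 := Nat.div_add_mod (n + (3 * e - 1)) (3 * e)
  have h2 := Nat.mod_lt (n + (3 * e - 1)) (show 0 < 3 * e by omega)
  rw [hh] at h1
  have h3 : n ≤ 3 * e * h := by omega
  have h4 : 3 * e * h ≤ n + 3 * e := by omega
  refine ⟨Nat.pos_of_ne_zero fun h0 => ?_, ?_, h3, h4⟩
  · rw [h0] at h3; omega
  · by_contra hlt
    have : 3 * e * (n + 1) ≤ 3 * e * h := Nat.mul_le_mul_left _ (by omega)
    nlinarith [show 3 * e * h ≤ n + (3 * e - 1) by omega]

end RAM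

theorem mainTheorem8 (τ : ℝ) (hτ : Arith.matMulExponent < τ) :
    ∃ (P : RAM.Prog) (C : ℝ), ∀ (n k : ℕ) (G : ArcWeightedDigraph n) (ε : ℝ),
      0 < ε → 1 ≤ k → k ≤ n → 2 ≤ G.wMax →
      ∃ (t : ℕ) (m : RAM.Mem),
        RAM.Exec P (G.encode k ⌈1 / ε⌉₊) t m ∧
        G.IsApproxMinCut k ε (ArcWeightedDigraph.output n m) ∧
        (t : ℝ) ≤ C * ((2 : ℝ) ^ (τ * n / 3) * Real.log G.wMax * (max 1 (1 / ε)) ^ 2 * (k : ℝ) ^ 2) := by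
  -- The room between σ and τ pays for the polynomial factors in `n`.
  obtain ⟨σ, hσ, hστ⟩ := exists_between hτ
  obtain ⟨e, R, D, U, V, W, he, hD, hS, hdR, hR⟩ := Arith.exists_scheme hσ
  have hR1 : 1 ≤ R := (Nat.pow_pos (Nat.two_pow_pos e)).trans_le hdR
  -- A negative σ would force R < 1.
  have hσ0 : 0 ≤ σ := by
    have h1 : (1 : ℝ) ≤ (2 : ℝ) ^ (σ * e) := le_trans (by exact_mod_cast hR1) hR
    by_contra hneg
    have : (2 : ℝ) ^ (σ * e) < 1 := Real.rpow_lt_one_of_one_lt_of_neg one_lt_two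
      (mul_neg_of_neg_of_pos (not_le.1 hneg) (by exact_mod_cast he))
    linarith
  obtain ⟨C₁, hC₁, h₁⟩ := RAM.exists_brute_bound
  obtain ⟨C₂, hC₂, h₂⟩ := RAM.exists_fast_bound (e := e) (D := D) hστ hσ0 hR1 hR
  set P := RAM.mainProg e R D U V W with hP
  refine ⟨P, P.wt * (C₁ + C₂) * 4, fun n k G ε hε hk hkn hW => ?_⟩
  have hn : 1 ≤ n := hk.trans hkn
  set q := ⌈1 / ε⌉₊ with hq
  have hqε : 1 ≤ ε * q := by
    have := Nat.le_ceil (1 / ε)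
    rwa [div_le_iff₀ hε, mul_comm] at this
  have hq1 : 1 ≤ q := Nat.ceil_pos.2 (by positivity)
  -- Rounding 1/ε up adds less than 1, hence at most doubles max(1, 1/ε).
  have hqM : (q : ℝ) ^ 2 ≤ 4 * max 1 (1 / ε) ^ 2 := by
    have h1 : (q : ℝ) ≤ 2 * max 1 (1 / ε) := by
      have h1 := (Nat.ceil_lt_add_one (a := 1 / ε) (by positivity)).le
      have h2 := le_max_left 1 (1 / ε)
      have h3 := le_max_right 1 (1 / ε)
      rw [← hq] at h1
      linarith
    calc _ ≤ (2 * max 1 (1 / ε)) ^ 2 := pow_le_pow_left₀ (Nat.cast_nonneg _) h1 2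
      _ = _ := by ring
  have hlog : 0 ≤ Real.log G.wMax := Real.log_natCast_nonneg _
  have hk2 : (1 : ℝ) ≤ (k : ℝ) ^ 2 := one_le_pow₀ (by exact_mod_cast hk)
  have hpow : (1 : ℝ) ≤ (2 : ℝ) ^ (τ * n / 3) :=
    Real.one_le_rpow one_le_two (by have := hσ0.trans hστ.le; positivity)
  have hfinal : ∀ {t x : ℕ}, t ≤ P.wt * x →
      (x : ℝ) ≤ (C₁ + C₂) * ((2 : ℝ) ^ (τ * n / 3) * Real.log G.wMax * (q : ℝ) ^ 2) →
      (t : ℝ) ≤ P.wt * (C₁ + C₂) * 4 * ((2 : ℝ) ^ (τ * n / 3) * Real.log G.wMax *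
        (max 1 (1 / ε)) ^ 2 * (k : ℝ) ^ 2) := by
    intro t x ht hx
    calc (t : ℝ) ≤ P.wt * x := by exact_mod_cast ht
      _ ≤ P.wt * ((C₁ + C₂) * ((2 : ℝ) ^ (τ * n / 3) * Real.log G.wMax *
          (4 * max 1 (1 / ε) ^ 2))) := by
        refine mul_le_mul_of_nonneg_left (hx.trans ?_) (Nat.cast_nonneg _)
        gcongr
      _ = P.wt * (C₁ + C₂) * 4 * ((2 : ℝ) ^ (τ * n / 3) * Real.log G.wMax *
          (max 1 (1 / ε)) ^ 2 * 1) := by ring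
      _ ≤ _ := by gcongr
  -- The same comparison that the program makes to choose its branch.
  rcases lt_or_ge q (2 ^ n) with hlt | hge
  · obtain ⟨d1, d2, d3, d4⟩ := RAM.depth_bounds hn he rfl
    obtain ⟨t, m, hE, hA, ht⟩ := RAM.exec_mainProg_fast G hn hkn hqε hq1 hlt hW hS hD hdR rfl d1 d2
      d3
    refine ⟨t, m, hE, hA, hfinal ht ((h₂ n k q _ G.wMax hn hq1 d2 d4 hW).trans ?_)⟩
    gcongr
    linarith
  · obtain ⟨t, m, hE, hA, ht⟩ := RAM.exec_mainProg_brute G (e := e) (R := R) (D := D) (U := U)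
      (V := V) (W := W) hn hkn hqε hge hW
    refine ⟨t, m, hE, hA, hfinal ht ((h₁ n q G.wMax hge hW).trans ?_)⟩
    calc _ = C₁ * (1 * Real.log G.wMax * (q : ℝ) ^ 2) := by ring
      _ ≤ _ := by gcongr; linarith
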